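/- Let $N\ge 2$, $0<\alpha<1$, $2^*_\alpha=\frac{2N}{N-2\alpha}$, $\hat u(\xi)=\int_{\mathbf R^N} e^{-2\pi i x\cdot\xi}u(x)\,dx$ (extended to $L^2$), and let $$H^\alpha(\mathbf R^N)=\Big\{u\in L^2(\mathbf R^N,\mathbf R)\ \Big|\ \|u\|_\alpha^2=\int_{\mathbf R^N}(1+4\pi^2|\xi|^2)^\alpha|\hat u(\xi)|^2\,d\xi<\infty\Big\},$$ a real inner product space with $\langle u,v\rangle_\alpha=\int(1+4\pi^2|\xi|^2)^\alpha\,\hat u\,\overline{\hat v}\,d\xi$. Let $f:\mathbf R^N\times\mathbf R\to\mathbf R$ and $f_\infty:\mathbf R\to\mathbf R$, put $F(x,s)=\int_0^s f(x,t)\,dt$ and $F_\infty(s)=\int_0^s f_\infty(t)\,dt$, and assume: (G1) $f$ is continuous and $f(x,-s)=-f(x,s)$ for all $(x,s)$; (G2) $-\infty<\liminf_{s\to0}\inf_{x}\frac{f(x,s)}{s}\le\limsup_{s\to0}\sup_{x}\frac{f(x,s)}{s}<1$; (G3) $\lim_{|s|\to\infty}\sup_{x}\frac{|f(x,s)|}{|s|^{2^*_\alpha-1}}=0$;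 (G4) there is $s_0>0$ with $\inf_{x}\big(F(x,s_0)-\frac12s_0^2\big)>0$; (G5) $f_\infty$ is continuous and $f(x,\cdot)\to f_\infty$ in $L^\infty_{\rm loc}(\mathbf R)$ as $|x|\to\infty$. Let $J(u)=\frac12\|u\|_\alpha^2-\int F(x,u(x))\,dx$ and $J_\infty(u)=\frac12\|u\|_\alpha^2-\int F_\infty(u)\,dx$ on $H^\alpha(\mathbf R^N)$. Suppose that every weak solution $u\in H^\alpha(\mathbf R^N)$ of $(1-\Delta)^\alpha u=f_\infty(u)$, i.e. every $u$ with $\langle u,\varphi\rangle_\alpha=\int f_\infty(u)\varphi\,dx$ for all $\varphi\in H^\alpha(\mathbf R^N)$, satisfies the Pohozaev identity $$P_\infty(u)=\frac{N-2\alpha}{2}\|u\|_\alpha^2-N\int F_\infty(u)\,dx+\alpha\int(1+4\pi^2|\xi|^2)^{\alpha-1}|\hat u|^2\,d\xi=0.$$ Let $(u_n)$ be a bounded sequence in $H^\alpha(\mathbf R^N)$ with $J(u_n)\to c\in\mathbf R$ and $J'(u_n)\to0$ in the dual space $(H^\alpha(\mathbf R^N))^*$, where $J'$ is the Fréchet derivative.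 Then there exist a subsequence of $(u_n)$, still denoted $(u_n)$, an integer $\ell\ge0$, a function $u_0\in H^\alpha(\mathbf R^N)$, functions $\omega_1,\dots,\omega_\ell\in H^\alpha(\mathbf R^N)$ and sequences $(y_{n,i})_n\subset\mathbf R^N$, $1\le i\le\ell$, such that (i) $|y_{n,i}|\to\infty$ for every $i$, and $|y_{n,i}-y_{n,j}|\to\infty$ for $i\ne j$, as $n\to\infty$; (ii) $J'(u_0)=0$, and $\omega_i\not\equiv0$ and $J_\infty'(\omega_i)=0$ for every $i$; (iii) $\big\|u_n-u_0-\sum_{i=1}^\ell\omega_i(\cdot-y_{n,i})\big\|_\alpha\to0$ and $c=J(u_0)+\sum_{i=1}^\ell J_\infty(\omega_i)$ (for $\ell=0$ the sums are empty). -/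

import Mathlib

open MeasureTheory Filter Topology FourierTransform
open scoped ComplexConjugate

noncomputable section

namespace FracSchrodinger

/-- Euclidean space `ℝ^N`. -/
abbrev RN (N : ℕ) : Type := EuclideanSpace ℝ (Fin N)

/-- The real Lebesgue space `L²(ℝ^N, ℝ)`. -/
abbrev L2R (N : ℕ) : Type := Lp ℝ 2 (volume : Measure (RN N))

/-- The complex Lebesgue space `L²(ℝ^N, ℂ)`. -/
abbrev L2C (N : ℕ) : Type := Lp ℂ 2 (volume : Measure (RN N))

/-- The symbol `(1 + 4π²|ξ|²)^α` of `(1 - Δ)^α`. -/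
def symb {N : ℕ} (α : ℝ) (ξ : RN N) : ℝ := (1 + 4 * Real.pi ^ 2 * ‖ξ‖ ^ 2) ^ α

/-- The Fourier transform `û` of a real `L²` function `u` on `ℝ^N`; it is the continuous
extension to `L²` of `û(ξ) = ∫ e^{-2πi x·ξ} u(x) dx`. -/
def hat {N : ℕ} (u : L2R N) : L2C N := 𝓕 (Complex.ofRealCLM.compLp u)

section Helpers

variable {N : ℕ}

theorem symb_pos (α : ℝ) (ξ : RN N) : 0 < symb α ξ := by
  unfold symb; positivity

theorem continuous_symb (α : ℝ) : Continuous (symb α : RN N → ℝ) := by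
  unfold symb
  refine Continuous.rpow_const (by fun_prop) fun ξ => Or.inl ?_
  positivity

theorem hat_add (u v : L2R N) : hat (u + v) = hat u + hat v := by
  have h : Complex.ofRealCLM.compLp (u + v) =
      Complex.ofRealCLM.compLp u + Complex.ofRealCLM.compLp v :=
    (Complex.ofRealCLM.compLpL 2 (volume : Measure (RN N))).map_add u v
  unfold hat
  rw [h, FourierTransform.fourier_add]

theorem hat_smul (c : ℝ) (u : L2R N) : hat (c • u) = (c : ℂ) • hat u := by
  have h : Complex.ofRealCLM.compLp (c • u) = (c : ℂ) • Complex.ofRealCLM.compLp u := by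
    refine ((Complex.ofRealCLM.compLpL 2 (volume : Measure (RN N))).map_smul c u).trans ?_
    exact RCLike.real_smul_eq_coe_smul (K := ℂ) c _
  unfold hat
  rw [h, FourierTransform.fourier_smul]

theorem hat_zero : hat (0 : L2R N) = 0 := by
  simpa using hat_smul (0 : ℝ) (0 : L2R N)

theorem norm_hat (u : L2R N) : ‖hat u‖ = ‖u‖ := by
  unfold hat
  rw [Lp.norm_fourier_eq, Lp.norm_def, Lp.norm_def]
  congr 1
  refine eLpNorm_congr_norm_ae ?_
  filter_upwards [Complex.ofRealCLM.coeFn_compLp u] with x hx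
  rw [hx]
  simp

theorem coeFn_hat_add (u v : L2R N) :
    ⇑(hat (u + v)) =ᵐ[volume] fun ξ => hat u ξ + hat v ξ := by
  rw [hat_add]
  exact Lp.coeFn_add _ _

theorem coeFn_hat_smul (c : ℝ) (u : L2R N) :
    ⇑(hat (c • u)) =ᵐ[volume] fun ξ => (c : ℂ) * hat u ξ := by
  rw [hat_smul]
  filter_upwards [Lp.coeFn_smul (c : ℂ) (hat u)] with ξ hξ
  rw [hξ]
  rfl

end Helpers

/-- The fractional Sobolev space `H^α(ℝ^N)` as a real subspace of `L²(ℝ^N, ℝ)`: those `u` with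
`∫ (1 + 4π²|ξ|²)^α |û(ξ)|² dξ < ∞`. -/
def sobolevSubmodule (N : ℕ) (α : ℝ) : Submodule ℝ (L2R N) where
  carrier := {u | Integrable (fun ξ => symb α ξ * ‖hat u ξ‖ ^ 2) volume}
  zero_mem' := by
    have h : (fun ξ => symb α ξ * ‖hat (0 : L2R N) ξ‖ ^ 2) =ᵐ[volume] fun _ => (0 : ℝ) := by
      rw [hat_zero]
      filter_upwards [Lp.coeFn_zero ℂ 2 (volume : Measure (RN N))] with ξ hξ
      rw [hξ]
      simp
    exact (integrable_congr h).2 (integrable_zero _ _ _)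
  add_mem' := by
    intro u v hu hv
    refine Integrable.mono' ((hu.add hv).const_mul 2) ?_ ?_
    · exact (continuous_symb α).aestronglyMeasurable.mul
        ((Lp.aestronglyMeasurable (hat (u + v))).norm.pow 2)
    · filter_upwards [coeFn_hat_add u v] with ξ hξ
      have hs := (symb_pos α ξ).le
      rw [hξ, Real.norm_of_nonneg (by positivity)]
      have h1 : ‖hat u ξ + hat v ξ‖ ^ 2 ≤ 2 * (‖hat u ξ‖ ^ 2 + ‖hat v ξ‖ ^ 2) := by
        have h2 := norm_add_le (hat u ξ) (hat v ξ)
        nlinarith [sq_nonneg (‖hat u ξ‖ - ‖hat v ξ‖), norm_nonneg (hat u ξ + hat v ξ),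
          norm_nonneg (hat u ξ), norm_nonneg (hat v ξ)]
      calc _ ≤ symb α ξ * (2 * (‖hat u ξ‖ ^ 2 + ‖hat v ξ‖ ^ 2)) :=
            mul_le_mul_of_nonneg_left h1 hs
        _ = _ := by simp only [Pi.add_apply]; ring
  smul_mem' := by
    intro c u hu
    have h : (fun ξ => symb α ξ * ‖hat (c • u) ξ‖ ^ 2) =ᵐ[volume]
        fun ξ => c ^ 2 * (symb α ξ * ‖hat u ξ‖ ^ 2) := by
      filter_upwards [coeFn_hat_smul c u] with ξ hξ
      rw [hξ, norm_mul, mul_pow, Complex.norm_real, Real.norm_eq_abs, sq_abs]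
      ring
    exact (integrable_congr h).2 (Integrable.const_mul hu _)

/-- The fractional Sobolev space `H^α(ℝ^N)` of real functions. It is a new type, so that it does
not inherit the `L²` norm. -/
def HSpace (N : ℕ) (α : ℝ) : Type := sobolevSubmodule N α

namespace HSpace

variable {N : ℕ} {α : ℝ}

instance : AddCommGroup (HSpace N α) := inferInstanceAs (AddCommGroup (sobolevSubmodule N α))

instance : Module ℝ (HSpace N α) := inferInstanceAs (Module ℝ (sobolevSubmodule N α))

/-- The inclusion `H^α(ℝ^N) ⊂ L²(ℝ^N)`. -/
def toL2 (u : HSpace N α) : L2R N := Subtype.val u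

/-- An element of `H^α(ℝ^N)` as a function on `ℝ^N`. -/
instance : CoeFun (HSpace N α) fun _ => RN N → ℝ := ⟨fun u => ⇑(toL2 u)⟩

theorem integrable_sq (u : HSpace N α) :
    Integrable (fun ξ => symb α ξ * ‖hat u.toL2 ξ‖ ^ 2) volume := u.2

theorem toL2_add (u v : HSpace N α) : (u + v).toL2 = u.toL2 + v.toL2 := rfl

theorem toL2_smul (c : ℝ) (u : HSpace N α) : (c • u).toL2 = c • u.toL2 := rfl

/-- The scalar product `⟨u, v⟩_α = ∫ (1 + 4π²|ξ|²)^α û(ξ) conj(v̂(ξ)) dξ`. This integral is a real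
number for real `u` and `v`, so taking the real part of the integrand does not change it. -/
def scalarProd (u v : HSpace N α) : ℝ :=
  ∫ ξ, symb α ξ * (hat u.toL2 ξ * conj (hat v.toL2 ξ)).re

theorem integrable_scalarProd (u v : HSpace N α) :
    Integrable (fun ξ => symb α ξ * (hat u.toL2 ξ * conj (hat v.toL2 ξ)).re) volume := by
  refine Integrable.mono' (u.integrable_sq.add v.integrable_sq) ?_ ?_
  · refine (continuous_symb α).aestronglyMeasurable.mul ?_
    exact Complex.continuous_re.comp_aestronglyMeasurable
      ((Lp.aestronglyMeasurable _).mul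
        (Complex.continuous_conj.comp_aestronglyMeasurable (Lp.aestronglyMeasurable _)))
  · refine Eventually.of_forall fun ξ => ?_
    have hs := (symb_pos α ξ).le
    have h1 : |(hat u.toL2 ξ * conj (hat v.toL2 ξ)).re| ≤ ‖hat u.toL2 ξ‖ * ‖hat v.toL2 ξ‖ := by
      refine (Complex.abs_re_le_norm _).trans ?_
      rw [norm_mul, RCLike.norm_conj]
    rw [Real.norm_eq_abs, abs_mul, abs_of_nonneg hs, Pi.add_apply, ← mul_add]
    refine mul_le_mul_of_nonneg_left (h1.trans ?_) hs
    nlinarith [sq_nonneg (‖hat u.toL2 ξ‖ - ‖hat v.toL2 ξ‖), sq_nonneg ‖hat u.toL2 ξ‖,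
      sq_nonneg ‖hat v.toL2 ξ‖]

theorem scalarProd_self (u : HSpace N α) :
    scalarProd u u = ∫ ξ, symb α ξ * ‖hat u.toL2 ξ‖ ^ 2 := by
  unfold scalarProd
  congr 1
  funext ξ
  rw [Complex.mul_conj, Complex.normSq_eq_norm_sq, Complex.ofReal_re]

/-- `⟨·,·⟩_α` is a real inner product on `H^α(ℝ^N)`. -/
@[reducible]
def innerCore (N : ℕ) (α : ℝ) : InnerProductSpace.Core ℝ (HSpace N α) where
  inner u v := scalarProd u v
  conj_inner_symm u v := by
    simp only [conj_trivial]
    unfold scalarProd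
    congr 1
    funext ξ
    simp only [Complex.mul_re, Complex.conj_re, Complex.conj_im]
    ring
  re_inner_nonneg u := by
    simp only [RCLike.re_to_real]
    rw [scalarProd_self]
    exact integral_nonneg fun ξ => mul_nonneg (symb_pos α ξ).le (sq_nonneg _)
  add_left u v w := by
    unfold scalarProd
    rw [← integral_add (integrable_scalarProd u w) (integrable_scalarProd v w)]
    refine integral_congr_ae ?_
    filter_upwards [coeFn_hat_add u.toL2 v.toL2] with ξ hξ
    rw [toL2_add, hξ, add_mul, Complex.add_re, mul_add]
  smul_left u v c := by
    simp only [conj_trivial]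
    unfold scalarProd
    rw [← integral_const_mul]
    refine integral_congr_ae ?_
    filter_upwards [coeFn_hat_smul c u.toL2] with ξ hξ
    rw [toL2_smul, hξ, mul_assoc, Complex.re_ofReal_mul]
    ring
  definite u hu := by
    have h0 : scalarProd u u = 0 := hu
    rw [scalarProd_self, integral_eq_zero_iff_of_nonneg
      (fun ξ => mul_nonneg (symb_pos α ξ).le (sq_nonneg _)) u.integrable_sq] at h0
    have h1 : hat u.toL2 = 0 := by
      refine (Lp.eq_zero_iff_ae_eq_zero).2 ?_
      filter_upwards [h0] with ξ hξ
      have h2 : ‖hat u.toL2 ξ‖ ^ 2 = 0 :=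
        (mul_eq_zero.1 hξ).resolve_left (symb_pos α ξ).ne'
      exact norm_eq_zero.1 (pow_eq_zero_iff (two_ne_zero)|>.1 h2)
    have h2 : u.toL2 = 0 := by
      rw [← norm_eq_zero, ← norm_hat, h1, norm_zero]
    exact Subtype.ext h2

instance : NormedAddCommGroup (HSpace N α) := (innerCore N α).toNormedAddCommGroup

instance : InnerProductSpace ℝ (HSpace N α) := InnerProductSpace.ofCore (innerCore N α).toCore

theorem inner_eq (u v : HSpace N α) : inner ℝ u v = scalarProd u v := rfl

/-- `‖u‖_α² = ∫ (1 + 4π²|ξ|²)^α |û(ξ)|² dξ`. -/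
theorem norm_sq_eq (u : HSpace N α) : ‖u‖ ^ 2 = ∫ ξ, symb α ξ * ‖hat u.toL2 ξ‖ ^ 2 := by
  rw [← real_inner_self_eq_norm_sq, inner_eq, scalarProd_self]

end HSpace

section Translation

variable {N : ℕ}

theorem mp_sub (y : RN N) :
    MeasurePreserving (fun x : RN N => x - y) (volume : Measure (RN N)) volume :=
  measurePreserving_sub_right volume y

/-- The character `ξ ↦ e^{-2πi y·ξ}`. -/
def chr (y ξ : RN N) : ℂ := Complex.exp ((-2 * Real.pi * inner ℝ y ξ : ℝ) * Complex.I)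

theorem norm_chr (y ξ : RN N) : ‖chr y ξ‖ = 1 := Complex.norm_exp_ofReal_mul_I _

theorem continuous_chr (y : RN N) : Continuous (chr y) := by
  unfold chr
  fun_prop

theorem norm_chr_mul (y ξ : RN N) (z : ℂ) : ‖chr y ξ * z‖ = ‖z‖ := by
  rw [norm_mul, norm_chr, one_mul]

theorem memLp_chr_mul (y : RN N) (v : L2C N) :
    MemLp (fun ξ => chr y ξ * v ξ) 2 (volume : Measure (RN N)) :=
  (Lp.memLp v).congr_norm
    ((continuous_chr y).aestronglyMeasurable.mul (Lp.aestronglyMeasurable v))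
    (Eventually.of_forall fun ξ => (norm_chr_mul y ξ (v ξ)).symm)

/-- Multiplication by a character on `L²`. -/
def mulChr (y : RN N) (v : L2C N) : L2C N := (memLp_chr_mul y v).toLp _

theorem continuous_mulChr (y : RN N) : Continuous (mulChr y) := by
  refine Isometry.continuous (Isometry.of_dist_eq fun v w => ?_)
  rw [dist_eq_norm, dist_eq_norm, Lp.norm_def, Lp.norm_def]
  congr 1
  refine eLpNorm_congr_norm_ae ?_
  filter_upwards [Lp.coeFn_sub (mulChr y v) (mulChr y w), Lp.coeFn_sub v w,
    (memLp_chr_mul y v).coeFn_toLp, (memLp_chr_mul y w).coeFn_toLp] with ξ h1 h2 h3 h4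
  rw [h1, h2, Pi.sub_apply, Pi.sub_apply]
  unfold mulChr
  rw [h3, h4, ← mul_sub, norm_chr_mul]

theorem fourier_translate_schwartz (y : RN N) (g : SchwartzMap (RN N) ℂ) (ξ : RN N) :
    𝓕 (g.compSubConstCLM ℂ y) ξ = chr y ξ * 𝓕 g ξ := by
  have h := congrFun (VectorFourier.fourierIntegral_comp_add_right Real.fourierChar
    (volume : Measure (RN N)) (innerₗ (RN N)) (fun x => g x) (-y)) ξ
  have e1 : (fun x => g x) ∘ (fun v : RN N => v + -y) = ⇑(g.compSubConstCLM ℂ y) := by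
    funext x
    simp [sub_eq_add_neg]
  rw [e1] at h
  refine h.trans ?_
  rw [Circle.smul_def, smul_eq_mul]
  congr 1
  rw [Real.fourierChar_apply]
  unfold chr
  congr 1
  rw [innerₗ_apply_apply, inner_neg_left]
  push_cast
  ring

theorem fourier_translate (y : RN N) (v : L2C N) :
    𝓕 (Lp.compMeasurePreserving (fun x : RN N => x - y) (mp_sub y) v) = mulChr y (𝓕 v) := by
  refine DenseRange.induction_on
    (p := fun v : L2C N =>
      𝓕 (Lp.compMeasurePreserving (fun x : RN N => x - y) (mp_sub y) v) = mulChr y (𝓕 v))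
    (SchwartzMap.denseRange_toLpCLM (p := 2) ENNReal.ofNat_ne_top) v ?_ ?_
  · refine isClosed_eq ?_ ?_
    · exact (Lp.fourierTransformₗᵢ (RN N) ℂ).continuous.comp
        (Lp.isometry_compMeasurePreserving (mp_sub y)).continuous
    · exact (continuous_mulChr y).comp (Lp.fourierTransformₗᵢ (RN N) ℂ).continuous
  · intro g
    have h1 : Lp.compMeasurePreserving (fun x : RN N => x - y) (mp_sub y) (g.toLp 2) =
        (g.compSubConstCLM ℂ y).toLp 2 := by
      refine Lp.ext ?_
      filter_upwards [Lp.coeFn_compMeasurePreserving (g.toLp 2) (mp_sub y),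
        (mp_sub y).quasiMeasurePreserving.ae (g.coeFn_toLp 2 volume),
        (g.compSubConstCLM ℂ y).coeFn_toLp 2 volume] with x h1 h2 h3
      rw [h1, h3, Function.comp_apply, h2]
      rfl
    change 𝓕 (Lp.compMeasurePreserving (fun x : RN N => x - y) (mp_sub y) (g.toLp 2)) =
      mulChr y (𝓕 (g.toLp 2))
    rw [h1, SchwartzMap.toLp_fourier_eq, SchwartzMap.toLp_fourier_eq]
    refine Lp.ext ?_
    filter_upwards [(𝓕 (g.compSubConstCLM ℂ y)).coeFn_toLp 2 volume,
      (𝓕 g).coeFn_toLp 2 volume, (memLp_chr_mul y ((𝓕 g).toLp 2)).coeFn_toLp] with ξ h1 h2 h3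
    unfold mulChr
    rw [h1, h3, h2, fourier_translate_schwartz]

theorem norm_hat_translate (y : RN N) (u : L2R N) :
    ∀ᵐ ξ ∂(volume : Measure (RN N)),
      ‖hat (Lp.compMeasurePreserving (fun x : RN N => x - y) (mp_sub y) u) ξ‖ = ‖hat u ξ‖ := by
  have h : Complex.ofRealCLM.compLp
      (Lp.compMeasurePreserving (fun x : RN N => x - y) (mp_sub y) u) =
      Lp.compMeasurePreserving (fun x : RN N => x - y) (mp_sub y)
        (Complex.ofRealCLM.compLp u) := by
    refine Lp.ext ?_
    filter_upwards [Complex.ofRealCLM.coeFn_compLp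
        (Lp.compMeasurePreserving (fun x : RN N => x - y) (mp_sub y) u),
      Lp.coeFn_compMeasurePreserving u (mp_sub y),
      Lp.coeFn_compMeasurePreserving (Complex.ofRealCLM.compLp u) (mp_sub y),
      (mp_sub y).quasiMeasurePreserving.ae (Complex.ofRealCLM.coeFn_compLp u)] with x h1 h2 h3 h4
    rw [h1, h2, h3, Function.comp_apply, Function.comp_apply, h4]
  unfold hat
  rw [h, fourier_translate]
  filter_upwards [(memLp_chr_mul y (𝓕 (Complex.ofRealCLM.compLp u))).coeFn_toLp] with ξ hξ
  unfold mulChr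
  rw [hξ, norm_chr_mul]

end Translation

namespace HSpace

variable {N : ℕ} {α : ℝ}

/-- The translate `x ↦ u(x - y)` of `u ∈ H^α(ℝ^N)`, again an element of `H^α(ℝ^N)`. -/
def translate (y : RN N) (u : HSpace N α) : HSpace N α :=
  ⟨Lp.compMeasurePreserving (fun x : RN N => x - y) (mp_sub y) u.toL2, by
    refine (integrable_congr ?_).2 u.integrable_sq
    filter_upwards [norm_hat_translate y u.toL2] with ξ hξ
    rw [hξ]⟩

theorem translate_ae (y : RN N) (u : HSpace N α) :
    ∀ᵐ x ∂(volume : Measure (RN N)), translate y u x = u (x - y) :=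
  Lp.coeFn_compMeasurePreserving u.toL2 (mp_sub y)

end HSpace

/-- The critical Sobolev exponent `2*_α = 2N / (N - 2α)`. -/
def critExp (N : ℕ) (α : ℝ) : ℝ := 2 * N / (N - 2 * α)

/-- The conditions (G1)--(G5) on a nonlinearity `f = f(x,s)` and its limit `f_∞` at infinity. -/
structure Nonlinearity (N : ℕ) (α : ℝ) (f : RN N → ℝ → ℝ) (finf : ℝ → ℝ) : Prop where
  /-- (G1) `f` is continuous on `ℝ^N × ℝ`. -/
  continuous : Continuous (Function.uncurry f)
  /-- (G1) `f` is odd in `s`. -/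
  odd : ∀ x s, f x (-s) = -f x s
  /-- (G2), lower bound; infimum and lower limit are taken in `[-∞,∞]`. -/
  liminf_zero : ⊥ < liminf (fun s : ℝ => ⨅ x, ((f x s / s : ℝ) : EReal)) (𝓝[≠] 0)
  /-- (G2), upper bound; supremum and upper limit are taken in `[-∞,∞]`. -/
  limsup_zero : limsup (fun s : ℝ => ⨆ x, ((f x s / s : ℝ) : EReal)) (𝓝[≠] 0) < 1
  /-- (G3) uniformly subcritical growth; the supremum is taken in `[0,∞]`. -/
  subcritical : Tendsto (fun s : ℝ => ⨆ x, ENNReal.ofReal (|f x s| / |s| ^ (critExp N α - 1)))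
    (cocompact ℝ) (𝓝 0)
  /-- (G4), where `F(x,s) = ∫₀ˢ f(x,t) dt`. -/
  exists_pos : ∃ s₀ : ℝ, 0 < s₀ ∧ ∃ δ : ℝ, 0 < δ ∧
    ∀ x, δ ≤ (∫ t in (0 : ℝ)..s₀, f x t) - s₀ ^ 2 / 2
  /-- (G5) `f_∞` is continuous. -/
  continuous_lim : Continuous finf
  /-- (G5) `f(x,·) → f_∞` in `L^∞_loc(ℝ)`, that is uniformly on compact sets, as `|x| → ∞`. -/
  tendsto_lim : ∀ K : Set ℝ, IsCompact K → TendstoUniformlyOn f finf (cocompact (RN N)) K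

section Functionals

variable {N : ℕ} {α : ℝ}

/-- `J(u) = ½‖u‖_α² - ∫ F(x,u(x)) dx` with `F(x,s) = ∫₀ˢ f(x,t) dt`. -/
def energy (f : RN N → ℝ → ℝ) (u : HSpace N α) : ℝ :=
  ‖u‖ ^ 2 / 2 - ∫ x, (∫ t in (0 : ℝ)..u x, f x t)

/-- `J_∞`, the energy of a nonlinearity that does not depend on `x`. -/
def energyInf (finf : ℝ → ℝ) (u : HSpace N α) : ℝ := energy (fun _ => finf) u

/-- Weak solutions `u ∈ H^α(ℝ^N)` of `(1 - Δ)^α u = g(u)`. -/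
def IsWeakSolution (g : ℝ → ℝ) (u : HSpace N α) : Prop :=
  ∀ φ : HSpace N α, HSpace.scalarProd u φ - ∫ x, g (u x) * φ x = 0

/-- The Pohozaev functional `P_∞`. -/
def pohozaev (finf : ℝ → ℝ) (u : HSpace N α) : ℝ :=
  (N - 2 * α) / 2 * ‖u‖ ^ 2 - N * (∫ x, (∫ t in (0 : ℝ)..u x, finf t))
    + α * ∫ ξ, symb (α - 1) ξ * ‖hat u.toL2 ξ‖ ^ 2

/-- `(u_n)` is a bounded Palais--Smale sequence of `Φ` at level `c`: it is bounded, `Φ(u_n) → c`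
and `Φ'(u_n) → 0` in the dual space, where `Φ'` is the Fréchet derivative. -/
structure IsBoundedPS (Φ : HSpace N α → ℝ) (c : ℝ) (u : ℕ → HSpace N α) : Prop where
  bounded : ∃ C : ℝ, ∀ n, ‖u n‖ ≤ C
  tendsto_level : Tendsto (fun n => Φ (u n)) atTop (𝓝 c)
  tendsto_deriv : Tendsto (fun n => fderiv ℝ Φ (u n)) atTop (𝓝 0)

/-- `u` is a critical point of `Φ`: the Fréchet derivative exists at `u` and vanishes. -/
def IsCritical (Φ : HSpace N α → ℝ) (u : HSpace N α) : Prop :=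
  HasFDerivAt Φ (0 : HSpace N α →L[ℝ] ℝ) u

end Functionals

end FracSchrodinger

end

open FracSchrodinger

/-! The argument is concentration compactness, with concentration detected by low frequencies. Along
a subsequence `u n` converges weakly to some u₀, and J'(u_n) → 0 makes u₀ critical
(`inner_eq_of_weakConv`). Let r_n be u_n minus u₀ and minus the translated profiles found so far; it
is weakly null around the origin and around every centre found so far.

Suppose the parts of r_n with frequencies below some A do not tend to zero uniformly. Then there are
centres z_n at which they stay away from zero. Evaluating a band-limited part at a point is a
continuous functional on H^α, so the translates r_n(· + z_n) have a nonzero weak limit w along a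
subsequence (`exists_profile_of_not_vanishes`). The centres z_n must drift away from the origin and
from the earlier centres. Hence the equation seen from z_n tends to the one with f_∞, and w is
critical for J_∞. Removing w splits the squared norm by expanding the scalar product, and splits ∫F
by a Brezis–Lieb argument (`tendsto_nl_sub`). Nonzero critical points of J_∞ have norm at least some
ρ > 0 (`exists_le_norm_of_critical`), while the squared norms of the profiles add up to at most K²,
where K bounds `u n`. So the extraction stops (`exists_vanishes`).

It stops with a remainder whose low frequencies vanish uniformly. As high frequencies carry little
L² mass, the integral of r_n² over {|r_n| > δ} tends to zero. Now J'(u_n) is tested with r_n. The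
slope of f at zero is below one, so f(x,u_n) r_n is at most (1 - η) r_n² plus errors: mixed terms
|u_n - r_n| |r_n|, which tend to zero in L¹, the tail above, and ε times critical powers
(`exists_mul_remainder_le`). The main term is absorbed by ‖r_n‖², and r_n → 0 strongly
(`tendsto_norm_of_vanishes`).

One frequency splitting supplies the analysis. The part below A is bounded pointwise by D
A^((N-2α)/2) ‖u‖, and the rest has squared L² norm at most A^(-2α) ‖u‖². This yields the critical
Sobolev inequality (`exists_sobolev`) and local compactness (`exists_subseq_ae_of_weakConv`). Limits
of nonlinear integrals then follow from `tendsto_integral_of_le_add`, a dominated convergence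
theorem fed by Young inequalities for s² + |s|^p. -/

noncomputable section

namespace FracSchrodinger

/-! ### Plancherel identities and the symbol -/

section Hat
variable {N : ℕ}

theorem hat_sub (u v : L2R N) : hat (u - v) = hat u - hat v := by
  have h := hat_add (u - v) v
  rw [sub_add_cancel] at h
  rw [h, add_sub_cancel_right]

theorem isometry_hat : Isometry (hat : L2R N → L2C N) :=
  Isometry.of_dist_eq fun u v => by rw [dist_eq_norm, dist_eq_norm, ← hat_sub, norm_hat]

theorem symb_mul (a b : ℝ) (ξ : RN N) : symb a ξ * symb b ξ = symb (a + b) ξ := by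
  unfold symb
  rw [Real.rpow_add (by positivity)]

theorem one_le_symb {α : ℝ} (hα : 0 ≤ α) (ξ : RN N) : 1 ≤ symb α ξ :=
  Real.one_le_rpow (by nlinarith [sq_nonneg (Real.pi * ‖ξ‖)]) hα

theorem symb_neg_mul (a : ℝ) (ξ : RN N) : symb (-a) ξ * symb a ξ = 1 := by
  rw [symb_mul, neg_add_cancel]; simp [symb]

theorem symb_half_sq (α : ℝ) (ξ : RN N) : symb (α / 2) ξ ^ 2 = symb α ξ := by
  rw [sq, symb_mul]; congr 1; ring

theorem symb_le_one {α : ℝ} (hα : 0 ≤ α) (ξ : RN N) : symb (-α) ξ ≤ 1 := by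
  have h1 := symb_neg_mul α ξ
  have h2 := one_le_symb hα ξ
  nlinarith [symb_pos (-α) ξ]

theorem norm_sq_L2C (g : L2C N) : ‖g‖ ^ 2 = ∫ ξ, ‖g ξ‖ ^ 2 := by
  have h := L2.inner_def (𝕜 := ℂ) g g
  rw [inner_self_eq_norm_sq_to_K] at h
  have h2 : ∀ ξ, inner ℂ (g ξ) (g ξ) = ((‖g ξ‖ ^ 2 : ℝ) : ℂ) := fun ξ => by
    rw [inner_self_eq_norm_sq_to_K]; simp
  simp_rw [h2] at h
  rw [integral_complex_ofReal] at h
  exact Complex.ofReal_injective (by simpa using h)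

theorem norm_sq_L2R (g : L2R N) : ‖g‖ ^ 2 = ∫ ξ, g ξ ^ 2 := by
  have h := L2.inner_def (𝕜 := ℝ) g g
  rw [real_inner_self_eq_norm_sq] at h
  rw [h]
  congr 1
  funext ξ
  simp [sq]

theorem integrable_norm_sq_L2C (g : L2C N) : Integrable fun ξ => ‖g ξ‖ ^ 2 :=
  (memLp_two_iff_integrable_sq_norm (Lp.aestronglyMeasurable g)).1 (Lp.memLp g)

theorem integrable_sq_L2R (g : L2R N) : Integrable fun ξ => g ξ ^ 2 :=
  (memLp_two_iff_integrable_sq (Lp.aestronglyMeasurable g)).1 (Lp.memLp g)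

end Hat

/-! ### Completeness and separability of H^α -/

namespace HSpace
variable {N : ℕ} {α : ℝ}

theorem toL2_sub (u v : HSpace N α) : (u - v).toL2 = u.toL2 - v.toL2 := rfl
theorem toL2_zero : (0 : HSpace N α).toL2 = 0 := rfl

theorem coe_add (u v : HSpace N α) : ⇑(u + v) =ᵐ[volume] fun x => u x + v x := by
  rw [toL2_add]; exact Lp.coeFn_add _ _

theorem coe_sub (u v : HSpace N α) : ⇑(u - v) =ᵐ[volume] fun x => u x - v x := by
  rw [toL2_sub]; exact Lp.coeFn_sub _ _

theorem coe_smul (c : ℝ) (u : HSpace N α) : ⇑(c • u) =ᵐ[volume] fun x => c * u x := by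
  rw [toL2_smul]; exact Lp.coeFn_smul _ _

theorem coe_zero : ⇑(0 : HSpace N α) =ᵐ[volume] fun _ => (0 : ℝ) := by
  rw [toL2_zero]; exact Lp.coeFn_zero _ _ _

theorem coe_sum {ι : Type*} (s : Finset ι) (u : ι → HSpace N α) :
    ⇑(∑ i ∈ s, u i) =ᵐ[volume] fun x => ∑ i ∈ s, u i x := by
  classical
  induction s using Finset.induction_on with
  | empty => simpa using coe_zero
  | insert a s ha ih =>
    rw [Finset.sum_insert ha]
    filter_upwards [coe_add (u a) (∑ i ∈ s, u i), ih] with x h1 h2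
    rw [h1, h2, Finset.sum_insert ha]

theorem norm_toL2_le (hα : 0 ≤ α) (u : HSpace N α) : ‖u.toL2‖ ≤ ‖u‖ := by
  refine (sq_le_sq₀ (norm_nonneg _) (norm_nonneg _)).1 ?_
  rw [← norm_hat, norm_sq_L2C, norm_sq_eq]
  refine integral_mono (integrable_norm_sq_L2C _) u.integrable_sq fun ξ => ?_
  have := one_le_symb hα ξ
  nlinarith [sq_nonneg ‖hat u.toL2 ξ‖]

theorem integral_sq_le (hα : 0 ≤ α) (u : HSpace N α) : ∫ x, u x ^ 2 ≤ ‖u‖ ^ 2 := by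
  rw [← norm_sq_L2R]
  gcongr
  exact norm_toL2_le hα u

theorem memLp_weightedHat (u : HSpace N α) :
    MemLp (fun ξ => (symb (α / 2) ξ : ℂ) * hat u.toL2 ξ) 2 (volume : Measure (RN N)) := by
  refine (memLp_two_iff_integrable_sq_norm ?_).2 ?_
  · exact ((Complex.continuous_ofReal.comp (continuous_symb _)).aestronglyMeasurable).mul
      (Lp.aestronglyMeasurable _)
  · refine u.integrable_sq.congr (Eventually.of_forall fun ξ => ?_)
    simp only [norm_mul, mul_pow, Complex.norm_real, Real.norm_eq_abs, sq_abs, symb_half_sq]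

/-- The isometric embedding `u ↦ (1 + 4π²|ξ|²)^{α/2} û` of `H^α` into `L²`. -/
def weightedHat : HSpace N α →ₗᵢ[ℝ] L2C N where
  toFun u := (memLp_weightedHat u).toLp _
  map_add' u v := by
    rw [← MemLp.toLp_add]
    refine MemLp.toLp_congr _ _ ?_
    filter_upwards [coeFn_hat_add u.toL2 v.toL2] with ξ h
    simp only [Pi.add_apply, toL2_add, h, mul_add]
  map_smul' c u := by
    refine Lp.ext ?_
    filter_upwards [(memLp_weightedHat (c • u)).coeFn_toLp, (memLp_weightedHat u).coeFn_toLp,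
      Lp.coeFn_smul c ((memLp_weightedHat u).toLp _), coeFn_hat_smul c u.toL2] with ξ h1 h2 h3 h4
    simp only [RingHom.id_apply]
    rw [h1, h3, Pi.smul_apply, h2, toL2_smul, h4, Complex.real_smul]
    ring
  norm_map' u := by
    refine (sq_eq_sq₀ (norm_nonneg _) (norm_nonneg _)).1 ?_
    rw [norm_sq_L2C, norm_sq_eq]
    refine integral_congr_ae ?_
    filter_upwards [(memLp_weightedHat u).coeFn_toLp] with ξ h
    simp only [LinearMap.coe_mk, AddHom.coe_mk]
    rw [h, norm_mul, mul_pow, Complex.norm_real, Real.norm_eq_abs, sq_abs, symb_half_sq]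

theorem coeFn_weightedHat (u : HSpace N α) :
    ⇑(weightedHat u) =ᵐ[volume] fun ξ => (symb (α / 2) ξ : ℂ) * hat u.toL2 ξ :=
  (memLp_weightedHat u).coeFn_toLp

/-- Separability is inherited from L² through the isometry `weightedHat`; it is what makes
Banach–Alaoglu sequential. -/
instance : TopologicalSpace.SeparableSpace (HSpace N α) := by
  have : Fact ((2 : ENNReal) ≠ ⊤) := ⟨ENNReal.ofNat_ne_top⟩
  have : SecondCountableTopology (HSpace N α) :=
    (weightedHat (N := N) (α := α)).isometry.isEmbedding.secondCountableTopology
  infer_instance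

theorem memLp_symb_mul {β : ℝ} (hβ : 0 ≤ β) (g : L2C N) :
    MemLp (fun ξ => (symb (-β) ξ : ℂ) * g ξ) 2 (volume : Measure (RN N)) := by
  refine (Lp.memLp g).mono (((Complex.continuous_ofReal.comp
    (continuous_symb _)).aestronglyMeasurable).mul (Lp.aestronglyMeasurable _))
    (Eventually.of_forall fun ξ => ?_)
  rw [norm_mul, Complex.norm_real, Real.norm_eq_abs, abs_of_pos (symb_pos _ _)]
  exact mul_le_of_le_one_left (norm_nonneg _) (symb_le_one hβ ξ)

theorem lipschitz_symb_mul {β : ℝ} (hβ : 0 ≤ β) :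
    LipschitzWith 1 fun g : L2C N => (memLp_symb_mul hβ g).toLp _ := by
  refine LipschitzWith.of_dist_le_mul fun g h => ?_
  rw [NNReal.coe_one, one_mul, dist_eq_norm, dist_eq_norm, ← MemLp.toLp_sub]
  refine Lp.norm_le_norm_of_ae_le ?_
  filter_upwards [((memLp_symb_mul hβ g).sub (memLp_symb_mul hβ h)).coeFn_toLp,
    Lp.coeFn_sub g h] with ξ h1 h2
  rw [h1, h2, Pi.sub_apply, Pi.sub_apply, ← mul_sub, norm_mul, Complex.norm_real,
    Real.norm_eq_abs, abs_of_pos (symb_pos _ _)]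
  exact mul_le_of_le_one_left (norm_nonneg _) (symb_le_one hβ ξ)

/-- An L² function g lies in the range exactly when g divided by (1 + 4π²|ξ|²)^(α/2) is the
transform of a real function. So the range is the preimage, under a Lipschitz map, of the range of
`hat`, which is closed because `hat` is an isometry on a complete space. -/
theorem isClosed_range_weightedHat (hα : 0 ≤ α) :
    IsClosed (Set.range (weightedHat : HSpace N α → L2C N)) := by
  have hβ : 0 ≤ α / 2 := by linarith
  have h : Set.range (weightedHat : HSpace N α → L2C N) =
      (fun g : L2C N => (memLp_symb_mul hβ g).toLp _) ⁻¹' Set.range (hat : L2R N → L2C N) := by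
    ext g
    constructor
    · rintro ⟨u, rfl⟩
      refine ⟨u.toL2, Lp.ext ?_⟩
      filter_upwards [(memLp_symb_mul hβ (weightedHat u)).coeFn_toLp, coeFn_weightedHat u]
        with ξ h1 h2
      rw [h1, h2, ← mul_assoc, ← Complex.ofReal_mul, symb_neg_mul, Complex.ofReal_one, one_mul]
    · rintro ⟨v, hv⟩
      have h3 : ∀ᵐ ξ ∂(volume : Measure (RN N)), (symb (α / 2) ξ : ℂ) * hat v ξ = g ξ := by
        filter_upwards [(memLp_symb_mul hβ g).coeFn_toLp] with ξ h1
        rw [hv, h1, ← mul_assoc, ← Complex.ofReal_mul, mul_comm (symb (α / 2) ξ), symb_neg_mul,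
          Complex.ofReal_one, one_mul]
      have hm : v ∈ sobolevSubmodule N α := by
        refine (integrable_norm_sq_L2C g).congr ?_
        filter_upwards [h3] with ξ h1
        rw [← h1, norm_mul, mul_pow, Complex.norm_real, Real.norm_eq_abs, sq_abs, symb_half_sq]
      refine ⟨⟨v, hm⟩, Lp.ext ?_⟩
      filter_upwards [coeFn_weightedHat (⟨v, hm⟩ : HSpace N α), h3] with ξ h1 h2
      rw [h1, ← h2]
      rfl
  rw [h]
  exact (isometry_hat.isClosedEmbedding.isClosed_range).preimage (lipschitz_symb_mul hβ).continuous

theorem completeSpace (hα : 0 ≤ α) : CompleteSpace (HSpace N α) :=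
  (completeSpace_iff_isComplete_range
    (weightedHat (N := N) (α := α)).isometry.isUniformInducing).2
    (isClosed_range_weightedHat hα).isComplete

end HSpace

/-! ### Weak sequential convergence -/

/-- Weak convergence of sequences in a real inner product space. -/
def WeakConv {E : Type*} [NormedAddCommGroup E] [InnerProductSpace ℝ E] (v : ℕ → E) (w : E) :
    Prop :=
  ∀ φ, Tendsto (fun n => inner ℝ (v n) φ) atTop (𝓝 (inner ℝ w φ))

namespace WeakConv
variable {E : Type*} [NormedAddCommGroup E] [InnerProductSpace ℝ E] {v w : ℕ → E} {a b : E}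

theorem comp (h : WeakConv v a) {k : ℕ → ℕ} (hk : Tendsto k atTop atTop) :
    WeakConv (fun n => v (k n)) a := fun φ => (h φ).comp hk

theorem add (hv : WeakConv v a) (hw : WeakConv w b) : WeakConv (fun n => v n + w n) (a + b) :=
  fun φ => by simpa only [inner_add_left] using (hv φ).add (hw φ)

theorem sub (hv : WeakConv v a) (hw : WeakConv w b) : WeakConv (fun n => v n - w n) (a - b) :=
  fun φ => by simpa only [inner_sub_left] using (hv φ).sub (hw φ)

theorem sum_zero {ι : Type*} (s : Finset ι) {v : ι → ℕ → E} (h : ∀ i ∈ s, WeakConv (v i) 0) :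
    WeakConv (fun n => ∑ i ∈ s, v i n) 0 := fun φ => by
  simp only [sum_inner, inner_zero_left]
  rw [← Finset.sum_const_zero (s := s)]
  exact tendsto_finsetSum s fun i hi => by simpa only [inner_zero_left] using h i hi φ

theorem const (a : E) : WeakConv (fun _ => a) a := fun _ => tendsto_const_nhds

/-- Riesz representation turns the sequence into functionals in a closed ball of the dual, which is
weak-* sequentially compact by separability. -/
theorem exists_subseq [CompleteSpace E] [TopologicalSpace.SeparableSpace E] {C : ℝ}
    (hv : ∀ n, ‖v n‖ ≤ C) : ∃ a : E, ∃ k : ℕ → ℕ, StrictMono k ∧ WeakConv (fun n => v (k n)) a := by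
  let ψ : ℕ → WeakDual ℝ E := fun n => StrongDual.toWeakDual (InnerProductSpace.toDual ℝ E (v n))
  have hm : ∀ n, ψ n ∈ WeakDual.toStrongDual ⁻¹' Metric.closedBall (0 : StrongDual ℝ E) C := by
    intro n
    rw [Set.mem_preimage, mem_closedBall_zero_iff]
    exact ((InnerProductSpace.toDual ℝ E).norm_map (v n)).trans_le (hv n)
  obtain ⟨a, -, k, hk, ha⟩ := WeakDual.isSeqCompact_closedBall ℝ E 0 C hm
  refine ⟨(InnerProductSpace.toDual ℝ E).symm (WeakDual.toStrongDual a), k, hk, fun φ => ?_⟩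
  have h := ((WeakBilin.eval_continuous (topDualPairing ℝ E) φ).tendsto a).comp ha
  have e : inner ℝ ((InnerProductSpace.toDual ℝ E).symm (WeakDual.toStrongDual a)) φ = a φ := by
    rw [InnerProductSpace.toDual_symm_apply]; rfl
  rw [e]
  refine h.congr fun n => ?_
  rfl

/-- Weakly convergent sequences pair to the limit with strongly convergent ones. -/
theorem inner_tendsto {C : ℝ} (hb : ∀ n, ‖v n‖ ≤ C) (hv : WeakConv v a)
    (hw : Tendsto w atTop (𝓝 b)) : Tendsto (fun n => inner ℝ (v n) (w n)) atTop (𝓝 (inner ℝ a b)) := by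
  have h1 : Tendsto (fun n => inner ℝ (v n) (w n - b)) atTop (𝓝 0) := by
    refine squeeze_zero_norm (a := fun n => C * ‖w n - b‖) (fun n => ?_) ?_
    · exact (norm_inner_le_norm _ _).trans (mul_le_mul_of_nonneg_right (hb n) (norm_nonneg _))
    · simpa using (tendsto_iff_norm_sub_tendsto_zero.1 hw).const_mul C
  have h2 := h1.add (hv b)
  simp only [← inner_add_right, sub_add_cancel, zero_add] at h2
  exact h2

/-- Continuous linear functionals are weakly sequentially continuous. -/
theorem map_clm [CompleteSpace E] (hv : WeakConv v a) (L : E →L[ℝ] ℝ) :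
    Tendsto (fun n => L (v n)) atTop (𝓝 (L a)) := by
  have h := hv ((InnerProductSpace.toDual ℝ E).symm L)
  have e : ∀ x, inner ℝ x ((InnerProductSpace.toDual ℝ E).symm L) = L x := fun x => by
    rw [real_inner_comm, InnerProductSpace.toDual_symm_apply]
  simpa only [e] using h

end WeakConv

/-! ### Translations acting on H^α -/

section
variable {N : ℕ}

theorem hat_translate (y : RN N) (u : L2R N) :
    ⇑(hat (Lp.compMeasurePreserving (fun x : RN N => x - y) (mp_sub y) u)) =ᵐ[volume]
      fun ξ => chr y ξ * hat u ξ := by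
  have h : Complex.ofRealCLM.compLp
      (Lp.compMeasurePreserving (fun x : RN N => x - y) (mp_sub y) u) =
      Lp.compMeasurePreserving (fun x : RN N => x - y) (mp_sub y)
        (Complex.ofRealCLM.compLp u) := by
    refine Lp.ext ?_
    filter_upwards [Complex.ofRealCLM.coeFn_compLp
        (Lp.compMeasurePreserving (fun x : RN N => x - y) (mp_sub y) u),
      Lp.coeFn_compMeasurePreserving u (mp_sub y),
      Lp.coeFn_compMeasurePreserving (Complex.ofRealCLM.compLp u) (mp_sub y),
      (mp_sub y).quasiMeasurePreserving.ae (Complex.ofRealCLM.coeFn_compLp u)] with x h1 h2 h3 h4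
    rw [h1, h2, h3, Function.comp_apply, Function.comp_apply, h4]
  unfold hat
  rw [h, fourier_translate]
  exact (memLp_chr_mul y (𝓕 (Complex.ofRealCLM.compLp u))).coeFn_toLp

theorem chr_zero (ξ : RN N) : chr 0 ξ = 1 := by simp [chr]

theorem chr_add (y z ξ : RN N) : chr (y + z) ξ = chr y ξ * chr z ξ := by
  unfold chr
  rw [← Complex.exp_add, inner_add_left]
  push_cast
  ring_nf

theorem chr_eq_fourierChar (y ξ : RN N) : chr y ξ = (Real.fourierChar (-inner ℝ ξ y) : ℂ) := by
  rw [Real.fourierChar_apply, chr, real_inner_comm]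
  push_cast
  ring_nf

theorem conj_chr (y ξ : RN N) : conj (chr y ξ) = chr (-y) ξ := by
  unfold chr
  rw [← Complex.exp_conj, inner_neg_left]
  congr 1
  rw [map_mul, Complex.conj_ofReal, Complex.conj_I]
  push_cast
  ring

end

namespace HSpace
variable {N : ℕ} {α : ℝ}

theorem hat_translate_ae (y : RN N) (u : HSpace N α) :
    ⇑(hat (translate y u).toL2) =ᵐ[volume] fun ξ => chr y ξ * hat u.toL2 ξ :=
  hat_translate y u.toL2

theorem ext_ae {u v : HSpace N α} (h : ⇑u =ᵐ[volume] ⇑v) : u = v :=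
  Subtype.ext (Lp.ext h)

theorem comp_sub_ae {Z : Type*} (y : RN N) {g h : RN N → Z} (H : g =ᵐ[volume] h) :
    (fun x => g (x - y)) =ᵐ[volume] fun x => h (x - y) :=
  (mp_sub y).quasiMeasurePreserving.ae_eq_comp H

theorem translate_add (y : RN N) (u v : HSpace N α) :
    translate y (u + v) = translate y u + translate y v :=
  Subtype.ext (map_add (Lp.compMeasurePreserving (fun x : RN N => x - y) (mp_sub y)) _ _)

theorem translate_sub (y : RN N) (u v : HSpace N α) :
    translate y (u - v) = translate y u - translate y v :=
  Subtype.ext (map_sub (Lp.compMeasurePreserving (fun x : RN N => x - y) (mp_sub y)) _ _)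

theorem translate_sum {ι : Type*} (s : Finset ι) (y : RN N) (u : ι → HSpace N α) :
    translate y (∑ i ∈ s, u i) = ∑ i ∈ s, translate y (u i) :=
  map_sum (AddMonoidHom.mk' (translate y : HSpace N α → HSpace N α) (translate_add y)) u s

theorem translate_translate (y z : RN N) (u : HSpace N α) :
    translate y (translate z u) = translate (y + z) u := by
  refine ext_ae ?_
  filter_upwards [translate_ae y (translate z u), translate_ae (y + z) u,
    comp_sub_ae y (translate_ae z u)] with x h1 h2 h3
  rw [h1, h2, ← sub_sub]
  exact h3

theorem translate_zero (u : HSpace N α) : translate 0 u = u := by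
  refine ext_ae ?_
  filter_upwards [translate_ae 0 u] with x h1
  rw [h1, sub_zero]

theorem inner_translate_translate (y : RN N) (u v : HSpace N α) :
    inner ℝ (translate y u) (translate y v) = (inner ℝ u v : ℝ) := by
  rw [inner_eq, inner_eq]
  refine integral_congr_ae ?_
  filter_upwards [hat_translate_ae y u, hat_translate_ae y v] with ξ h1 h2
  rw [h1, h2, map_mul, mul_mul_mul_comm, conj_chr, ← chr_add, add_neg_cancel, chr_zero, one_mul]

theorem norm_translate (y : RN N) (u : HSpace N α) : ‖translate y u‖ = ‖u‖ := by
  rw [norm_eq_sqrt_real_inner, inner_translate_translate, ← norm_eq_sqrt_real_inner]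

theorem inner_translate_left (y : RN N) (u v : HSpace N α) :
    inner ℝ (translate y u) v = (inner ℝ u (translate (-y) v) : ℝ) := by
  rw [← inner_translate_translate y u, translate_translate, add_neg_cancel, translate_zero]

theorem integrable_inner_density (u v : HSpace N α) :
    Integrable fun ξ => (symb α ξ : ℂ) * (hat u.toL2 ξ * conj (hat v.toL2 ξ)) := by
  refine Integrable.mono' (u.integrable_sq.add v.integrable_sq) ?_ ?_
  · exact (Complex.continuous_ofReal.comp (continuous_symb α)).aestronglyMeasurable.mul
      ((Lp.aestronglyMeasurable _).mul
        (Complex.continuous_conj.comp_aestronglyMeasurable (Lp.aestronglyMeasurable _)))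
  · refine Eventually.of_forall fun ξ => ?_
    have hs := (symb_pos α ξ).le
    rw [norm_mul, norm_mul, RCLike.norm_conj, Complex.norm_real, Real.norm_of_nonneg hs,
      Pi.add_apply, ← mul_add]
    refine mul_le_mul_of_nonneg_left ?_ hs
    nlinarith [sq_nonneg (‖hat u.toL2 ξ‖ - ‖hat v.toL2 ξ‖), sq_nonneg ‖hat u.toL2 ξ‖,
      sq_nonneg ‖hat v.toL2 ξ‖]

/-- A translation multiplies the transform by a character, so the product, as a function of y, is a
Fourier transform of an L¹ density. Continuity in y and decay as |y| → ∞ (Riemann–Lebesgue) both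
follow from this. -/
theorem inner_translate_eq_fourier (y : RN N) (u v : HSpace N α) :
    (inner ℝ (translate y u) v : ℝ) =
      (𝓕 (fun ξ => (symb α ξ : ℂ) * (hat u.toL2 ξ * conj (hat v.toL2 ξ))) y).re := by
  rw [inner_eq, Real.fourier_eq, ← Complex.reCLM_apply, ← ContinuousLinearMap.integral_comp_comm]
  · refine integral_congr_ae ?_
    filter_upwards [hat_translate_ae y u] with ξ h1
    rw [h1, Complex.reCLM_apply, Circle.smul_def, smul_eq_mul, ← chr_eq_fourierChar,
      mul_left_comm, Complex.re_ofReal_mul, mul_assoc]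
  · rw [Real.fourierIntegral_convergent_iff]
    exact integrable_inner_density u v

theorem continuous_inner_translate (u v : HSpace N α) :
    Continuous fun y => (inner ℝ (translate y u) v : ℝ) := by
  simp_rw [inner_translate_eq_fourier]
  refine Complex.continuous_re.comp ?_
  exact VectorFourier.fourierIntegral_continuous Real.continuous_fourierChar
    (show Continuous fun p : RN N × RN N => (inner ℝ p.1 p.2 : ℝ) by fun_prop)
    (integrable_inner_density u v)

/-- Translations preserve the norm, so strong convergence reduces to convergence of the scalar
products with the limit. -/
theorem tendsto_translate {z : ℕ → RN N} {a : RN N} (hz : Tendsto z atTop (𝓝 a))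
    (u : HSpace N α) : Tendsto (fun n => translate (z n) u) atTop (𝓝 (translate a u)) := by
  refine tendsto_iff_norm_sub_tendsto_zero.2 ?_
  have h : Tendsto (fun n => 2 * ‖u‖ ^ 2 - 2 * inner ℝ (translate (z n) u) (translate a u)) atTop
      (𝓝 (2 * ‖u‖ ^ 2 - 2 * inner ℝ (translate a u) (translate a u))) :=
    ((((continuous_inner_translate u (translate a u)).tendsto a).comp hz).const_mul 2).const_sub _
  rw [real_inner_self_eq_norm_sq, norm_translate, sub_self] at h
  have h2 : ∀ n, ‖translate (z n) u - translate a u‖ ^ 2 =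
      2 * ‖u‖ ^ 2 - 2 * inner ℝ (translate (z n) u) (translate a u) := fun n => by
    rw [norm_sub_sq_real, norm_translate, norm_translate]; ring
  simp_rw [← h2] at h
  have h3 := h.sqrt
  simpa only [Real.sqrt_sq (norm_nonneg _), Real.sqrt_zero] using h3

theorem weakConv_translate_of_norm_tendsto {y : ℕ → RN N}
    (hy : Tendsto (fun n => ‖y n‖) atTop atTop) (u : HSpace N α) :
    WeakConv (fun n => translate (y n) u) 0 := fun φ => by
  simp_rw [inner_zero_left, inner_translate_eq_fourier]
  have h := (tendsto_integral_exp_inner_smul_cocompact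
    (fun ξ => (symb α ξ : ℂ) * (hat u.toL2 ξ * conj (hat φ.toL2 ξ)))).comp
    (Metric.cobounded_eq_cocompact (α := RN N) ▸ tendsto_norm_atTop_iff_cobounded.1 hy)
  have := (Complex.continuous_re.tendsto 0).comp h
  exact this

/-- The translation is moved to the test function, where it converges strongly. -/
theorem _root_.FracSchrodinger.WeakConv.translate {v : ℕ → HSpace N α} {w : HSpace N α} {C : ℝ}
    (hb : ∀ n, ‖v n‖ ≤ C) (hv : WeakConv v w) {z : ℕ → RN N} {a : RN N}
    (hz : Tendsto z atTop (𝓝 a)) :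
    WeakConv (fun n => translate (z n) (v n)) (translate a w) := fun φ => by
  simp_rw [inner_translate_left]
  exact hv.inner_tendsto hb (tendsto_translate hz.neg φ)

end HSpace

/-! ### Inverse Fourier integral and integrals of powers of |ξ| -/

section
variable {N : ℕ}

/-- On `L¹ ∩ L²` the inverse Fourier transform on `L²` is given by the Fourier integral. -/
theorem coeFn_fourierInv_of_integrable (g : L2C N) (hg : Integrable (⇑g)) :
    ⇑(𝓕⁻ g : L2C N) =ᵐ[volume] 𝓕⁻ (⇑g) := by
  have hcont : Continuous (𝓕⁻ (⇑g)) := by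
    have h : Continuous (𝓕 (⇑g)) := VectorFourier.fourierIntegral_continuous
      Real.continuous_fourierChar
      (show Continuous fun p : RN N × RN N => (inner ℝ p.1 p.2 : ℝ) by fun_prop) hg
    have e : 𝓕⁻ (⇑g) = fun x => 𝓕 (⇑g) (-x) := funext fun x => Real.fourierInv_eq_fourier_neg _ _
    rw [e]
    exact h.comp continuous_neg
  -- Both sides are tested against smooth compactly supported functions, which are Schwartz
  -- functions; the transform moves to the test function, once by the definition on tempered
  -- distributions and once by Fubini.
  refine ae_eq_of_integral_contDiff_smul_eq ((Lp.memLp _).locallyIntegrable (by norm_num))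
    hcont.locallyIntegrable fun φ hφ hc => ?_
  have hc1 : HasCompactSupport (Complex.ofRealCLM ∘ φ) := hc.comp_left rfl
  have hφ1 : ContDiff ℝ (⊤ : ℕ∞) (Complex.ofRealCLM ∘ φ) := by fun_prop
  set ψ : SchwartzMap (RN N) ℂ := hc1.toSchwartzMap hφ1 with hψ
  have e1 : ∀ x, ψ x = (φ x : ℂ) := fun x => rfl
  have h1 : ∫ x, ψ x • (𝓕⁻ g : L2C N) x = ∫ x, (𝓕⁻ ψ) x • g x := by
    have h := congrArg (fun T => T ψ) (Lp.fourierInv_toTemperedDistribution_eq g)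
    simp only [TemperedDistribution.fourierInv_apply, Lp.toTemperedDistribution_apply] at h
    exact h.symm
  have h2 : ∫ x, (𝓕⁻ ψ) x • g x = ∫ x, ψ x • 𝓕⁻ (⇑g) x := by
    have h := VectorFourier.integral_fourierIntegral_smul_eq_flip (μ := volume) (ν := volume)
      (L := -innerₗ (RN N)) Real.continuous_fourierChar
      (show Continuous fun p : RN N × RN N => -(inner ℝ p.1 p.2 : ℝ) by fun_prop)
      (ψ.integrable) hg
    have e2 : (-innerₗ (RN N)).flip = -innerₗ (RN N) := by
      ext x y
      simp [real_inner_comm]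
    rw [e2] at h
    rw [SchwartzMap.fourierInv_coe]
    exact h
  simp only [Complex.real_smul, ← e1]
  simpa only [smul_eq_mul] using h1.trans h2

theorem isFiniteMeasure_restrict_ball (A : ℝ) :
    IsFiniteMeasure ((volume : Measure (RN N)).restrict (Metric.ball 0 A)) :=
  isFiniteMeasure_restrict.2 measure_ball_lt_top.ne

theorem integrableOn_ball_hat (A : ℝ) (g : L2C N) : IntegrableOn (⇑g) (Metric.ball 0 A) :=
  have := isFiniteMeasure_restrict_ball (N := N) A
  (((Lp.memLp g).restrict _).integrable (by norm_num))

theorem measurableSet_ball_zero (A : ℝ) : MeasurableSet (Metric.ball (0 : RN N) A) :=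
  measurableSet_ball

theorem integrableOn_norm_rpow (hN : 2 ≤ N) {α : ℝ} (hα₁ : α < 1) (A : ℝ) :
    IntegrableOn (fun ξ : RN N => ‖ξ‖ ^ (-(2 * α))) (Metric.ball 0 A) := by
  have hN' : (2 : ℝ) ≤ N := by exact_mod_cast hN
  refine integrableOn_ball_of_norm_le_rpow (C := 1) (α := 2 * α) (by simp; lia)
    (by simp; linarith) (Eventually.of_forall fun ξ => ?_) ?_
  · rw [one_mul, Real.norm_of_nonneg (by positivity)]
  · exact (measurable_norm.pow_const _).aestronglyMeasurable

theorem setIntegral_norm_rpow {α : ℝ} {A : ℝ} (hA : 0 < A) :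
    ∫ ξ in Metric.ball (0 : RN N) A, ‖ξ‖ ^ (-(2 * α)) =
      A ^ ((N : ℝ) - 2 * α) * ∫ ξ in Metric.ball (0 : RN N) 1, ‖ξ‖ ^ (-(2 * α)) := by
  have h := Measure.setIntegral_comp_smul_of_pos (volume : Measure (RN N))
    (fun ξ : RN N => ‖ξ‖ ^ (-(2 * α))) (Metric.ball 0 1) hA
  rw [smul_unitBall_of_pos hA] at h
  have e : ∀ ξ : RN N, ‖A • ξ‖ ^ (-(2 * α)) = A ^ (-(2 * α)) * ‖ξ‖ ^ (-(2 * α)) := fun ξ => by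
    rw [norm_smul, Real.norm_of_nonneg hA.le, Real.mul_rpow hA.le (norm_nonneg _)]
  simp_rw [e] at h
  rw [integral_const_mul] at h
  have h2 : A ^ N * (A ^ N)⁻¹ = 1 := mul_inv_cancel₀ (by positivity)
  simp only [finrank_euclideanSpace, Fintype.card_fin, smul_eq_mul] at h
  rw [sub_eq_add_neg, Real.rpow_add hA, Real.rpow_natCast, mul_assoc, h, ← mul_assoc, h2, one_mul]

theorem symb_neg_le {α : ℝ} (hα₀ : 0 < α) {ξ : RN N} (hξ : ξ ≠ 0) :
    symb (-α) ξ ≤ ‖ξ‖ ^ (-(2 * α)) := by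
  have hpos : 0 < ‖ξ‖ := norm_pos_iff.2 hξ
  have e : ‖ξ‖ ^ (-(2 * α)) = (‖ξ‖ ^ 2) ^ (-α) := by
    rw [← Real.rpow_natCast, ← Real.rpow_mul hpos.le]; congr 1; push_cast; ring
  rw [e]
  unfold symb
  refine Real.rpow_le_rpow_of_nonpos (by positivity) ?_ (by linarith)
  have h1 : 1 ≤ 4 * Real.pi ^ 2 := by nlinarith [Real.pi_gt_three]
  nlinarith [sq_nonneg ‖ξ‖]

theorem le_symb {α : ℝ} (hα₀ : 0 < α) (ξ : RN N) : ‖ξ‖ ^ (2 * α) ≤ symb α ξ := by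
  have e : ‖ξ‖ ^ (2 * α) = (‖ξ‖ ^ 2) ^ α := by
    rw [← Real.rpow_natCast, ← Real.rpow_mul (norm_nonneg _)]; norm_num
  rw [e]
  unfold symb
  refine Real.rpow_le_rpow (by positivity) ?_ hα₀.le
  have h1 : 1 ≤ 4 * Real.pi ^ 2 := by nlinarith [Real.pi_gt_three]
  nlinarith [sq_nonneg ‖ξ‖]

end

/-! ### Splitting into low and high frequencies -/

namespace HSpace
variable {N : ℕ} {α : ℝ}

/-- The part of `u` with frequencies in the ball of radius `A`. -/
def low (A : ℝ) (u : HSpace N α) (x : RN N) : ℂ :=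
  ∫ ξ in Metric.ball 0 A, chr (-x) ξ * hat u.toL2 ξ

theorem low_eq_fourierInv (A : ℝ) (u : HSpace N α) (x : RN N) :
    low A u x = 𝓕⁻ ((Metric.ball 0 A).indicator (hat u.toL2)) x := by
  unfold low
  rw [Real.fourierInv_eq, ← integral_indicator (measurableSet_ball_zero A)]
  congr 1
  funext ξ
  by_cases h : ξ ∈ Metric.ball (0 : RN N) A
  · rw [Set.indicator_of_mem h, Set.indicator_of_mem h, Circle.smul_def, smul_eq_mul,
      chr_eq_fourierChar, inner_neg_right, neg_neg]
  · rw [Set.indicator_of_notMem h, Set.indicator_of_notMem h, smul_zero]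

/-- The transform is cut by the indicator of the ball. The inner piece is in L¹ ∩ L², so its inverse
transform is the integral `low`; the outer piece is measured by Plancherel. -/
theorem exists_low_add_high (A : ℝ) (u : HSpace N α) :
    ∃ g : L2C N, (∀ᵐ x, (u x : ℂ) = low A u x + g x) ∧
      ∫ x, ‖g x‖ ^ 2 = ∫ ξ in (Metric.ball 0 A)ᶜ, ‖hat u.toL2 ξ‖ ^ 2 := by
  have hB := measurableSet_ball_zero (N := N) A
  set v : L2C N := hat u.toL2 with hv
  have hm1 : MemLp ((Metric.ball 0 A).indicator v) 2 (volume : Measure (RN N)) :=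
    (Lp.memLp v).indicator hB
  have hm2 : MemLp ((Metric.ball 0 A)ᶜ.indicator v) 2 (volume : Measure (RN N)) :=
    (Lp.memLp v).indicator hB.compl
  have hsum : v = hm1.toLp _ + hm2.toLp _ := by
    refine Lp.ext ?_
    filter_upwards [Lp.coeFn_add (hm1.toLp _) (hm2.toLp _), hm1.coeFn_toLp, hm2.coeFn_toLp]
      with ξ h1 h2 h3
    rw [h1, Pi.add_apply, h2, h3, ← Pi.add_apply (Set.indicator _ _), Set.indicator_self_add_compl]
  refine ⟨𝓕⁻ (hm2.toLp _), ?_, ?_⟩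
  · have h1 : Complex.ofRealCLM.compLp u.toL2 = 𝓕⁻ (hm1.toLp _) + 𝓕⁻ (hm2.toLp _) := by
      rw [← FourierTransform.fourierInv_add, ← hsum, hv]
      unfold hat
      rw [FourierTransform.fourierInv_fourier_eq]
    have hint : Integrable (⇑(hm1.toLp _)) :=
      ((integrable_indicator_iff hB).2 (integrableOn_ball_hat A v)).congr hm1.coeFn_toLp.symm
    filter_upwards [Complex.ofRealCLM.coeFn_compLp u.toL2,
      Lp.coeFn_add (𝓕⁻ (hm1.toLp _) : L2C N) (𝓕⁻ (hm2.toLp _)),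
      coeFn_fourierInv_of_integrable _ hint] with x h2 h3 h4
    have h5 := h2
    rw [h1, h3, Pi.add_apply, h4, Real.fourierInv_congr_ae hm1.coeFn_toLp,
      ← low_eq_fourierInv] at h5
    exact h5.symm
  · have h1 : ‖(𝓕⁻ (hm2.toLp _) : L2C N)‖ = ‖(hm2.toLp _ : L2C N)‖ := by
      rw [← Lp.norm_fourier_eq, FourierTransform.fourier_fourierInv_eq]
    rw [← norm_sq_L2C, h1, norm_sq_L2C, ← integral_indicator hB.compl]
    refine integral_congr_ae ?_
    filter_upwards [hm2.coeFn_toLp] with ξ h2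
    rw [h2]
    by_cases h : ξ ∈ (Metric.ball (0 : RN N) A)ᶜ
    · rw [Set.indicator_of_mem h, Set.indicator_of_mem h]
    · rw [Set.indicator_of_notMem h, Set.indicator_of_notMem h]
      simp

theorem integral_high_le (hα₀ : 0 < α) {A : ℝ} (hA : 0 < A) (u : HSpace N α) :
    ∫ ξ in (Metric.ball 0 A)ᶜ, ‖hat u.toL2 ξ‖ ^ 2 ≤ A ^ (-(2 * α)) * ‖u‖ ^ 2 := by
  rw [norm_sq_eq, ← integral_const_mul]
  refine (setIntegral_mono_on (integrable_norm_sq_L2C _).integrableOn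
    (u.integrable_sq.const_mul (A ^ (-(2 * α)))).integrableOn (measurableSet_ball_zero A).compl
    fun ξ hξ => ?_).trans (setIntegral_le_integral (u.integrable_sq.const_mul _)
      (Eventually.of_forall fun ξ => ?_))
  · rw [Set.mem_compl_iff, mem_ball_zero_iff, not_lt] at hξ
    have h1 : A ^ (2 * α) ≤ symb α ξ :=
      (Real.rpow_le_rpow hA.le hξ (by linarith)).trans (le_symb hα₀ ξ)
    have h2 : 1 ≤ A ^ (-(2 * α)) * symb α ξ := by
      have : A ^ (-(2 * α)) * A ^ (2 * α) = 1 := by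
        rw [← Real.rpow_add hA, neg_add_cancel, Real.rpow_zero]
      rw [← this]
      gcongr
    nlinarith [sq_nonneg ‖hat u.toL2 ξ‖]
  · have := symb_pos α ξ
    show (0 : ℝ) ≤ A ^ (-(2 * α)) * (symb α ξ * ‖hat u.toL2 ξ‖ ^ 2)
    positivity

/-- Cauchy–Schwarz after inserting (1 + 4π²|ξ|²)^(α/2) and its inverse. The inverse weight, squared,
is at most |ξ|^(-2α), which is locally integrable as 2α < N, and scaling gives the power of A. -/
theorem exists_norm_low_le (hN : 2 ≤ N) (hα₀ : 0 < α) (hα₁ : α < 1) :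
    ∃ D : ℝ, 0 < D ∧ ∀ A : ℝ, 0 < A → ∀ (u : HSpace N α) (x : RN N),
      ‖low A u x‖ ≤ D * A ^ (((N : ℝ) - 2 * α) / 2) * ‖u‖ := by
  set I : ℝ := ∫ ξ in Metric.ball (0 : RN N) 1, ‖ξ‖ ^ (-(2 * α)) with hI
  have hI0 : 0 ≤ I := integral_nonneg fun ξ => by positivity
  -- The summand 1 only serves to make the constant positive.
  refine ⟨√I + 1, by positivity, fun A hA u x => ?_⟩
  have : Nontrivial (RN N) := by
    refine Module.nontrivial_of_finrank_pos (R := ℝ) ?_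
    simp; lia
  have h1 : ‖low A u x‖ ≤ ∫ ξ in Metric.ball 0 A, symb (-(α / 2)) ξ * ‖weightedHat u ξ‖ := by
    refine (norm_integral_le_integral_norm _).trans_eq (integral_congr_ae (ae_restrict_of_ae ?_))
    filter_upwards [coeFn_weightedHat u] with ξ h
    rw [h, norm_chr_mul, norm_mul, Complex.norm_real, Real.norm_of_nonneg (symb_pos _ _).le,
      ← mul_assoc, symb_neg_mul, one_mul]
  have h2 := integral_mul_le_Lp_mul_Lq_of_nonneg (μ := volume.restrict (Metric.ball (0 : RN N) A))
    Real.HolderConjugate.two_two (f := fun ξ => symb (-(α / 2)) ξ)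
    (g := fun ξ => ‖weightedHat u ξ‖) (Eventually.of_forall fun ξ => (symb_pos _ _).le)
    (Eventually.of_forall fun ξ => norm_nonneg _) ?_ ?_
  rotate_left
  · have := isFiniteMeasure_restrict_ball (N := N) A
    refine MemLp.mono_exponent (q := ⊤) ?_ le_top
    refine memLp_top_of_bound (continuous_symb _).aestronglyMeasurable 1
      (Eventually.of_forall fun ξ => ?_)
    rw [Real.norm_of_nonneg (symb_pos _ _).le]
    exact symb_le_one (by linarith) ξ
  · rw [ENNReal.ofReal_ofNat]
    exact ((Lp.memLp _).norm).restrict _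
  have h3 : ∫ ξ in Metric.ball (0 : RN N) A, symb (-(α / 2)) ξ ^ (2 : ℝ) ≤
      A ^ ((N : ℝ) - 2 * α) * I := by
    rw [hI, ← setIntegral_norm_rpow hA]
    refine integral_mono_of_nonneg (Eventually.of_forall fun ξ => ?_)
      (integrableOn_norm_rpow hN hα₁ A) (ae_restrict_of_ae ?_)
    · have := symb_pos (-(α / 2)) ξ
      show 0 ≤ symb (-(α / 2)) ξ ^ (2 : ℝ)
      positivity
    · filter_upwards [Measure.ae_ne volume (0 : RN N)] with ξ hξ
      rw [Real.rpow_two, ← neg_div, symb_half_sq]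
      exact symb_neg_le hα₀ hξ
  have h4 : ∫ ξ in Metric.ball (0 : RN N) A, ‖weightedHat u ξ‖ ^ (2 : ℝ) ≤ ‖u‖ ^ 2 := by
    simp only [Real.rpow_two]
    rw [← weightedHat.norm_map u, norm_sq_L2C]
    exact setIntegral_le_integral (integrable_norm_sq_L2C _)
      (Eventually.of_forall fun ξ => by positivity)
  have h30 : 0 ≤ ∫ ξ in Metric.ball (0 : RN N) A, symb (-(α / 2)) ξ ^ (2 : ℝ) :=
    integral_nonneg fun ξ => by have := symb_pos (-(α / 2)) ξ; positivity
  have h40 : 0 ≤ ∫ ξ in Metric.ball (0 : RN N) A, ‖weightedHat u ξ‖ ^ (2 : ℝ) :=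
    integral_nonneg fun ξ => by positivity
  have h5 : (A ^ ((N : ℝ) - 2 * α) * I) ^ (1 / 2 : ℝ) = A ^ (((N : ℝ) - 2 * α) / 2) * √I := by
    rw [Real.mul_rpow (by positivity) hI0, ← Real.rpow_mul hA.le, Real.sqrt_eq_rpow]
    congr 2; ring
  have h6 : (‖u‖ ^ 2) ^ (1 / 2 : ℝ) = ‖u‖ := by
    rw [← Real.sqrt_eq_rpow, Real.sqrt_sq (norm_nonneg _)]
  calc ‖low A u x‖ ≤ _ := h1.trans h2
    _ ≤ (A ^ ((N : ℝ) - 2 * α) * I) ^ (1 / 2 : ℝ) * (‖u‖ ^ 2) ^ (1 / 2 : ℝ) := by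
        gcongr
    _ = √I * A ^ (((N : ℝ) - 2 * α) / 2) * ‖u‖ := by rw [h5, h6]; ring
    _ ≤ (√I + 1) * A ^ (((N : ℝ) - 2 * α) / 2) * ‖u‖ := by
        have := Real.rpow_nonneg hA.le (((N : ℝ) - 2 * α) / 2)
        gcongr
        linarith

theorem integrableOn_low (A : ℝ) (u : HSpace N α) (x : RN N) :
    IntegrableOn (fun ξ => chr (-x) ξ * hat u.toL2 ξ) (Metric.ball 0 A) := by
  refine Integrable.mono (integrableOn_ball_hat A (hat u.toL2)) ?_ (Eventually.of_forall fun ξ => ?_)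
  · exact ((continuous_chr _).aestronglyMeasurable.mul (Lp.aestronglyMeasurable _)).restrict
  · rw [norm_chr_mul]

theorem low_add (A : ℝ) (u v : HSpace N α) (x : RN N) : low A (u + v) x = low A u x + low A v x := by
  unfold low
  rw [← integral_add (integrableOn_low A u x) (integrableOn_low A v x)]
  refine integral_congr_ae (ae_restrict_of_ae ?_)
  filter_upwards [coeFn_hat_add u.toL2 v.toL2] with ξ h
  rw [toL2_add, h, mul_add]

theorem low_smul (A : ℝ) (c : ℝ) (u : HSpace N α) (x : RN N) :
    low A (c • u) x = (c : ℂ) * low A u x := by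
  unfold low
  rw [← integral_const_mul]
  refine integral_congr_ae (ae_restrict_of_ae ?_)
  filter_upwards [coeFn_hat_smul c u.toL2] with ξ h
  rw [toL2_smul, h]
  ring

theorem low_translate (A : ℝ) (y : RN N) (u : HSpace N α) (x : RN N) :
    low A (translate y u) x = low A u (x - y) := by
  unfold low
  refine integral_congr_ae (ae_restrict_of_ae ?_)
  filter_upwards [hat_translate_ae y u] with ξ h
  rw [h, ← mul_assoc, ← chr_add]
  congr 2
  abel

theorem continuous_low (A : ℝ) (u : HSpace N α) : Continuous (low A u) := by
  have e : low A u = fun x => 𝓕 ((Metric.ball 0 A).indicator (hat u.toL2)) (-x) :=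
    funext fun x => by rw [low_eq_fourierInv, Real.fourierInv_eq_fourier_neg]
  rw [e]
  have h : Continuous (𝓕 ((Metric.ball 0 A).indicator (hat u.toL2))) :=
    VectorFourier.fourierIntegral_continuous Real.continuous_fourierChar
      (show Continuous fun p : RN N × RN N => (inner ℝ p.1 p.2 : ℝ) by fun_prop)
      ((integrable_indicator_iff (measurableSet_ball_zero A)).2 (integrableOn_ball_hat A _))
  exact h.comp continuous_neg

/-- Low frequency parts of weakly convergent sequences converge pointwise. -/
theorem tendsto_low (hN : 2 ≤ N) (hα₀ : 0 < α) (hα₁ : α < 1) {A : ℝ} (hA : 0 < A)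
    {v : ℕ → HSpace N α} {w : HSpace N α} (hv : WeakConv v w) (x : RN N) :
    Tendsto (fun n => low A (v n) x) atTop (𝓝 (low A w x)) := by
  have := completeSpace (N := N) hα₀.le
  obtain ⟨D, hD, h⟩ := exists_norm_low_le (N := N) hN hα₀ hα₁
  let L : HSpace N α →L[ℝ] ℂ := LinearMap.mkContinuous
    { toFun := fun u => low A u x
      map_add' := fun u v => low_add A u v x
      map_smul' := fun c u => by rw [low_smul, RingHom.id_apply, Complex.real_smul] }
    (D * A ^ (((N : ℝ) - 2 * α) / 2)) fun u => h A hA u x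
  have hre := hv.map_clm (Complex.reCLM.comp L)
  have him := hv.map_clm (Complex.imCLM.comp L)
  have h1 := ((Complex.continuous_ofReal.tendsto _).comp hre).add
    (((Complex.continuous_ofReal.tendsto _).comp him).mul_const Complex.I)
  have e : ∀ u : HSpace N α, ((Complex.reCLM.comp L u : ℝ) : ℂ) +
      ((Complex.imCLM.comp L u : ℝ) : ℂ) * Complex.I = low A u x := fun u =>
    Complex.re_add_im (low A u x)
  simpa only [Function.comp_apply, e] using h1

end HSpace

/-! ### The critical Sobolev inequality -/

theorem sub_two_mul_pos {N : ℕ} {α : ℝ} (hN : 2 ≤ N) (hα₁ : α < 1) : 0 < (N : ℝ) - 2 * α := by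
  have : (2 : ℝ) ≤ N := by exact_mod_cast hN
  linarith

/-- The scaling relation behind the critical exponent: the growth exponent of the low-frequency
bound, times p - 2, is exactly the order 2α of the symbol. -/
theorem critExp_sub_two {N : ℕ} {α : ℝ} (hN : 2 ≤ N) (hα₁ : α < 1) :
    (((N : ℝ) - 2 * α) / 2) * (critExp N α - 2) = 2 * α := by
  have := sub_two_mul_pos hN hα₁
  unfold critExp
  field_simp
  ring

theorem two_lt_critExp {N : ℕ} {α : ℝ} (hN : 2 ≤ N) (hα₀ : 0 < α) (hα₁ : α < 1) :
    2 < critExp N α := by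
  have h1 := sub_two_mul_pos hN hα₁
  have h2 := critExp_sub_two hN hα₁
  by_contra! h
  nlinarith

namespace HSpace
variable {N : ℕ} {α : ℝ}

theorem lintegral_layer {p T : ℝ} (hp : 2 < p) (hT : 0 ≤ T) :
    ∫⁻ t in Set.Ioi (0 : ℝ), (Set.Iic T).indicator (fun t => ENNReal.ofReal (t ^ (p - 3))) t =
      ENNReal.ofReal (T ^ (p - 2) / (p - 2)) := by
  rw [lintegral_indicator measurableSet_Iic, Measure.restrict_restrict measurableSet_Iic,
    Set.Iic_inter_Ioi, ← ofReal_integral_eq_lintegral_ofReal]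
  · rw [← intervalIntegral.integral_of_le hT, integral_rpow (Or.inl (by linarith))]
    have e : p - 3 + 1 = p - 2 := by ring
    rw [e, Real.zero_rpow (by linarith), sub_zero]
  · exact (intervalIntegral.intervalIntegrable_rpow' (by linarith)).1
  · filter_upwards [ae_restrict_mem measurableSet_Ioc] with t ht
    exact Real.rpow_nonneg ht.1.le _

/-- Weak type bound for the super-level sets of `u` by its high frequencies. -/
theorem volume_superlevel_le (u : HSpace N α) {A t : ℝ} (ht : 0 < t)
    (hlow : ∀ x, ‖low A u x‖ ≤ t / 2) :
    volume {x | t < |u x|} ≤ ENNReal.ofReal (4 / t ^ 2) *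
      ∫⁻ ξ in (Metric.ball 0 A)ᶜ, ENNReal.ofReal (‖hat u.toL2 ξ‖ ^ 2) := by
  obtain ⟨g, hg, hg2⟩ := exists_low_add_high A u
  have hint := (integrable_norm_sq_L2C (hat u.toL2)).integrableOn (s := (Metric.ball 0 A)ᶜ)
  rw [← ofReal_integral_eq_lintegral_ofReal hint (Eventually.of_forall fun ξ => by positivity),
    ← hg2, ofReal_integral_eq_lintegral_ofReal (integrable_norm_sq_L2C g)
      (Eventually.of_forall fun ξ => by positivity)]
  have h1 : volume {x | t < |u x|} ≤
      volume {x | ENNReal.ofReal ((t / 2) ^ 2) ≤ ENNReal.ofReal (‖g x‖ ^ 2)} := by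
    refine measure_mono_ae ?_
    filter_upwards [hg] with x hx hxt
    refine ENNReal.ofReal_le_ofReal ?_
    have h2 : |u x| ≤ ‖low A u x‖ + ‖g x‖ := by
      rw [← Real.norm_eq_abs, ← Complex.norm_real, hx]
      exact norm_add_le _ _
    have h3 : t < |u x| := hxt
    have := hlow x
    gcongr
    linarith
  refine h1.trans ?_
  have hm : AEMeasurable (fun x => ENNReal.ofReal (‖g x‖ ^ 2)) :=
    ((integrable_norm_sq_L2C g).1.aemeasurable).ennreal_ofReal
  have h4 := meas_ge_le_lintegral_div hm (ε := ENNReal.ofReal ((t / 2) ^ 2))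
    (by simp only [ne_eq, ENNReal.ofReal_eq_zero, not_le]; positivity) ENNReal.ofReal_ne_top
  refine h4.trans_eq ?_
  rw [ENNReal.div_eq_inv_mul, ← ENNReal.ofReal_inv_of_pos (by positivity)]
  congr 2
  field_simp
  norm_num

/-- The critical Sobolev inequality, by splitting into low and high frequencies. -/
theorem exists_sobolev (hN : 2 ≤ N) (hα₀ : 0 < α) (hα₁ : α < 1) :
    ∃ C : ℝ, 0 < C ∧ ∀ u : HSpace N α, Integrable (fun x => |u x| ^ critExp N α) ∧
      ∫ x, |u x| ^ critExp N α ≤ C * ‖u‖ ^ critExp N α := by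
  obtain ⟨D, hD, hlow⟩ := exists_norm_low_le (N := N) hN hα₀ hα₁
  have hp := two_lt_critExp hN hα₀ hα₁
  have hmp := critExp_sub_two hN hα₁
  have hm : 0 < ((N : ℝ) - 2 * α) / 2 := by have := sub_two_mul_pos hN hα₁; linarith
  set p := critExp N α
  set m := ((N : ℝ) - 2 * α) / 2
  refine ⟨p * (4 * ((2 * D) ^ (p - 2) / (p - 2))), ?_, fun u => ?_⟩
  · have : 0 < p - 2 := by linarith
    positivity
  suffices h : ∫⁻ x, ENNReal.ofReal (|u x| ^ p) ≤
      ENNReal.ofReal (p * (4 * ((2 * D) ^ (p - 2) / (p - 2))) * ‖u‖ ^ p) by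
    have hi : Integrable (fun x => |u x| ^ p) := by
      refine ⟨(((Lp.aestronglyMeasurable u.toL2).aemeasurable.abs).pow_const p).aestronglyMeasurable,
        ?_⟩
      rw [hasFiniteIntegral_iff_ofReal (Eventually.of_forall fun x => by positivity)]
      exact h.trans_lt ENNReal.ofReal_lt_top
    refine ⟨hi, ?_⟩
    rw [← ofReal_integral_eq_lintegral_ofReal hi (Eventually.of_forall fun x => by positivity)] at h
    refine (ENNReal.ofReal_le_ofReal_iff ?_).1 h
    have : 0 < p - 2 := by linarith
    positivity
  -- The zero function is set apart because the cut-off radius below involves division by ‖u‖.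
  rcases eq_or_lt_of_le (norm_nonneg u) with hK | hK
  · have hu : u = 0 := norm_eq_zero.1 hK.symm
    have h0 : ∫⁻ x, ENNReal.ofReal (|u x| ^ p) = 0 := by
      rw [hu]
      refine (lintegral_congr_ae ?_).trans lintegral_zero
      filter_upwards [coe_zero (N := N) (α := α)] with x hx
      rw [hx, abs_zero, Real.zero_rpow (by linarith), ENNReal.ofReal_zero]
    rw [h0]
    exact zero_le
  set K := ‖u‖
  set w : RN N → ENNReal := fun ξ => ENNReal.ofReal (‖hat u.toL2 ξ‖ ^ 2) with hw
  have hwm : Measurable w :=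
    ((Lp.stronglyMeasurable (hat u.toL2)).measurable.norm.pow_const 2).ennreal_ofReal
  -- Layer cake formula. For each level t a different cut-off radius is used.
  rw [lintegral_rpow_eq_lintegral_meas_lt_mul _ (Eventually.of_forall fun x => abs_nonneg _)
    (Lp.aestronglyMeasurable u.toL2).aemeasurable.abs (by linarith)]
  have hT : ∀ ξ : RN N, 0 ≤ 2 * D * K * ‖ξ‖ ^ m := fun ξ => by positivity
  have hbound : ∀ t ∈ Set.Ioi (0 : ℝ), volume {x | t < |u x|} * ENNReal.ofReal (t ^ (p - 1)) ≤
      ∫⁻ ξ, 4 * w ξ * (Set.Iic (2 * D * K * ‖ξ‖ ^ m)).indicator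
        (fun t => ENNReal.ofReal (t ^ (p - 3))) t := by
    intro t ht
    have ht' : 0 < t := ht
    -- The radius at which the low-frequency bound D A^m ‖u‖ equals t/2, so that |u| > t forces the
    -- high-frequency part above t/2.
    set A : ℝ := (t / (2 * D * K)) ^ (1 / m) with hA
    have hA0 : 0 < A := by positivity
    have hAm : A ^ m = t / (2 * D * K) := by
      rw [hA, ← Real.rpow_mul (by positivity), one_div_mul_cancel hm.ne', Real.rpow_one]
    have h1 := volume_superlevel_le u ht' (A := A) fun x => by
      refine (hlow A hA0 u x).trans_eq ?_
      rw [hAm]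
      field_simp
      rfl
    calc _ ≤ (ENNReal.ofReal (4 / t ^ 2) * ∫⁻ ξ in (Metric.ball 0 A)ᶜ, w ξ) *
          ENNReal.ofReal (t ^ (p - 1)) := by gcongr
      _ = ∫⁻ ξ in (Metric.ball 0 A)ᶜ, 4 * w ξ * ENNReal.ofReal (t ^ (p - 3)) := by
        have e1 : ENNReal.ofReal (4 / t ^ 2) * ENNReal.ofReal (t ^ (p - 1)) =
            4 * ENNReal.ofReal (t ^ (p - 3)) := by
          have e2 : t ^ (p - 1) = t ^ (p - 3) * t ^ 2 := by
            rw [← Real.rpow_natCast, ← Real.rpow_add ht']; congr 1; push_cast; ring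
          rw [← ENNReal.ofReal_mul (by positivity), ← ENNReal.ofReal_ofNat 4,
            ← ENNReal.ofReal_mul (by norm_num), e2]
          congr 1
          field_simp
        rw [mul_right_comm, e1, ← lintegral_const_mul _ hwm]
        refine lintegral_congr fun ξ => ?_
        ring
      _ ≤ _ := by
        rw [← lintegral_indicator (measurableSet_ball_zero A).compl]
        refine lintegral_mono fun ξ => ?_
        by_cases h : ξ ∈ (Metric.ball (0 : RN N) A)ᶜ
        · rw [Set.indicator_of_mem h, Set.indicator_of_mem]
          rw [Set.mem_compl_iff, mem_ball_zero_iff, not_lt] at h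
          have h2 : A ^ m ≤ ‖ξ‖ ^ m := Real.rpow_le_rpow hA0.le h hm.le
          rw [hAm, div_le_iff₀ (by positivity)] at h2
          show t ≤ _
          linarith
        · rw [Set.indicator_of_notMem h]
          exact zero_le
  have hmeas : Measurable (Function.uncurry fun (t : ℝ) (ξ : RN N) =>
      4 * w ξ * (Set.Iic (2 * D * K * ‖ξ‖ ^ m)).indicator
        (fun t => ENNReal.ofReal (t ^ (p - 3))) t) := by
    have e : (Function.uncurry fun (t : ℝ) (ξ : RN N) =>
      4 * w ξ * (Set.Iic (2 * D * K * ‖ξ‖ ^ m)).indicator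
        (fun t => ENNReal.ofReal (t ^ (p - 3))) t) = fun q : ℝ × RN N => 4 * w q.2 *
          {q : ℝ × RN N | q.1 ≤ 2 * D * K * ‖q.2‖ ^ m}.indicator
            (fun q => ENNReal.ofReal (q.1 ^ (p - 3))) q := by
      funext q
      rfl
    rw [e]
    refine ((hwm.comp measurable_snd).const_mul 4).mul (Measurable.indicator ?_ ?_)
    · exact (measurable_fst.pow_const _).ennreal_ofReal
    · exact measurableSet_le measurable_fst ((measurable_snd.norm.pow_const m).const_mul _)
  have hsymb : ∫⁻ ξ, ENNReal.ofReal (symb α ξ * ‖hat u.toL2 ξ‖ ^ 2) = ENNReal.ofReal (K ^ 2) := by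
    rw [← ofReal_integral_eq_lintegral_ofReal u.integrable_sq
      (Eventually.of_forall fun ξ => mul_nonneg (symb_pos α ξ).le (sq_nonneg _)), norm_sq_eq]
  have hp2 : 0 < p - 2 := by linarith
  calc _ ≤ ENNReal.ofReal p * ∫⁻ t in Set.Ioi (0 : ℝ), ∫⁻ ξ, 4 * w ξ *
        (Set.Iic (2 * D * K * ‖ξ‖ ^ m)).indicator (fun t => ENNReal.ofReal (t ^ (p - 3))) t := by
        gcongr 1
        exact setLIntegral_mono' measurableSet_Ioi hbound
    _ = ENNReal.ofReal p * ∫⁻ ξ, 4 * w ξ *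
        ENNReal.ofReal ((2 * D * K * ‖ξ‖ ^ m) ^ (p - 2) / (p - 2)) := by
        -- By Tonelli the integral over levels is done first: the frequency ξ contributes only to
        -- levels t ≤ 2DK|ξ|^m.
        rw [lintegral_lintegral_swap hmeas.aemeasurable]
        congr 1
        refine lintegral_congr fun ξ => ?_
        rw [lintegral_const_mul' _ _ (ENNReal.mul_ne_top (by norm_num) ENNReal.ofReal_ne_top),
          lintegral_layer hp (hT ξ)]
    _ ≤ ENNReal.ofReal p * ∫⁻ ξ, ENNReal.ofReal (4 * ((2 * D * K) ^ (p - 2) / (p - 2))) *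
        ENNReal.ofReal (symb α ξ * ‖hat u.toL2 ξ‖ ^ 2) := by
        refine mul_le_mul' le_rfl (lintegral_mono fun ξ => ?_)
        simp only [hw]
        rw [← ENNReal.ofReal_ofNat 4, ← ENNReal.ofReal_mul (by norm_num),
          ← ENNReal.ofReal_mul (by positivity), ← ENNReal.ofReal_mul (by positivity)]
        refine ENNReal.ofReal_le_ofReal ?_
        -- Here m(p - 2) = 2α turns the result of the t-integration into |ξ|^(2α), which the symbol
        -- dominates.
        have e : (2 * D * K * ‖ξ‖ ^ m) ^ (p - 2) = (2 * D * K) ^ (p - 2) * ‖ξ‖ ^ (2 * α) := by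
          rw [Real.mul_rpow (by positivity) (by positivity), ← Real.rpow_mul (norm_nonneg _), hmp]
        rw [e]
        have h1 := le_symb hα₀ ξ
        calc 4 * ‖hat u.toL2 ξ‖ ^ 2 * ((2 * D * K) ^ (p - 2) * ‖ξ‖ ^ (2 * α) / (p - 2))
            = 4 * ((2 * D * K) ^ (p - 2) / (p - 2)) * (‖ξ‖ ^ (2 * α) * ‖hat u.toL2 ξ‖ ^ 2) := by
              ring
          _ ≤ _ := by gcongr
    _ = _ := by
        rw [lintegral_const_mul' _ _ ENNReal.ofReal_ne_top, hsymb,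
          ← ENNReal.ofReal_mul (by positivity), ← ENNReal.ofReal_mul (by linarith)]
        congr 1
        have e : K ^ p = K ^ (p - 2) * K ^ 2 := by
          rw [← Real.rpow_natCast, ← Real.rpow_add hK]; congr 1; push_cast; ring
        rw [e, Real.mul_rpow (by positivity) hK.le]
        ring

end HSpace

/-! ### Convergence theorems for integrals -/

section Measure
variable {X : Type*} [MeasurableSpace X] {μ : Measure X}

/-- A dominated convergence theorem in which the dominating function may contain arbitrarily small
multiples of an `L¹`-bounded sequence. -/
theorem tendsto_integral_of_le_add {Q A : ℕ → X → ℝ} {B : X → ℝ} {K : ℝ} (hB : Integrable B μ)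
    (hA : ∀ n, Integrable (A n) μ) (hA0 : ∀ n x, 0 ≤ A n x) (hAK : ∀ n, ∫ x, A n x ∂μ ≤ K)
    (hQm : ∀ n, AEStronglyMeasurable (Q n) μ) (hQ0 : ∀ n x, 0 ≤ Q n x)
    (hlim : ∀ᵐ x ∂μ, Tendsto (fun n => Q n x) atTop (𝓝 0))
    (hle : ∀ ε > 0, ∃ C, ∀ᶠ n in atTop, ∀ᵐ x ∂μ, Q n x ≤ C * B x + ε * A n x) :
    Tendsto (fun n => ∫ x, Q n x ∂μ) atTop (𝓝 0) := by
  have hK : 0 ≤ K := (integral_nonneg (hA0 0)).trans (hAK 0)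
  refine tendsto_order.2 ⟨fun a ha => Eventually.of_forall fun n =>
    ha.trans_le (integral_nonneg (hQ0 n)), fun a ha => ?_⟩
  set ε := a / (2 * (K + 1)) with hε
  have hε0 : 0 < ε := by positivity
  obtain ⟨C, hC⟩ := hle ε hε0
  -- The positive part of Q - εA is dominated by |C B| and tends to zero almost everywhere; what is
  -- cut away has integral at most εK < a/2.
  have h1 : Tendsto (fun n => ∫ x, max (Q n x - ε * A n x) 0 ∂μ) atTop (𝓝 (∫ _, (0 : ℝ) ∂μ)) := by
    refine tendsto_integral_filter_of_dominated_convergence (fun x => |C * B x|)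
      (Eventually.of_forall fun n => ?_) (hC.mono fun n hn => ?_) (hB.const_mul C).abs ?_
    · exact ((hQm n).sub ((hA n).1.const_mul ε)).sup aestronglyMeasurable_const
    · filter_upwards [hn] with x hx
      rw [Real.norm_of_nonneg (le_max_right _ _)]
      exact max_le (by linarith [le_abs_self (C * B x)]) (abs_nonneg _)
    · filter_upwards [hlim] with x hx
      refine squeeze_zero (fun n => le_max_right _ _) (fun n => ?_) hx
      exact max_le (by have := mul_nonneg hε0.le (hA0 n x); linarith) (hQ0 n x)
  rw [integral_zero] at h1
  filter_upwards [(tendsto_order.1 h1).2 (a / 2) (by positivity), hC] with n hn hCn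
  have hQi : Integrable (Q n) μ := by
    refine Integrable.mono' ((hB.const_mul C).add ((hA n).const_mul ε)) (hQm n) ?_
    filter_upwards [hCn] with x hx
    rwa [Real.norm_of_nonneg (hQ0 n x)]
  have hmi : Integrable (fun x => max (Q n x - ε * A n x) 0) μ :=
    (hQi.sub ((hA n).const_mul ε)).sup (integrable_zero _ _ _)
  have h2 : ∫ x, Q n x ∂μ ≤ ∫ x, max (Q n x - ε * A n x) 0 + ε * A n x ∂μ := by
    refine integral_mono hQi ?_ fun x => ?_
    · exact hmi.add ((hA n).const_mul ε)
    · linarith [le_max_left (Q n x - ε * A n x) 0]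
  rw [integral_add hmi ((hA n).const_mul ε), integral_const_mul] at h2
  have h3 : ε * ∫ x, A n x ∂μ < a / 2 := by
    have h4 : ε * (K + 1) = a / 2 := by rw [hε]; field_simp
    nlinarith [hAK n]
  linarith

theorem exists_subseq_ae_of_integral_tendsto {G : ℕ → X → ℝ} (hG : ∀ n, Integrable (G n) μ)
    (hG0 : ∀ n x, 0 ≤ G n x) (h : Tendsto (fun n => ∫ x, G n x ∂μ) atTop (𝓝 0)) :
    ∃ k : ℕ → ℕ, StrictMono k ∧ ∀ᵐ x ∂μ, Tendsto (fun n => G (k n) x) atTop (𝓝 0) := by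
  have h1 : Tendsto (fun n => eLpNorm (G n - fun _ => 0) 1 μ) atTop (𝓝 0) := by
    have h2 := (ENNReal.continuous_ofReal.tendsto 0).comp h
    rw [ENNReal.ofReal_zero] at h2
    refine h2.congr fun n => ?_
    rw [Function.comp_apply, ofReal_integral_eq_lintegral_ofReal (hG n)
      (Eventually.of_forall (hG0 n)), eLpNorm_one_eq_lintegral_enorm]
    refine lintegral_congr fun x => ?_
    rw [Pi.sub_apply, sub_zero, Real.enorm_of_nonneg (hG0 n x)]
  exact (tendstoInMeasure_of_tendsto_eLpNorm one_ne_zero (fun n => (hG n).1)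
    aestronglyMeasurable_const h1).exists_seq_tendsto_ae

end Measure

/-! ### Local compactness and vanishing sequences -/

namespace HSpace
variable {N : ℕ} {α : ℝ}

theorem sq_le_low_high {A : ℝ} {u : HSpace N α} {g : L2C N} {x : RN N}
    (h : (u x : ℂ) = low A u x + g x) : u x ^ 2 ≤ 2 * ‖low A u x‖ ^ 2 + 2 * ‖g x‖ ^ 2 := by
  have h2 : |u x| ≤ ‖low A u x‖ + ‖g x‖ := by
    rw [← Real.norm_eq_abs, ← Complex.norm_real, h]
    exact norm_add_le _ _
  rw [← sq_abs]
  nlinarith [abs_nonneg (u x), sq_nonneg (‖low A u x‖ - ‖g x‖), norm_nonneg (low A u x),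
    norm_nonneg (g x)]

theorem exists_cutoff (hα₀ : 0 < α) (K : ℝ) {ε : ℝ} (hε : 0 < ε) :
    ∃ A : ℝ, 0 < A ∧ A ^ (-(2 * α)) * K ^ 2 < ε := by
  have h : Tendsto (fun A : ℝ => A ^ (-(2 * α)) * K ^ 2) atTop (𝓝 (0 * K ^ 2)) :=
    (tendsto_rpow_neg_atTop (by linarith : 0 < 2 * α)).mul_const _
  rw [zero_mul] at h
  obtain ⟨A, h1, h2⟩ := (((tendsto_order.1 h).2 ε hε).and (eventually_gt_atTop 0)).exists
  exact ⟨A, h2, h1⟩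

/-- A weighted form of Rellich's theorem. High frequencies are uniformly small in L²; low ones are
uniformly bounded and tend to zero pointwise by weak convergence, so the integrable weight permits
dominated convergence. -/
theorem tendsto_weighted_integral_sq (hN : 2 ≤ N) (hα₀ : 0 < α) (hα₁ : α < 1)
    {ρ : RN N → ℝ} (hρ : Integrable ρ) (hρ0 : ∀ x, 0 ≤ ρ x) (hρ1 : ∀ x, ρ x ≤ 1)
    {r : ℕ → HSpace N α} {K : ℝ} (hb : ∀ n, ‖r n‖ ≤ K) (hr : WeakConv r 0) :
    Tendsto (fun n => ∫ x, ρ x * r n x ^ 2) atTop (𝓝 0) := by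
  obtain ⟨D, hD, hlow⟩ := exists_norm_low_le (N := N) hN hα₀ hα₁
  refine tendsto_order.2 ⟨fun a ha => Eventually.of_forall fun n => ha.trans_le
    (integral_nonneg fun x => mul_nonneg (hρ0 x) (sq_nonneg _)), fun a ha => ?_⟩
  obtain ⟨A, hA, hAε⟩ := exists_cutoff hα₀ K (show 0 < a / 4 by positivity)
  set E := D * A ^ (((N : ℝ) - 2 * α) / 2) * K
  have hE : ∀ n x, ‖low A (r n) x‖ ≤ E := fun n x =>
    (hlow A hA (r n) x).trans (mul_le_mul_of_nonneg_left (hb n) (by positivity))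
  have hK : 0 ≤ K := (norm_nonneg _).trans (hb 0)
  have hmeas : ∀ n, AEStronglyMeasurable (fun x => ρ x * ‖low A (r n) x‖ ^ 2) := fun n =>
    hρ.1.mul ((continuous_low A (r n)).norm.pow 2).aestronglyMeasurable
  have hdom : ∀ n x, ‖ρ x * ‖low A (r n) x‖ ^ 2‖ ≤ E ^ 2 * ρ x := fun n x => by
    rw [Real.norm_of_nonneg (mul_nonneg (hρ0 x) (sq_nonneg _)), mul_comm (ρ x)]
    exact mul_le_mul_of_nonneg_right (pow_le_pow_left₀ (norm_nonneg _) (hE n x) 2) (hρ0 x)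
  have h1 : Tendsto (fun n => ∫ x, ρ x * ‖low A (r n) x‖ ^ 2) atTop (𝓝 (∫ x : RN N, (0 : ℝ))) := by
    refine tendsto_integral_of_dominated_convergence (fun x => E ^ 2 * ρ x) hmeas
      (hρ.const_mul _) (fun n => Eventually.of_forall (hdom n)) (Eventually.of_forall fun x => ?_)
    have h2 := ((tendsto_low hN hα₀ hα₁ hA hr x).norm.pow 2).const_mul (ρ x)
    have h0 : low A (0 : HSpace N α) x = 0 := by simpa using low_smul A 0 (0 : HSpace N α) x
    simpa [h0] using h2
  rw [integral_zero] at h1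
  filter_upwards [(tendsto_order.1 h1).2 (a / 4) (by positivity)] with n hn
  obtain ⟨g, hg, hg2⟩ := exists_low_add_high A (r n)
  have hg3 : ∫ x, ‖g x‖ ^ 2 < a / 4 := by
    rw [hg2]
    refine (integral_high_le hα₀ hA (r n)).trans_lt (lt_of_le_of_lt ?_ hAε)
    have := hb n
    gcongr
  have hi1 : Integrable (fun x => ρ x * ‖low A (r n) x‖ ^ 2) :=
    Integrable.mono' (hρ.const_mul _) (hmeas n) (Eventually.of_forall (hdom n))
  have hle : ∫ x, ρ x * r n x ^ 2 ≤
      ∫ x, (2 * (ρ x * ‖low A (r n) x‖ ^ 2) + 2 * ‖g x‖ ^ 2) := by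
    refine integral_mono_of_nonneg (Eventually.of_forall fun x =>
      mul_nonneg (hρ0 x) (sq_nonneg _)) ((hi1.const_mul 2).add
        ((integrable_norm_sq_L2C g).const_mul 2)) ?_
    filter_upwards [hg] with x hx
    have h1 := sq_le_low_high hx
    have h2 : ρ x * ‖g x‖ ^ 2 ≤ ‖g x‖ ^ 2 := mul_le_of_le_one_left (sq_nonneg _) (hρ1 x)
    have h3 := mul_le_mul_of_nonneg_left h1 (hρ0 x)
    show ρ x * r n x ^ 2 ≤ 2 * (ρ x * ‖low A (r n) x‖ ^ 2) + 2 * ‖g x‖ ^ 2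
    nlinarith
  rw [integral_add (hi1.const_mul 2) ((integrable_norm_sq_L2C g).const_mul 2),
    integral_const_mul, integral_const_mul] at hle
  linarith

/-- Local compactness: weakly convergent sequences converge almost everywhere along a
subsequence. -/
theorem exists_subseq_ae_of_weakConv (hN : 2 ≤ N) (hα₀ : 0 < α) (hα₁ : α < 1)
    {v : ℕ → HSpace N α} {w : HSpace N α} {K : ℝ} (hb : ∀ n, ‖v n‖ ≤ K) (hv : WeakConv v w) :
    ∃ k : ℕ → ℕ, StrictMono k ∧ ∀ᵐ x, Tendsto (fun n => v (k n) x) atTop (𝓝 (w x)) := by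
  -- A weight that is integrable and positive everywhere: one integral controls all of ℝ^N, and no
  -- diagonal argument over balls is needed.
  set ρ : RN N → ℝ := fun x => (1 + ‖x‖) ^ (-((N : ℝ) + 1)) with hρdef
  have hρ : Integrable ρ := integrable_one_add_norm (by simp)
  have hρ0 : ∀ x, 0 < ρ x := fun x => by positivity
  have hρ1 : ∀ x, ρ x ≤ 1 := fun x =>
    Real.rpow_le_one_of_one_le_of_nonpos (by linarith [norm_nonneg x]) (by
      have : (0 : ℝ) ≤ N := Nat.cast_nonneg _
      linarith)
  have hr : WeakConv (fun n => v n - w) 0 := by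
    simpa only [sub_self] using hv.sub (WeakConv.const w)
  have hrb : ∀ n, ‖v n - w‖ ≤ K + ‖w‖ := fun n =>
    (norm_sub_le _ _).trans (by linarith [hb n])
  have h1 := tendsto_weighted_integral_sq hN hα₀ hα₁ hρ (fun x => (hρ0 x).le) hρ1 hrb hr
  have hint : ∀ n, Integrable (fun x => ρ x * (v n - w) x ^ 2) := fun n => by
    refine Integrable.mono' (integrable_sq_L2R (v n - w).toL2)
      (hρ.1.mul ((Lp.aestronglyMeasurable _).pow 2)) (Eventually.of_forall fun x => ?_)
    rw [Real.norm_of_nonneg (mul_nonneg (hρ0 x).le (sq_nonneg _))]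
    exact mul_le_of_le_one_left (sq_nonneg _) (hρ1 x)
  obtain ⟨k, hk, h2⟩ := exists_subseq_ae_of_integral_tendsto hint
    (fun n x => mul_nonneg (hρ0 x).le (sq_nonneg _)) h1
  refine ⟨k, hk, ?_⟩
  have h3 : ∀ᵐ x, ∀ n, (v n - w) x = v n x - w x := ae_all_iff.2 fun n => coe_sub _ _
  filter_upwards [h2, h3] with x hx hx3
  have h4 := hx.const_mul (ρ x)⁻¹
  simp only [inv_mul_cancel_left₀ (hρ0 x).ne', mul_zero] at h4
  have h5 := h4.sqrt
  simp only [Real.sqrt_sq_eq_abs, Real.sqrt_zero, hx3] at h5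
  exact tendsto_sub_nhds_zero_iff.1 ((tendsto_zero_iff_abs_tendsto_zero _).2 h5)

theorem exists_subseq_weakConv_ae (hN : 2 ≤ N) (hα₀ : 0 < α) (hα₁ : α < 1)
    {v : ℕ → HSpace N α} {K : ℝ} (hb : ∀ n, ‖v n‖ ≤ K) :
    ∃ (w : HSpace N α) (k : ℕ → ℕ), StrictMono k ∧ WeakConv (fun n => v (k n)) w ∧
      ∀ᵐ x, Tendsto (fun n => v (k n) x) atTop (𝓝 (w x)) := by
  have := completeSpace (N := N) hα₀.le
  obtain ⟨w, k, hk, hw⟩ := WeakConv.exists_subseq hb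
  obtain ⟨j, hj, h⟩ := exists_subseq_ae_of_weakConv hN hα₀ hα₁ (fun n => hb (k n)) hw
  exact ⟨w, k ∘ j, hk.comp hj, hw.comp hj.tendsto_atTop, h⟩

/-- The low frequency parts of the sequence tend to zero uniformly. -/
def Vanishes (r : ℕ → HSpace N α) : Prop :=
  ∀ A > 0, ∀ ε > 0, ∀ᶠ n in atTop, ∀ x, ‖low A (r n) x‖ ≤ ε

/-- The square of `s` cut off at height `δ`. -/
def tailSq (δ s : ℝ) : ℝ := if δ < |s| then s ^ 2 else 0

theorem tailSq_nonneg (δ s : ℝ) : 0 ≤ tailSq δ s := by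
  unfold tailSq; split_ifs <;> positivity

theorem tailSq_le (δ s : ℝ) : tailSq δ s ≤ s ^ 2 := by
  unfold tailSq; split_ifs <;> nlinarith [sq_nonneg s]

theorem measurable_tailSq (δ : ℝ) : Measurable (tailSq δ) :=
  Measurable.ite (measurableSet_lt measurable_const measurable_id.abs)
    (measurable_id.pow_const 2) measurable_const

theorem integrable_tailSq (δ : ℝ) (u : HSpace N α) : Integrable (fun x => tailSq δ (u x)) := by
  refine Integrable.mono' (integrable_sq_L2R u.toL2)
    ((measurable_tailSq δ).comp_aemeasurable
      (Lp.aestronglyMeasurable u.toL2).aemeasurable).aestronglyMeasurable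
    (Eventually.of_forall fun x => ?_)
  rw [Real.norm_of_nonneg (tailSq_nonneg _ _)]
  exact tailSq_le _ _

/-- Once the low part is at most δ/2, every point with |r| > δ satisfies |r| ≤ 2|g| for the high
part g, whose L² norm is small for large A. -/
theorem Vanishes.tendsto_tailSq (hα₀ : 0 < α) {r : ℕ → HSpace N α} {K : ℝ}
    (hb : ∀ n, ‖r n‖ ≤ K) (hr : Vanishes r) {δ : ℝ} (hδ : 0 < δ) :
    Tendsto (fun n => ∫ x, tailSq δ (r n x)) atTop (𝓝 0) := by
  refine tendsto_order.2 ⟨fun a ha => Eventually.of_forall fun n => ha.trans_le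
    (integral_nonneg fun x => tailSq_nonneg _ _), fun a ha => ?_⟩
  obtain ⟨A, hA, hAε⟩ := exists_cutoff hα₀ K (show 0 < a / 4 by positivity)
  filter_upwards [hr A hA (δ / 2) (by positivity)] with n hn
  obtain ⟨g, hg, hg2⟩ := exists_low_add_high A (r n)
  have hg3 : ∫ x, ‖g x‖ ^ 2 < a / 4 := by
    rw [hg2]
    refine (integral_high_le hα₀ hA (r n)).trans_lt (lt_of_le_of_lt ?_ hAε)
    have := hb n
    have : 0 ≤ ‖r n‖ := norm_nonneg _
    gcongr
  have hle : ∫ x, tailSq δ (r n x) ≤ ∫ x, 4 * ‖g x‖ ^ 2 := by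
    refine integral_mono_ae (integrable_tailSq _ _) ((integrable_norm_sq_L2C g).const_mul 4) ?_
    filter_upwards [hg] with x hx
    show tailSq δ (r n x) ≤ 4 * ‖g x‖ ^ 2
    unfold tailSq
    split_ifs with h
    · have h2 : |r n x| ≤ ‖low A (r n) x‖ + ‖g x‖ := by
        rw [← Real.norm_eq_abs, ← Complex.norm_real, hx]
        exact norm_add_le _ _
      have h3 := hn x
      have h4 : |r n x| ≤ 2 * ‖g x‖ := by linarith
      rw [← sq_abs]
      nlinarith [abs_nonneg (r n x)]
    · positivity
  rw [integral_const_mul] at hle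
  linarith

end HSpace

/-! ### Young inequalities for s² + |s|^p -/

section Powers
variable {p : ℝ}

/-- The function `s² + |s|^p`. -/
def pw (p s : ℝ) : ℝ := s ^ 2 + |s| ^ p

theorem pw_nonneg (p s : ℝ) : 0 ≤ pw p s := by unfold pw; positivity

theorem pw_mono (hp : 0 ≤ p) {a b : ℝ} (h : |a| ≤ |b|) : pw p a ≤ pw p b :=
  add_le_add (sq_le_sq.2 h) (Real.rpow_le_rpow (abs_nonneg _) h hp)

theorem pw_two_mul_le (hp : 2 ≤ p) (a : ℝ) : pw p (2 * a) ≤ 2 ^ p * pw p a := by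
  unfold pw
  have h : (2 : ℝ) ^ 2 ≤ 2 ^ p := by
    rw [← Real.rpow_natCast]
    exact Real.rpow_le_rpow_of_exponent_le (by norm_num) (by exact_mod_cast hp)
  rw [abs_mul, Real.mul_rpow (abs_nonneg _) (abs_nonneg _), abs_two, mul_pow, mul_add]
  gcongr

theorem pw_add_le (hp : 2 ≤ p) (a b : ℝ) : pw p (|a| + |b|) ≤ 2 ^ p * (pw p a + pw p b) := by
  have h1 := pw_nonneg p a
  have h2 := pw_nonneg p b
  have h3 : (0 : ℝ) < 2 ^ p := by positivity
  have key : ∀ c, |a| ≤ |c| → |b| ≤ |c| → pw p (|a| + |b|) ≤ 2 ^ p * pw p c := fun c ha hb => by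
    refine (pw_mono (by linarith) ?_).trans (pw_two_mul_le hp c)
    rw [abs_of_nonneg (by positivity), abs_mul, abs_two]
    linarith
  rcases le_total |a| |b| with h | h
  · refine (key b h le_rfl).trans ?_
    gcongr
    linarith
  · refine (key a le_rfl h).trans ?_
    gcongr
    linarith

/-- Young's inequality with a small factor. -/
theorem exists_young (hp : 2 ≤ p) {ε : ℝ} (hε : 0 < ε) :
    ∃ C : ℝ, 0 ≤ C ∧ ∀ a b : ℝ, (|a| + |a| ^ (p - 1)) * |b| ≤ ε * pw p a + C * pw p b := by
  refine ⟨ε⁻¹ + (ε⁻¹) ^ (p - 1), by positivity, fun a b => ?_⟩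
  have ha := abs_nonneg a
  have hb := abs_nonneg b
  have hpow : ∀ t : ℝ, 0 ≤ t → t ^ (p - 1) * t = t ^ p := fun t ht => by
    rcases eq_or_lt_of_le ht with h | h
    · rw [← h, mul_zero, Real.zero_rpow (by linarith)]
    · rw [← Real.rpow_add_one h.ne', sub_add_cancel]
  have hb2 : 0 ≤ (ε⁻¹ + (ε⁻¹) ^ (p - 1)) * pw p b := mul_nonneg (by positivity) (pw_nonneg _ _)
  have ha2 : 0 ≤ ε * pw p a := mul_nonneg hε.le (pw_nonneg _ _)
  -- If |b| ≤ ε|a| the product goes into the first term; otherwise |a| ≤ |b|/ε and it goes into the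
  -- second, which dictates the constant.
  rcases le_total |b| (ε * |a|) with h | h
  · calc (|a| + |a| ^ (p - 1)) * |b| ≤ (|a| + |a| ^ (p - 1)) * (ε * |a|) := by gcongr
      _ = ε * pw p a := by
        rw [pw, ← hpow _ ha, ← sq_abs a]; ring
      _ ≤ _ := by linarith
  · have h1 : |a| ≤ ε⁻¹ * |b| := by
      rw [inv_mul_eq_div, le_div_iff₀ hε]; linarith
    calc (|a| + |a| ^ (p - 1)) * |b| ≤ (ε⁻¹ * |b| + (ε⁻¹ * |b|) ^ (p - 1)) * |b| := by
          gcongr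
          linarith
      _ = ε⁻¹ * b ^ 2 + (ε⁻¹) ^ (p - 1) * |b| ^ p := by
        rw [Real.mul_rpow (by positivity) hb, ← hpow _ hb, ← sq_abs b]; ring
      _ ≤ (ε⁻¹ + (ε⁻¹) ^ (p - 1)) * pw p b := by
        have h2 : 0 ≤ ε⁻¹ := by positivity
        have h3 : 0 ≤ (ε⁻¹) ^ (p - 1) := by positivity
        have h4 : 0 ≤ |b| ^ p := by positivity
        unfold pw
        nlinarith [mul_nonneg h2 h4, mul_nonneg h3 (sq_nonneg b)]
      _ ≤ _ := by linarith

theorem pw_mul_le (hp : 2 ≤ p) {t : ℝ} (ht0 : 0 < t) (ht1 : t ≤ 1) (b : ℝ) :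
    pw p (t * b) ≤ t ^ 2 * pw p b := by
  unfold pw
  rw [abs_mul, abs_of_pos ht0, Real.mul_rpow ht0.le (abs_nonneg _), mul_pow, mul_add]
  gcongr
  rw [← Real.rpow_natCast]
  exact Real.rpow_le_rpow_of_exponent_ge ht0 ht1 (by exact_mod_cast hp)

/-- Young's inequality with a small factor on the second term. -/
theorem exists_young_right (hp : 2 ≤ p) {ε : ℝ} (hε : 0 < ε) :
    ∃ C : ℝ, 0 ≤ C ∧ ∀ a b : ℝ, (|a| + |a| ^ (p - 1)) * |b| ≤ C * pw p a + ε * pw p b := by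
  obtain ⟨D, hD, h⟩ := exists_young hp one_pos
  -- The inequality is applied to a and tb: the left side scales by t, but s² + |s|^p by at most t²
  -- for t ≤ 1, so after division the factor on b is tD ≤ ε.
  set t := min 1 (ε / (D + 1)) with ht
  have ht0 : 0 < t := by positivity
  have htD : t * D ≤ ε := by
    have h1 : t * (D + 1) ≤ ε := by
      rw [← le_div_iff₀ (by positivity)]
      exact min_le_right _ _
    nlinarith
  refine ⟨t⁻¹, by positivity, fun a b => ?_⟩
  have h1 := h a (t * b)
  have h2 := pw_mul_le hp ht0 (min_le_left _ _) b
  rw [abs_mul, abs_of_pos ht0, one_mul] at h1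
  have h3 : t * ((|a| + |a| ^ (p - 1)) * |b|) ≤ pw p a + D * (t ^ 2 * pw p b) := by
    have := mul_le_mul_of_nonneg_left h2 hD
    linarith
  have h4 := mul_le_mul_of_nonneg_left h3 (inv_nonneg.2 ht0.le)
  rw [inv_mul_cancel_left₀ ht0.ne'] at h4
  have h5 : t⁻¹ * (pw p a + D * (t ^ 2 * pw p b)) = t⁻¹ * pw p a + t * D * pw p b := by
    field_simp
  have h6 := mul_le_mul_of_nonneg_right htD (pw_nonneg p b)
  linarith

end Powers

/-! ### Subcritical nonlinearities, their limits and primitives -/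

/-- Nonlinearities that are subcritical at infinity and whose slope at zero is below one,
uniformly in `x`. -/
structure Subcritical {N : ℕ} (p : ℝ) (f : RN N → ℝ → ℝ) : Prop where
  continuous : Continuous (Function.uncurry f)
  slope : ∃ η > 0, ∃ δ > 0, ∀ x s, |s| ≤ δ → f x s * s ≤ (1 - η) * s ^ 2
  growth : ∀ ε > 0, ∃ C ≥ 0, ∀ x s, |f x s| ≤ C * |s| + ε * |s| ^ (p - 1)

/-- `f(x + y_n, ·)` converges to `g(x, ·)` locally uniformly. -/
def LimAt {N : ℕ} (f : RN N → ℝ → ℝ) (y : ℕ → RN N) (g : RN N → ℝ → ℝ) : Prop :=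
  ∀ x a, Tendsto (fun q : ℕ × ℝ => f (x + y q.1) q.2) (atTop ×ˢ 𝓝 a) (𝓝 (g x a))

section Growth
variable {N : ℕ} {α : ℝ} {f : RN N → ℝ → ℝ} {finf : ℝ → ℝ}

theorem noncompactSpace_RN (hN : 2 ≤ N) : NoncompactSpace (RN N) := by
  have : Nontrivial (RN N) := Module.nontrivial_of_finrank_pos (R := ℝ) (by simp; lia)
  exact NormedSpace.noncompactSpace ℝ (RN N)

namespace Nonlinearity

theorem map_zero (hf : Nonlinearity N α f finf) (x : RN N) : f x 0 = 0 := by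
  have h := hf.odd x 0
  rw [neg_zero] at h
  linarith

theorem exists_slope (hf : Nonlinearity N α f finf) : ∃ η > 0, ∃ δ > 0, ∃ C ≥ 0,
    ∀ x s, |s| ≤ δ → f x s * s ≤ (1 - η) * s ^ 2 ∧ |f x s| ≤ C * |s| := by
  obtain ⟨c, hc, hc1⟩ := EReal.lt_iff_exists_real_btwn.1 hf.limsup_zero
  obtain ⟨b, -, hb⟩ := EReal.lt_iff_exists_real_btwn.1 hf.liminf_zero
  have hc1' : c < 1 := by exact_mod_cast hc1
  have h := (eventually_lt_of_limsup_lt hc).and (eventually_lt_of_lt_liminf hb)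
  rw [eventually_nhdsWithin_iff, Metric.eventually_nhds_iff] at h
  obtain ⟨δ, hδ, h⟩ := h
  -- The reals b and c enclose f(x,s)/s near zero with c < 1, so η = 1 - c; halving δ allows the
  -- closed condition |s| ≤ δ.
  refine ⟨1 - c, by linarith, δ / 2, by positivity, |c| + |b|, by positivity, fun x s hs => ?_⟩
  rcases eq_or_ne s 0 with rfl | hs0
  · simp [hf.map_zero]
  obtain ⟨h1, h2⟩ := h (y := s) (by rw [Real.dist_eq, sub_zero]; linarith) hs0
  have h3 : f x s / s < c := by
    exact_mod_cast (le_iSup (fun x => ((f x s / s : ℝ) : EReal)) x).trans_lt h1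
  have h4 : b < f x s / s := by
    exact_mod_cast h2.trans_le (iInf_le (fun x => ((f x s / s : ℝ) : EReal)) x)
  have e : f x s = f x s / s * s := by field_simp
  constructor
  · rw [e]
    nlinarith [sq_nonneg s]
  · rw [e, abs_mul]
    gcongr
    rw [abs_le]
    constructor
    · linarith [neg_abs_le b, abs_nonneg c]
    · linarith [le_abs_self c, abs_nonneg b]

/-- For x outside a compact set, f is within 1 of the continuous limit; on that compact set, joint
continuity gives the bound. -/
theorem exists_bound (hf : Nonlinearity N α f finf) (R : ℝ) :
    ∃ M ≥ 0, ∀ x s, |s| ≤ R → |f x s| ≤ M := by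
  have hK : IsCompact (Set.Icc (-R) R) := isCompact_Icc
  have h1 := Metric.tendstoUniformlyOn_iff.1 (hf.tendsto_lim _ hK) 1 one_pos
  obtain ⟨T, hT, hT2⟩ := mem_cocompact.1 h1
  obtain ⟨M1, hM1⟩ := hK.exists_bound_of_continuousOn hf.continuous_lim.continuousOn
  obtain ⟨M2, hM2⟩ := (hT.prod hK).exists_bound_of_continuousOn hf.continuous.continuousOn
  refine ⟨max 0 (max (M1 + 1) M2), le_max_left _ _, fun x s hs => ?_⟩
  have hs' : s ∈ Set.Icc (-R) R := abs_le.1 hs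
  by_cases hx : x ∈ T
  · have := hM2 (x, s) ⟨hx, hs'⟩
    exact this.trans ((le_max_right _ _).trans (le_max_right _ _))
  · have h2 := hT2 hx s hs'
    have h3 := hM1 s hs'
    rw [Real.dist_eq, abs_sub_comm] at h2
    rw [Real.norm_eq_abs] at h3
    have h4 : |f x s| ≤ |f x s - finf s| + |finf s| := by
      simpa using abs_add_le (f x s - finf s) (finf s)
    exact (show |f x s| ≤ M1 + 1 by linarith).trans ((le_max_left _ _).trans (le_max_right _ _))

theorem exists_growth_at_top (hf : Nonlinearity N α f finf) {ε : ℝ} (hε : 0 < ε) :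
    ∃ R : ℝ, ∀ x s, R < |s| → |f x s| ≤ ε * |s| ^ (critExp N α - 1) := by
  have h1 := (ENNReal.tendsto_nhds_zero.1 hf.subcritical) (ENNReal.ofReal ε) (by simpa using hε)
  rw [← Metric.cobounded_eq_cocompact, ← comap_norm_atTop, eventually_comap] at h1
  obtain ⟨R, hR⟩ := eventually_atTop.1 h1
  refine ⟨max R 0, fun x s hs => ?_⟩
  have h2 := hR |s| ((le_max_left _ _).trans hs.le) s rfl
  have h3 := (ENNReal.ofReal_le_ofReal_iff hε.le).1
    ((le_iSup (fun x => ENNReal.ofReal (|f x s| / |s| ^ (critExp N α - 1))) x).trans h2)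
  have h4 : 0 < |s| := (le_max_right _ _).trans_lt hs
  rwa [div_le_iff₀ (by positivity)] at h3

theorem subcritical_left (hf : Nonlinearity N α f finf) : Subcritical (critExp N α) f where
  continuous := hf.continuous
  slope := by
    obtain ⟨η, hη, δ, hδ, C, -, h⟩ := hf.exists_slope
    exact ⟨η, hη, δ, hδ, fun x s hs => (h x s hs).1⟩
  growth := by
    intro ε hε
    obtain ⟨η, hη, δ, hδ, C, hC, h⟩ := hf.exists_slope
    obtain ⟨R, hR⟩ := hf.exists_growth_at_top hε
    obtain ⟨M, hM, hM2⟩ := hf.exists_bound R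
    -- Three ranges: C serves |s| ≤ δ, the ratio M/δ serves δ < |s| ≤ R, and the ε-term serves |s| >
    -- R.
    refine ⟨C + M / δ, by positivity, fun x s => ?_⟩
    have h0 : 0 ≤ ε * |s| ^ (critExp N α - 1) := by positivity
    have h1 : 0 ≤ C * |s| := by positivity
    have h2 : 0 ≤ M / δ * |s| := by positivity
    rw [add_mul]
    rcases le_or_gt |s| δ with hs | hs
    · linarith [(h x s hs).2]
    rcases le_or_gt |s| R with hs2 | hs2
    · have h3 : M ≤ M / δ * |s| := by
        rw [div_mul_eq_mul_div, le_div_iff₀ hδ]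
        gcongr
      linarith [hM2 x s hs2]
    · linarith [hR x s hs2]

theorem tendsto_lim_apply (hf : Nonlinearity N α f finf) (s : ℝ) :
    Tendsto (fun x => f x s) (cocompact (RN N)) (𝓝 (finf s)) :=
  (hf.tendsto_lim {s} isCompact_singleton).tendsto_at (Set.mem_singleton s)

/-- The bounds for f are uniform in x and pass to the pointwise limit as |x| → ∞; noncompactness of
the space makes that limit meaningful. -/
theorem subcritical_lim (hN : 2 ≤ N) (hf : Nonlinearity N α f finf) :
    Subcritical (N := N) (critExp N α) (fun _ => finf) where
  continuous := hf.continuous_lim.comp continuous_snd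
  slope := by
    have := noncompactSpace_RN hN
    obtain ⟨η, hη, δ, hδ, h⟩ := hf.subcritical_left.slope
    exact ⟨η, hη, δ, hδ, fun _ s hs => le_of_tendsto ((hf.tendsto_lim_apply s).mul_const s)
      (Eventually.of_forall fun x => h x s hs)⟩
  growth := by
    have := noncompactSpace_RN hN
    intro ε hε
    obtain ⟨C, hC, h⟩ := hf.subcritical_left.growth ε hε
    exact ⟨C, hC, fun _ s => le_of_tendsto ((hf.tendsto_lim_apply s).abs)
      (Eventually.of_forall fun x => h x s)⟩

theorem limAt_of_norm_tendsto (hf : Nonlinearity N α f finf) {y : ℕ → RN N}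
    (hy : Tendsto (fun n => ‖y n‖) atTop atTop) : LimAt f y fun _ => finf := by
  intro x a
  rw [Metric.tendsto_nhds]
  intro ε hε
  have h1 := Metric.tendstoUniformlyOn_iff.1
    (hf.tendsto_lim _ (isCompact_closedBall a 1)) (ε / 2) (by positivity)
  have hxy : Tendsto (fun n => x + y n) atTop (cocompact (RN N)) := by
    rw [← Metric.cobounded_eq_cocompact, ← tendsto_norm_atTop_iff_cobounded]
    refine tendsto_atTop_mono (fun n => ?_) (tendsto_atTop_add_const_right _ (-‖x‖) hy)
    have := norm_sub_le (x + y n) x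
    rw [add_sub_cancel_left] at this
    linarith
  have h2 := hxy.eventually h1
  have h3 : ∀ᶠ s in 𝓝 a, dist s a ≤ 1 ∧ dist (finf s) (finf a) < ε / 2 :=
    ((Metric.eventually_nhds_iff_ball.2 ⟨1, one_pos, fun s hs => hs.le⟩)).and
      ((Metric.tendsto_nhds.1 (hf.continuous_lim.tendsto a)) (ε / 2) (by positivity))
  filter_upwards [h2.prod_mk h3] with q hq
  have h4 := hq.1 q.2 hq.2.1
  calc dist (f (x + y q.1) q.2) (finf a) ≤ dist (f (x + y q.1) q.2) (finf q.2) +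
        dist (finf q.2) (finf a) := dist_triangle _ _ _
    _ < ε := by rw [dist_comm (f _ _)]; linarith [hq.2.2]

end Nonlinearity

/-- With zero shifts the limit nonlinearity is f itself, so the weak limit u₀ and the escaping
profiles are covered by the same lemmas. -/
theorem Subcritical.limAt_zero {p : ℝ} (hf : Subcritical p f) : LimAt f (fun _ => 0) f := by
  intro x a
  have h : Continuous (f x) := hf.continuous.comp (Continuous.prodMk_right x)
  simp only [add_zero]
  exact (h.tendsto a).comp tendsto_snd

theorem LimAt.comp {y : ℕ → RN N} {g : RN N → ℝ → ℝ} (h : LimAt f y g) {k : ℕ → ℕ}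
    (hk : Tendsto k atTop atTop) : LimAt f (fun n => y (k n)) g := fun x a =>
  (h x a).comp (hk.prodMap tendsto_id)

theorem LimAt.tendsto {y : ℕ → RN N} {g : RN N → ℝ → ℝ} (h : LimAt f y g) (x : RN N)
    {s : ℕ → ℝ} {a : ℝ} (hs : Tendsto s atTop (𝓝 a)) :
    Tendsto (fun n => f (x + y n) (s n)) atTop (𝓝 (g x a)) :=
  (h x a).comp (tendsto_id.prodMk hs)

/-- The primitive `F(x,s) = ∫₀ˢ f(x,t) dt`. -/
def prim (f : RN N → ℝ → ℝ) (x : RN N) (s : ℝ) : ℝ := ∫ t in (0 : ℝ)..s, f x t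

namespace Subcritical
variable {p : ℝ}

theorem continuous_apply (hf : Subcritical p f) (x : RN N) : Continuous (f x) :=
  hf.continuous.comp (Continuous.prodMk_right x)

theorem continuous_prim (hf : Subcritical p f) : Continuous (Function.uncurry (prim f)) := by
  have h := intervalIntegral.continuous_parametric_intervalIntegral_of_continuous
    (μ := volume) (a₀ := 0) (f := fun (q : RN N × ℝ) (t : ℝ) => f q.1 t) (s := fun q => q.2)
    (hf.continuous.comp ((continuous_fst.comp continuous_fst).prodMk continuous_snd))
    continuous_snd
  exact h

theorem prim_zero (x : RN N) : prim f x 0 = 0 := intervalIntegral.integral_same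

theorem hasDerivAt_prim (hf : Subcritical p f) (x : RN N) (s : ℝ) :
    HasDerivAt (prim f x) (f x s) s :=
  intervalIntegral.integral_hasDerivAt_right ((hf.continuous_apply x).intervalIntegrable _ _)
    ((hf.continuous_apply x).stronglyMeasurableAtFilter _ _) (hf.continuous_apply x).continuousAt

theorem exists_growth (hf : Subcritical p f) :
    ∃ C ≥ 0, ∀ x s, |f x s| ≤ C * (|s| + |s| ^ (p - 1)) := by
  obtain ⟨C, hC, h⟩ := hf.growth 1 one_pos
  refine ⟨max C 1, by positivity, fun x s => (h x s).trans ?_⟩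
  rw [mul_add]
  gcongr
  · exact le_max_left _ _
  · exact le_max_right _ _

theorem exists_mul_le (hp : 2 ≤ p) (hf : Subcritical p f) {ε : ℝ} (hε : 0 < ε) :
    ∃ C ≥ 0, ∀ x a b, |f x a * b| ≤ ε * pw p a + C * pw p b := by
  obtain ⟨C, hC, h⟩ := hf.exists_growth
  obtain ⟨D, hD, hy⟩ := exists_young hp (show 0 < ε / (C + 1) by positivity)
  refine ⟨C * D, by positivity, fun x a b => ?_⟩
  have h1 : C * (ε / (C + 1)) ≤ ε := by
    rw [mul_div_assoc', div_le_iff₀ (by positivity)]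
    nlinarith
  calc |f x a * b| ≤ C * (|a| + |a| ^ (p - 1)) * |b| := by
        rw [abs_mul]
        gcongr
        exact h x a
    _ = C * ((|a| + |a| ^ (p - 1)) * |b|) := by ring
    _ ≤ C * (ε / (C + 1) * pw p a + D * pw p b) := by gcongr; exact hy a b
    _ = C * (ε / (C + 1)) * pw p a + C * D * pw p b := by ring
    _ ≤ _ := by
      have := pw_nonneg p a
      gcongr

theorem exists_prim_lipschitz (hp : 2 ≤ p) (hf : Subcritical p f) :
    ∃ C ≥ 0, ∀ x a b, |prim f x (a + b) - prim f x a| ≤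
      C * (((|a| + |b|) + (|a| + |b|) ^ (p - 1)) * |b|) := by
  obtain ⟨C, hC, h⟩ := hf.exists_growth
  refine ⟨C, hC, fun x a b => ?_⟩
  have h2 : prim f x (a + b) - prim f x a = ∫ t in a..a + b, f x t :=
    intervalIntegral.integral_interval_sub_left
      ((hf.continuous_apply x).intervalIntegrable _ _)
      ((hf.continuous_apply x).intervalIntegrable _ _)
  set τ := |a| + |b| with hτ
  have h3 : |∫ t in a..a + b, f x t| ≤ C * (τ + τ ^ (p - 1)) * |a + b - a| := by
    refine intervalIntegral.norm_integral_le_of_norm_le_const (E := ℝ) fun t ht => ?_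
    rw [Real.norm_eq_abs]
    have ht2 : |t| ≤ τ := by
      have h4 := Set.uIoc_subset_uIcc ht
      rw [Set.uIcc_eq_union, Set.mem_union, Set.mem_Icc, Set.mem_Icc] at h4
      rw [hτ, abs_le]
      rcases h4 with ⟨h5, h6⟩ | ⟨h5, h6⟩ <;> constructor <;>
        linarith [le_abs_self a, neg_abs_le a, le_abs_self b, neg_abs_le b]
    refine (h x t).trans ?_
    gcongr
    linarith
  rw [h2, ← mul_assoc]
  rwa [add_sub_cancel_left] at h3

theorem exists_prim_sub_le (hp : 2 ≤ p) (hf : Subcritical p f) {ε : ℝ} (hε : 0 < ε) :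
    ∃ C ≥ 0, ∀ x a b, |prim f x (a + b) - prim f x a| ≤ ε * pw p a + C * pw p b := by
  obtain ⟨C, hC, h⟩ := hf.exists_prim_lipschitz hp
  -- The factor 2^p offsets the loss in `pw_add_le`, and C + 1 offsets the growth constant.
  obtain ⟨D, hD, hy⟩ := exists_young hp (show 0 < ε / (2 ^ p * (C + 1)) by positivity)
  refine ⟨ε + C * D, by positivity, fun x a b => ?_⟩
  have h1 : C * (ε / (2 ^ p * (C + 1))) * 2 ^ p ≤ ε := by
    have : C * (ε / (2 ^ p * (C + 1))) * 2 ^ p = C * ε / (C + 1) := by field_simp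
    rw [this, div_le_iff₀ (by positivity)]
    nlinarith
  have h2 := h x a b
  set τ := |a| + |b| with hτ
  have hτ0 : 0 ≤ τ := by positivity
  have hpa := pw_nonneg p a
  have hpb := pw_nonneg p b
  calc _ ≤ C * ((|τ| + |τ| ^ (p - 1)) * |b|) := by rwa [abs_of_nonneg hτ0]
    _ ≤ C * (ε / (2 ^ p * (C + 1)) * pw p τ + D * pw p b) := by gcongr; exact hy τ b
    _ ≤ C * (ε / (2 ^ p * (C + 1)) * (2 ^ p * (pw p a + pw p b)) + D * pw p b) := by
      gcongr
      exact pw_add_le hp a b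
    _ = C * (ε / (2 ^ p * (C + 1))) * 2 ^ p * (pw p a + pw p b) + C * D * pw p b := by ring
    _ ≤ ε * (pw p a + pw p b) + C * D * pw p b := by gcongr
    _ = _ := by ring

/-- Bound for difference quotients, with a small factor on the increment. -/
theorem exists_diffQuotient_le (hp : 2 ≤ p) (hf : Subcritical p f) {ε : ℝ} (hε : 0 < ε) :
    ∃ C ≥ 0, ∃ t₀ > 0, ∀ t, 0 < t → t ≤ t₀ → ∀ x a k,
      |prim f x (a + t * k) - prim f x a - f x a * (t * k)| ≤ t * (C * pw p a + ε * pw p k) := by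
  obtain ⟨C, hC, h⟩ := hf.exists_prim_lipschitz hp
  obtain ⟨C', hC', h'⟩ := hf.exists_growth
  set B := C + C' + 1 with hB
  have hB0 : 0 < B := by positivity
  obtain ⟨D, hD, hy⟩ := exists_young_right hp (show 0 < ε / (4 * B) by positivity)
  set E := B * D * 2 ^ p with hE
  have hE0 : 0 ≤ E := by positivity
  -- For t up to this threshold E t² ≤ ε/2, and the coefficients of the increment add up to ε/2 +
  -- ε/4 + ε/4.
  refine ⟨E + B * D, by positivity, min 1 (ε / (2 * (E + 1))), by positivity,
    fun t ht htt x a k => ?_⟩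
  have ht1 : t ≤ 1 := htt.trans (min_le_left _ _)
  have hpa := pw_nonneg p a
  have hpk := pw_nonneg p k
  have htE : E * t ^ 2 ≤ ε / 2 := by
    have h1 : t * (2 * (E + 1)) ≤ ε := by
      rw [← le_div_iff₀ (by positivity)]
      exact htt.trans (min_le_right _ _)
    have h2 : t ^ 2 ≤ t := by nlinarith
    nlinarith [mul_le_mul_of_nonneg_left h2 hE0]
  set τ := |a| + |t * k| with hτ
  have hτ0 : 0 ≤ τ := by positivity
  have h1 : |prim f x (a + t * k) - prim f x a| ≤ t * (B * ((|τ| + |τ| ^ (p - 1)) * |k|)) := by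
    refine (h x a (t * k)).trans ?_
    have e : t * (B * ((|τ| + |τ| ^ (p - 1)) * |k|)) = B * ((τ + τ ^ (p - 1)) * |t * k|) := by
      rw [abs_mul, abs_of_pos ht, abs_of_nonneg hτ0]; ring
    rw [e]
    gcongr
    linarith
  have h2 : |f x a * (t * k)| ≤ t * (B * ((|a| + |a| ^ (p - 1)) * |k|)) := by
    rw [abs_mul, abs_mul, abs_of_pos ht]
    calc |f x a| * (t * |k|) ≤ (B * (|a| + |a| ^ (p - 1))) * (t * |k|) := by
          gcongr
          refine (h' x a).trans ?_
          gcongr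
          linarith
      _ = _ := by ring
  have h3 : B * ((|τ| + |τ| ^ (p - 1)) * |k|) ≤ E * pw p a + (ε / 2 + ε / 4) * pw p k := by
    calc _ ≤ B * (D * pw p τ + ε / (4 * B) * pw p k) := by gcongr; exact hy τ k
      _ ≤ B * (D * (2 ^ p * (pw p a + t ^ 2 * pw p k)) + ε / (4 * B) * pw p k) := by
        gcongr
        refine (pw_add_le hp a (t * k)).trans ?_
        gcongr
        exact pw_mul_le hp ht ht1 k
      _ = E * pw p a + (E * t ^ 2 + ε / 4) * pw p k := by rw [hE]; field_simp; ring
      _ ≤ _ := by gcongr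
  have h4 : B * ((|a| + |a| ^ (p - 1)) * |k|) ≤ B * D * pw p a + ε / 4 * pw p k := by
    calc _ ≤ B * (D * pw p a + ε / (4 * B) * pw p k) := by gcongr; exact hy a k
      _ = _ := by field_simp
  calc _ ≤ |prim f x (a + t * k) - prim f x a| + |f x a * (t * k)| := abs_sub _ _
    _ ≤ t * (E * pw p a + (ε / 2 + ε / 4) * pw p k) + t * (B * D * pw p a + ε / 4 * pw p k) :=
      add_le_add (h1.trans (by gcongr)) (h2.trans (by gcongr))
    _ = _ := by ring

theorem exists_prim_le (hp : 2 ≤ p) (hf : Subcritical p f) :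
    ∃ C ≥ 0, ∀ x a, |prim f x a| ≤ C * pw p a := by
  obtain ⟨C, hC, h⟩ := hf.exists_prim_sub_le hp one_pos
  refine ⟨C, hC, fun x a => ?_⟩
  have h1 := h x 0 a
  rw [zero_add, prim_zero, sub_zero] at h1
  have h2 : pw p 0 = 0 := by
    unfold pw
    rw [abs_zero, Real.zero_rpow (by linarith)]
    norm_num
  rwa [h2, mul_zero, zero_add] at h1

/-- Primitives inherit locally uniform convergence. -/
theorem limAt_prim (hf : Subcritical p f) (hp : 2 ≤ p) {y : ℕ → RN N} {g : RN N → ℝ → ℝ}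
    (h : LimAt f y g) : LimAt (prim f) y (prim g) := by
  intro x a
  obtain ⟨C, hC, hgr⟩ := hf.exists_growth
  -- Rescaling to the fixed interval [0,1] removes the moving endpoint before dominated convergence.
  have e : ∀ (f : RN N → ℝ → ℝ) z s, prim f z s = ∫ t in (0 : ℝ)..1, s * f z (s * t) :=
    fun f z s => by
      rw [intervalIntegral.integral_const_mul, intervalIntegral.mul_integral_comp_mul_left,
        mul_zero, mul_one, prim]
  simp_rw [e]
  set B := |a| + 1
  refine intervalIntegral.tendsto_integral_filter_of_dominated_convergence
    (fun _ => B * (C * (B + B ^ (p - 1)))) ?_ ?_ intervalIntegrable_const ?_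
  · refine Eventually.of_forall fun q => Continuous.aestronglyMeasurable ?_
    exact continuous_const.mul ((hf.continuous_apply _).comp (continuous_const.mul continuous_id))
  · have h3 : ∀ᶠ s in 𝓝 a, |s| ≤ B := by
      filter_upwards [Metric.ball_mem_nhds a one_pos] with s hs
      rw [Metric.mem_ball, Real.dist_eq] at hs
      have : |s| ≤ |s - a| + |a| := by simpa using abs_add_le (s - a) a
      show |s| ≤ |a| + 1
      linarith
    filter_upwards [h3.prod_inr _] with q hq
    refine Eventually.of_forall fun t ht => ?_
    rw [Set.uIoc_of_le zero_le_one] at ht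
    have h4 : |q.2 * t| ≤ B := by
      rw [abs_mul, abs_of_pos ht.1]
      nlinarith [abs_nonneg q.2, ht.2, ht.1]
    rw [norm_mul]
    refine mul_le_mul hq ((hgr _ _).trans ?_) (norm_nonneg _) (by positivity)
    gcongr
    linarith
  · refine Eventually.of_forall fun t _ => ?_
    have h5 : Tendsto (fun q : ℕ × ℝ => (q.1, q.2 * t)) (atTop ×ˢ 𝓝 a) (atTop ×ˢ 𝓝 (a * t)) :=
      tendsto_fst.prodMk (tendsto_snd.mul_const t)
    exact tendsto_snd.mul ((h x (a * t)).comp h5)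

end Subcritical
end Growth

namespace Subcritical
variable {N : ℕ} {p : ℝ} {f : RN N → ℝ → ℝ}

/-- The nonlinearity with shifted space variable. -/
theorem shift (hf : Subcritical p f) (y : RN N) : Subcritical p fun x => f (x + y) where
  continuous := hf.continuous.comp ((continuous_fst.add continuous_const).prodMk continuous_snd)
  slope := by
    obtain ⟨η, hη, δ, hδ, h⟩ := hf.slope
    exact ⟨η, hη, δ, hδ, fun x => h (x + y)⟩
  growth := fun ε hε => by
    obtain ⟨C, hC, h⟩ := hf.growth ε hε
    exact ⟨C, hC, fun x => h (x + y)⟩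

end Subcritical

/-! ### Differentiability of the energy -/

namespace HSpace
variable {N : ℕ} {α : ℝ} {f g : RN N → ℝ → ℝ}

theorem aestronglyMeasurable (u : HSpace N α) : AEStronglyMeasurable (⇑u) volume :=
  Lp.aestronglyMeasurable u.toL2

theorem aestronglyMeasurable_comp {G : RN N → ℝ → ℝ} (hG : Continuous (Function.uncurry G))
    (u : HSpace N α) : AEStronglyMeasurable (fun x => G x (u x)) volume :=
  hG.comp_aestronglyMeasurable (aestronglyMeasurable_id.prodMk u.aestronglyMeasurable)

theorem integrable_pw (hN : 2 ≤ N) (hα₀ : 0 < α) (hα₁ : α < 1) (u : HSpace N α) :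
    Integrable (fun x => pw (critExp N α) (u x)) := by
  obtain ⟨C, -, h⟩ := exists_sobolev (N := N) hN hα₀ hα₁
  exact (integrable_sq_L2R u.toL2).add (h u).1

theorem exists_integral_pw_le (hN : 2 ≤ N) (hα₀ : 0 < α) (hα₁ : α < 1) (K : ℝ) :
    ∃ M ≥ 0, ∀ u : HSpace N α, ‖u‖ ≤ K → ∫ x, pw (critExp N α) (u x) ≤ M := by
  obtain ⟨C, hC, h⟩ := exists_sobolev (N := N) hN hα₀ hα₁
  have hp := two_lt_critExp hN hα₀ hα₁
  refine ⟨|K| ^ 2 + C * |K| ^ critExp N α, by positivity, fun u hu => ?_⟩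
  have hu' : ‖u‖ ≤ |K| := hu.trans (le_abs_self K)
  have e : ∫ x, pw (critExp N α) (u x) = (∫ x, u x ^ 2) + ∫ x, |u x| ^ critExp N α :=
    integral_add (integrable_sq_L2R u.toL2) (h u).1
  rw [e]
  have h1 : ‖u‖ ^ critExp N α ≤ |K| ^ critExp N α :=
    Real.rpow_le_rpow (norm_nonneg _) hu' (by linarith)
  refine add_le_add ((integral_sq_le hα₀.le u).trans (by gcongr)) ((h u).2.trans (by gcongr))

theorem integrable_mul (hN : 2 ≤ N) (hα₀ : 0 < α) (hα₁ : α < 1)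
    (hf : Subcritical (critExp N α) f) (u φ : HSpace N α) :
    Integrable (fun x => f x (u x) * φ x) := by
  have hp := two_lt_critExp hN hα₀ hα₁
  obtain ⟨C, hC, h⟩ := hf.exists_mul_le hp.le one_pos
  refine Integrable.mono' (((integrable_pw hN hα₀ hα₁ u).const_mul 1).add
    ((integrable_pw hN hα₀ hα₁ φ).const_mul C))
    ((aestronglyMeasurable_comp hf.continuous u).mul φ.aestronglyMeasurable)
    (Eventually.of_forall fun x => h x _ _)

theorem integrable_prim (hN : 2 ≤ N) (hα₀ : 0 < α) (hα₁ : α < 1)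
    (hf : Subcritical (critExp N α) f) (u : HSpace N α) :
    Integrable (fun x => prim f x (u x)) := by
  have hp := two_lt_critExp hN hα₀ hα₁
  obtain ⟨C, hC, h⟩ := hf.exists_prim_le hp.le
  exact Integrable.mono' ((integrable_pw hN hα₀ hα₁ u).const_mul C)
    (aestronglyMeasurable_comp hf.continuous_prim u) (Eventually.of_forall fun x => h x _)

/-- The nonlinear part `∫ F(x,u)` of the energy. -/
def nl (f : RN N → ℝ → ℝ) (u : HSpace N α) : ℝ := ∫ x, prim f x (u x)

theorem energy_eq (u : HSpace N α) : energy f u = ‖u‖ ^ 2 / 2 - nl f u := rfl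

theorem exists_derivNl (hN : 2 ≤ N) (hα₀ : 0 < α) (hα₁ : α < 1)
    (hf : Subcritical (critExp N α) f) (u : HSpace N α) :
    ∃ L : HSpace N α →L[ℝ] ℝ, ∀ φ : HSpace N α, L φ = ∫ x, f x (u x) * φ x := by
  have hp := two_lt_critExp hN hα₀ hα₁
  obtain ⟨C, hC, h⟩ := hf.exists_mul_le hp.le one_pos
  obtain ⟨M, hM, hM2⟩ := exists_integral_pw_le (N := N) hN hα₀ hα₁ 1
  let T : HSpace N α →ₗ[ℝ] ℝ :=
    { toFun := fun φ => ∫ x, f x (u x) * φ x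
      map_add' := fun φ ψ => by
        rw [← integral_add (integrable_mul hN hα₀ hα₁ hf u φ) (integrable_mul hN hα₀ hα₁ hf u ψ)]
        refine integral_congr_ae ?_
        filter_upwards [coe_add φ ψ] with x hx
        rw [hx, mul_add]
      map_smul' := fun c φ => by
        rw [RingHom.id_apply, smul_eq_mul, ← integral_const_mul]
        refine integral_congr_ae ?_
        filter_upwards [coe_smul c φ] with x hx
        rw [hx]
        ring }
  -- The Young bound is not homogeneous in φ, so it is used on the unit ball only and extended by
  -- linearity.
  have hT : ∀ φ : HSpace N α, ‖φ‖ ≤ 1 → ‖T φ‖ ≤ (∫ x, pw (critExp N α) (u x)) + C * M := by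
    intro φ hφ
    have h1 : ‖T φ‖ ≤ ∫ x, (1 * pw (critExp N α) (u x) + C * pw (critExp N α) (φ x)) :=
      norm_integral_le_of_norm_le (((integrable_pw hN hα₀ hα₁ u).const_mul 1).add
        ((integrable_pw hN hα₀ hα₁ φ).const_mul C)) (Eventually.of_forall fun x => h x _ _)
    rw [integral_add ((integrable_pw hN hα₀ hα₁ u).const_mul 1)
      ((integrable_pw hN hα₀ hα₁ φ).const_mul C), integral_const_mul, integral_const_mul,
      one_mul] at h1
    refine h1.trans ?_
    gcongr
    exact hM2 φ hφ
  refine ⟨T.mkContinuous ((∫ x, pw (critExp N α) (u x)) + C * M) fun φ => ?_, fun φ => rfl⟩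
  rcases eq_or_ne φ 0 with rfl | hφ
  · simp
  have hn : 0 < ‖φ‖ := norm_pos_iff.2 hφ
  have h1 := hT (‖φ‖⁻¹ • φ) (by rw [norm_smul, norm_inv, norm_norm, inv_mul_cancel₀ hn.ne'])
  rw [map_smul, norm_smul, norm_inv, norm_norm, inv_mul_le_iff₀ hn] at h1
  linarith

/-- The directions k n are only bounded. Along a subsequence they converge almost everywhere, which
makes the quotients tend to zero pointwise, and the bound with small factor on k n replaces
domination. -/
theorem tendsto_integral_diffQuotient (hN : 2 ≤ N) (hα₀ : 0 < α) (hα₁ : α < 1)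
    (hf : Subcritical (critExp N α) f) (u : HSpace N α) {k : ℕ → HSpace N α}
    (hk : ∀ n, ‖k n‖ ≤ 1) {t : ℕ → ℝ} (ht0 : ∀ n, 0 ≤ t n) (ht : Tendsto t atTop (𝓝 0)) :
    Tendsto (fun n => ∫ x, (t n)⁻¹ *
      |prim f x (u x + t n * k n x) - prim f x (u x) - f x (u x) * (t n * k n x)|) atTop (𝓝 0) := by
  have hp := two_lt_critExp hN hα₀ hα₁
  obtain ⟨M, hM, hM2⟩ := exists_integral_pw_le (N := N) hN hα₀ hα₁ 1
  refine tendsto_of_subseq_tendsto fun ns hns => ?_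
  obtain ⟨w, j, hj, -, hae⟩ := exists_subseq_weakConv_ae hN hα₀ hα₁ fun n => hk (ns n)
  refine ⟨j, ?_⟩
  have hmeas : ∀ n, AEStronglyMeasurable (fun x => (t n)⁻¹ *
      |prim f x (u x + t n * k n x) - prim f x (u x) - f x (u x) * (t n * k n x)|) volume :=
    fun n => by
    have h1 := (k n).aestronglyMeasurable.const_mul (t n)
    have h2 := hf.continuous_prim.comp_aestronglyMeasurable
      ((aestronglyMeasurable_id (μ := (volume : Measure (RN N)))).prodMk
        (u.aestronglyMeasurable.add h1))
    exact (((h2.sub (aestronglyMeasurable_comp hf.continuous_prim u)).sub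
      ((aestronglyMeasurable_comp hf.continuous u).mul h1)).norm).const_mul _
  refine tendsto_integral_of_le_add
    (A := fun n x => pw (critExp N α) (k (ns (j n)) x))
    (B := fun x => pw (critExp N α) (u x)) (K := M) (integrable_pw hN hα₀ hα₁ u)
    (fun n => integrable_pw hN hα₀ hα₁ _) (fun n x => pw_nonneg _ _)
    (fun n => hM2 _ (hk _)) (fun n => hmeas _)
    (fun n x => mul_nonneg (inv_nonneg.2 (ht0 _)) (abs_nonneg _)) ?_ fun ε hε => ?_
  · filter_upwards [hae] with x hx
    have htj : Tendsto (fun n => t (ns (j n))) atTop (𝓝 0) :=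
      ht.comp (hns.comp hj.tendsto_atTop)
    have h1 : Tendsto (fun n => t (ns (j n)) * k (ns (j n)) x) atTop (𝓝 0) := by
      simpa using htj.mul hx
    have h2 := (hasDerivAt_iff_isLittleO_nhds_zero.1 (hf.hasDerivAt_prim x (u x))).comp_tendsto h1
    have h3 : (fun n => t (ns (j n)) * k (ns (j n)) x) =O[atTop] fun n => t (ns (j n)) := by
      simpa using (Asymptotics.isBigO_refl (fun n => t (ns (j n))) atTop).mul (hx.isBigO_one ℝ)
    have h4 := ((h2.trans_isBigO h3).tendsto_div_nhds_zero).abs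
    rw [abs_zero] at h4
    refine h4.congr fun n => ?_
    rw [abs_div, abs_of_nonneg (ht0 _), div_eq_inv_mul, Function.comp_apply, smul_eq_mul,
      mul_comm (t _ * _) (f _ _)]
  · obtain ⟨C, hC, t₀, ht₀, h⟩ := hf.exists_diffQuotient_le hp.le hε
    refine ⟨C, ?_⟩
    have htj : Tendsto (fun n => t (ns (j n))) atTop (𝓝 0) :=
      ht.comp (hns.comp hj.tendsto_atTop)
    filter_upwards [(tendsto_order.1 htj).2 t₀ ht₀] with n hn
    refine Eventually.of_forall fun x => ?_
    rcases eq_or_lt_of_le (ht0 (ns (j n))) with h0 | h0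
    · rw [← h0, inv_zero, zero_mul]
      exact add_nonneg (mul_nonneg hC (pw_nonneg _ _)) (mul_nonneg hε.le (pw_nonneg _ _))
    · rw [inv_mul_le_iff₀ h0]
      exact h _ h0 hn.le x _ _

theorem hasFDerivAt_nl (hN : 2 ≤ N) (hα₀ : 0 < α) (hα₁ : α < 1)
    (hf : Subcritical (critExp N α) f) (u : HSpace N α) {L : HSpace N α →L[ℝ] ℝ}
    (hL : ∀ φ : HSpace N α, L φ = ∫ x, f x (u x) * φ x) : HasFDerivAt (nl f) L u := by
  rw [hasFDerivAt_iff_tendsto]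
  refine tendsto_of_seq_tendsto fun v hv => ?_
  -- Polar form of the increment; if it is zero, the convention 0⁻¹ = 0 gives k n = 0 and nothing
  -- breaks.
  set t : ℕ → ℝ := fun n => ‖v n - u‖ with ht
  set k : ℕ → HSpace N α := fun n => (t n)⁻¹ • (v n - u) with hk
  have ht0 : Tendsto t atTop (𝓝 0) := tendsto_iff_norm_sub_tendsto_zero.1 hv
  have hk1 : ∀ n, ‖k n‖ ≤ 1 := fun n => by
    rw [hk, norm_smul, norm_inv, ht, norm_norm]
    exact inv_mul_le_one
  have htk : ∀ n, v n - u = t n • k n := fun n => by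
    rcases eq_or_ne (t n) 0 with h | h
    · rw [h, zero_smul]
      exact norm_eq_zero.1 h
    · rw [hk, smul_inv_smul₀ h]
  refine squeeze_zero (fun n => mul_nonneg (inv_nonneg.2 (norm_nonneg _)) (norm_nonneg _))
    (fun n => ?_)
    (tendsto_integral_diffQuotient hN hα₀ hα₁ hf u hk1 (fun n => norm_nonneg _) ht0)
  have hae : ⇑(v n) =ᵐ[volume] fun x => u x + t n * k n x := by
    have e : v n = u + t n • k n := by rw [← htk, add_sub_cancel]
    filter_upwards [coe_add u (t n • k n), coe_smul (t n) (k n)] with x h1 h2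
    rw [e, h1, h2]
  have hi1 := integrable_prim hN hα₀ hα₁ hf (v n)
  have hi2 := integrable_prim hN hα₀ hα₁ hf u
  have hi3 := integrable_mul hN hα₀ hα₁ hf u (v n - u)
  have e : nl f (v n) - nl f u - L (v n - u) = ∫ x, (prim f x (u x + t n * k n x) -
      prim f x (u x) - f x (u x) * (t n * k n x)) := by
    have hi4 : Integrable (fun x => prim f x (v n x) - prim f x (u x)) := hi1.sub hi2
    rw [hL, nl, nl, ← integral_sub hi1 hi2, ← integral_sub hi4 hi3]
    refine integral_congr_ae ?_
    filter_upwards [hae, coe_smul (t n) (k n)] with x h1 h2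
    rw [h1, htk, h2]
  rw [Function.comp_apply, e, integral_const_mul]
  exact mul_le_mul_of_nonneg_left (norm_integral_le_integral_norm _)
    (inv_nonneg.2 (norm_nonneg _))

theorem exists_hasFDerivAt_energy (hN : 2 ≤ N) (hα₀ : 0 < α) (hα₁ : α < 1)
    (hf : Subcritical (critExp N α) f) (u : HSpace N α) :
    ∃ L : HSpace N α →L[ℝ] ℝ, (∀ φ : HSpace N α, L φ = inner ℝ u φ - ∫ x, f x (u x) * φ x) ∧
      HasFDerivAt (energy f) L u := by
  obtain ⟨L, hL⟩ := exists_derivNl hN hα₀ hα₁ hf u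
  have h1 := (hasStrictFDerivAt_norm_sq u).hasFDerivAt
  have h2 := (h1.const_mul (1 / 2 : ℝ)).sub (hasFDerivAt_nl hN hα₀ hα₁ hf u hL)
  refine ⟨_, fun φ => ?_, h2.congr_of_eventuallyEq (Eventually.of_forall fun v => ?_)⟩
  · rw [← hL]
    simp
  · simp only [energy_eq, Pi.sub_apply]
    ring

theorem isCritical_iff (hN : 2 ≤ N) (hα₀ : 0 < α) (hα₁ : α < 1)
    (hf : Subcritical (critExp N α) f) (u : HSpace N α) :
    IsCritical (energy f) u ↔ ∀ φ : HSpace N α, inner ℝ u φ = ∫ x, f x (u x) * φ x := by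
  obtain ⟨L, hL, hd⟩ := exists_hasFDerivAt_energy hN hα₀ hα₁ hf u
  constructor
  · intro h φ
    have h1 : L = 0 := hd.unique h
    have h2 := hL φ
    rw [h1, zero_apply] at h2
    linarith
  · intro h
    have h1 : L = 0 := by
      ext φ
      rw [hL, h φ, sub_self, zero_apply]
    rw [h1] at hd
    exact hd

theorem continuousAt_nl (hN : 2 ≤ N) (hα₀ : 0 < α) (hα₁ : α < 1)
    (hf : Subcritical (critExp N α) f) (u : HSpace N α) : ContinuousAt (nl f) u := by
  obtain ⟨L, hL⟩ := exists_derivNl hN hα₀ hα₁ hf u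
  exact (hasFDerivAt_nl hN hα₀ hα₁ hf u hL).continuousAt

end HSpace

/-! ### Weak limits of the equation and splitting of the energy -/

namespace HSpace
variable {N : ℕ} {α : ℝ} {f g : RN N → ℝ → ℝ}

theorem tendsto_norm_clm {L : ℕ → HSpace N α →L[ℝ] ℝ} (h : Tendsto L atTop (𝓝 0)) :
    Tendsto (fun n => ‖L n‖) atTop (𝓝 0) := by
  refine (tendsto_zero_iff_norm_tendsto_zero (E := HSpace N α →L[ℝ] ℝ)).1 ?_
  exact h

theorem translate_neg_ae (y : RN N) (u : HSpace N α) :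
    ⇑(translate (-y) u) =ᵐ[volume] fun x => u (x + y) := by
  filter_upwards [translate_ae (-y) u] with x hx
  rw [hx, sub_neg_eq_add]

theorem translate_neg_translate (y : RN N) (u : HSpace N α) :
    translate (-y) (translate y u) = u := by
  rw [translate_translate, neg_add_cancel, translate_zero]

theorem nl_eq_shift (f : RN N → ℝ → ℝ) (y : RN N) (u : HSpace N α) :
    nl f u = ∫ x, prim f (x + y) (translate (-y) u x) := by
  rw [nl, ← integral_add_right_eq_self _ y]
  refine integral_congr_ae ?_
  filter_upwards [translate_neg_ae y u] with x hx
  rw [hx]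

theorem integral_mul_translate (f : RN N → ℝ → ℝ) (y : RN N) (u φ : HSpace N α) :
    ∫ x, f x (u x) * translate y φ x = ∫ x, f (x + y) (translate (-y) u x) * φ x := by
  rw [← integral_add_right_eq_self _ y]
  refine integral_congr_ae ?_
  have h := translate_neg_ae y (translate y φ)
  rw [translate_neg_translate] at h
  filter_upwards [translate_neg_ae y u, h] with x h1 h2
  rw [h1, h2]

/-- Almost everywhere convergence along subsequences identifies the limit, and Young's inequality
puts the small factor on the bounded sequence v n and the large one on the fixed φ. -/
theorem tendsto_integral_mul_of_weakConv (hN : 2 ≤ N) (hα₀ : 0 < α) (hα₁ : α < 1)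
    (hf : Subcritical (critExp N α) f) (hg : Subcritical (critExp N α) g) {y : ℕ → RN N}
    (hlim : LimAt f y g) {v : ℕ → HSpace N α} {w : HSpace N α} {K : ℝ} (hb : ∀ n, ‖v n‖ ≤ K)
    (hv : WeakConv v w) (φ : HSpace N α) :
    Tendsto (fun n => ∫ x, f (x + y n) (v n x) * φ x) atTop (𝓝 (∫ x, g x (w x) * φ x)) := by
  have hp := two_lt_critExp hN hα₀ hα₁
  obtain ⟨M, hM, hM2⟩ := exists_integral_pw_le (N := N) hN hα₀ hα₁ K
  refine tendsto_of_subseq_tendsto fun ns hns => ?_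
  obtain ⟨j, hj, hae⟩ := exists_subseq_ae_of_weakConv hN hα₀ hα₁ (fun n => hb (ns n))
    (hv.comp hns)
  refine ⟨j, ?_⟩
  set z : ℕ → RN N := fun n => y (ns (j n))
  set V : ℕ → HSpace N α := fun n => v (ns (j n))
  have hlim' : LimAt f z g := hlim.comp (hns.comp hj.tendsto_atTop)
  have hi1 : ∀ n, Integrable (fun x => f (x + z n) (V n x) * φ x) := fun n =>
    integrable_mul hN hα₀ hα₁ (hf.shift (z n)) (V n) φ
  have hi2 := integrable_mul hN hα₀ hα₁ hg w φ
  obtain ⟨C', hC', h'⟩ := hg.exists_mul_le hp.le one_pos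
  have key : Tendsto (fun n => ∫ x, |f (x + z n) (V n x) * φ x - g x (w x) * φ x|) atTop (𝓝 0) := by
    refine tendsto_integral_of_le_add (A := fun n x => pw (critExp N α) (V n x))
      (B := fun x => pw (critExp N α) (w x) + pw (critExp N α) (φ x)) (K := M)
      ((integrable_pw hN hα₀ hα₁ w).add (integrable_pw hN hα₀ hα₁ φ))
      (fun n => integrable_pw hN hα₀ hα₁ _) (fun n x => pw_nonneg _ _)
      (fun n => hM2 _ (hb _)) (fun n => ((hi1 n).sub hi2).1.norm) (fun n x => abs_nonneg _)
      ?_ fun ε hε => ?_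
    · filter_upwards [hae] with x hx
      have h1 := (((hlim'.tendsto x hx).mul_const (φ x)).sub_const (g x (w x) * φ x)).abs
      rwa [sub_self, abs_zero] at h1
    · obtain ⟨C, hC, h⟩ := hf.exists_mul_le hp.le hε
      refine ⟨1 + C + C', Eventually.of_forall fun n => Eventually.of_forall fun x => ?_⟩
      have h1 := h (x + z n) (V n x) (φ x)
      have h2 := h' x (w x) (φ x)
      have h3 := pw_nonneg (critExp N α) (w x)
      have h4 := pw_nonneg (critExp N α) (φ x)
      calc _ ≤ |f (x + z n) (V n x) * φ x| + |g x (w x) * φ x| := abs_sub _ _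
        _ ≤ _ := by nlinarith [mul_nonneg hC h3, mul_nonneg hC' h3]
  refine tendsto_sub_nhds_zero_iff.1 (squeeze_zero_norm (fun n => ?_) key)
  rw [← integral_sub (hi1 n) hi2]
  exact norm_integral_le_integral_norm _

/-- Weak limits of translates of Palais–Smale sequences are critical points of the limit
functional. -/
theorem inner_eq_of_weakConv (hN : 2 ≤ N) (hα₀ : 0 < α) (hα₁ : α < 1)
    (hf : Subcritical (critExp N α) f) (hg : Subcritical (critExp N α) g) {y : ℕ → RN N}
    (hlim : LimAt f y g) {u : ℕ → HSpace N α} {w : HSpace N α} {K : ℝ} (hb : ∀ n, ‖u n‖ ≤ K)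
    (hw : WeakConv (fun n => translate (-y n) (u n)) w)
    (hder : Tendsto (fun n => fderiv ℝ (energy f) (u n)) atTop (𝓝 0)) (φ : HSpace N α) :
    inner ℝ w φ = ∫ x, g x (w x) * φ x := by
  -- Testing with translates of φ costs nothing, as their norms are constant.
  have h1 : Tendsto (fun n => fderiv ℝ (energy f) (u n) (translate (y n) φ)) atTop (𝓝 0) := by
    refine squeeze_zero_norm (a := fun n => ‖fderiv ℝ (energy f) (u n)‖ * ‖φ‖) (fun n => ?_) ?_
    · rw [← norm_translate (y n) φ]
      exact ContinuousLinearMap.le_opNorm _ _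
    · simpa using (tendsto_norm_clm hder).mul_const ‖φ‖
  have h2 : ∀ n, fderiv ℝ (energy f) (u n) (translate (y n) φ) =
      inner ℝ (translate (-y n) (u n)) φ - ∫ x, f (x + y n) (translate (-y n) (u n) x) * φ x := by
    intro n
    obtain ⟨L, hL, hd⟩ := exists_hasFDerivAt_energy hN hα₀ hα₁ hf (u n)
    rw [hd.fderiv, hL, integral_mul_translate, inner_translate_left, neg_neg]
  simp_rw [h2] at h1
  have h3 := (hw φ).sub (tendsto_integral_mul_of_weakConv hN hα₀ hα₁ hf hg hlim
    (fun n => (norm_translate _ _).trans_le (hb n)) hw φ)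
  exact sub_eq_zero.1 (tendsto_nhds_unique h3 h1)

/-- Splitting of the nonlinear part of the energy when a profile is removed. -/
theorem tendsto_nl_sub (hN : 2 ≤ N) (hα₀ : 0 < α) (hα₁ : α < 1)
    (hf : Subcritical (critExp N α) f) (hg : Subcritical (critExp N α) g) {y : ℕ → RN N}
    (hlim : LimAt f y g) {r : ℕ → HSpace N α} {w : HSpace N α} {K : ℝ} (hb : ∀ n, ‖r n‖ ≤ K)
    (hw : WeakConv (fun n => translate (-y n) (r n)) w) :
    Tendsto (fun n => nl f (r n) - nl f (r n - translate (y n) w)) atTop (𝓝 (nl g w)) := by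
  have hp := two_lt_critExp hN hα₀ hα₁
  obtain ⟨M, hM, hM2⟩ := exists_integral_pw_le (N := N) hN hα₀ hα₁ (K + ‖w‖)
  set v : ℕ → HSpace N α := fun n => translate (-y n) (r n) - w with hv
  have hvb : ∀ n, ‖v n‖ ≤ K + ‖w‖ := fun n =>
    (norm_sub_le _ _).trans (by rw [norm_translate]; linarith [hb n])
  have hvw : WeakConv v 0 := by simpa using hw.sub (WeakConv.const w)
  refine tendsto_of_subseq_tendsto fun ns hns => ?_
  obtain ⟨j, hj, hae⟩ := exists_subseq_ae_of_weakConv hN hα₀ hα₁ (fun n => hvb (ns n))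
    (hvw.comp hns)
  refine ⟨j, ?_⟩
  set z : ℕ → RN N := fun n => y (ns (j n)) with hz
  set V : ℕ → HSpace N α := fun n => v (ns (j n)) with hV
  have hlim' : LimAt f z g := hlim.comp (hns.comp hj.tendsto_atTop)
  have hlimF := hf.limAt_prim hp.le hlim'
  have hi1 : ∀ n, Integrable (fun x => prim f (x + z n) (V n x + w x)) := fun n =>
    (integrable_prim hN hα₀ hα₁ (hf.shift (z n)) (V n + w)).congr (by
      filter_upwards [coe_add (V n) w] with x hx
      rw [hx]
      rfl)
  have hi2 : ∀ n, Integrable (fun x => prim f (x + z n) (V n x)) := fun n =>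
    integrable_prim hN hα₀ hα₁ (hf.shift (z n)) (V n)
  have hi3 := integrable_prim hN hα₀ hα₁ hg w
  obtain ⟨C', hC', h'⟩ := hg.exists_prim_le hp.le
  have key : Tendsto (fun n => ∫ x, |prim f (x + z n) (V n x + w x) - prim f (x + z n) (V n x) -
      prim g x (w x)|) atTop (𝓝 0) := by
    -- Brezis–Lieb: V n → 0 almost everywhere, so the integrand tends to zero, and it is bounded by
    -- a small multiple of the V n term plus a fixed integrable function of w.
    refine tendsto_integral_of_le_add (A := fun n x => pw (critExp N α) (V n x))
      (B := fun x => pw (critExp N α) (w x)) (K := M) (integrable_pw hN hα₀ hα₁ w)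
      (fun n => integrable_pw hN hα₀ hα₁ _) (fun n x => pw_nonneg _ _)
      (fun n => hM2 _ (hvb _)) (fun n => (((hi1 n).sub (hi2 n)).sub hi3).1.norm)
      (fun n x => abs_nonneg _) ?_ fun ε hε => ?_
    · filter_upwards [hae, coe_zero (N := N) (α := α)] with x hx h0
      rw [h0] at hx
      have hx2 := hx.add_const (w x)
      rw [zero_add] at hx2
      have h1 := (((hlimF.tendsto x hx2).sub (hlimF.tendsto x hx)).sub_const (prim g x (w x))).abs
      rwa [Subcritical.prim_zero, sub_zero, sub_self, abs_zero] at h1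
    · obtain ⟨C, hC, h⟩ := hf.exists_prim_sub_le hp.le hε
      refine ⟨C + C', Eventually.of_forall fun n => Eventually.of_forall fun x => ?_⟩
      have h1 := h (x + z n) (V n x) (w x)
      have h2 := h' x (w x)
      calc _ ≤ |prim f (x + z n) (V n x + w x) - prim f (x + z n) (V n x)| + |prim g x (w x)| :=
            abs_sub _ _
        _ ≤ _ := by linarith
  refine tendsto_sub_nhds_zero_iff.1 (squeeze_zero_norm (fun n => ?_) key)
  have e1 : nl f (r (ns (j n))) = ∫ x, prim f (x + z n) (V n x + w x) := by
    rw [nl_eq_shift f (z n)]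
    refine integral_congr_ae ?_
    filter_upwards [coe_sub (translate (-z n) (r (ns (j n)))) w] with x hx
    simp only [hV, hv]
    rw [hx, sub_add_cancel]
  have e2 : nl f (r (ns (j n)) - translate (y (ns (j n))) w) =
      ∫ x, prim f (x + z n) (V n x) := by
    rw [nl_eq_shift f (z n), translate_sub, translate_neg_translate]
  have hi12 : Integrable (fun x => prim f (x + z n) (V n x + w x) - prim f (x + z n) (V n x)) :=
    (hi1 n).sub (hi2 n)
  rw [e1, e2, nl, ← integral_sub (hi1 n) (hi2 n), ← integral_sub hi12 hi3]
  exact norm_integral_le_integral_norm _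

theorem integrable_abs_mul (u v : HSpace N α) : Integrable (fun x => |u x| * |v x|) := by
  refine Integrable.mono' ((integrable_sq_L2R u.toL2).add (integrable_sq_L2R v.toL2))
    (u.aestronglyMeasurable.norm.mul v.aestronglyMeasurable.norm)
    (Eventually.of_forall fun x => ?_)
  rw [Real.norm_of_nonneg (by positivity), Pi.add_apply, ← sq_abs (u x), ← sq_abs (v x)]
  nlinarith [sq_nonneg (|u x| - |v x|), sq_nonneg |u x|, sq_nonneg |v x|]

theorem tendsto_integral_abs_mul (hN : 2 ≤ N) (hα₀ : 0 < α) (hα₁ : α < 1)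
    {v : ℕ → HSpace N α} {K : ℝ} (hb : ∀ n, ‖v n‖ ≤ K) (hv : WeakConv v 0) (w : HSpace N α) :
    Tendsto (fun n => ∫ x, |w x| * |v n x|) atTop (𝓝 0) := by
  refine tendsto_of_subseq_tendsto fun ns hns => ?_
  obtain ⟨j, hj, hae⟩ := exists_subseq_ae_of_weakConv hN hα₀ hα₁ (fun n => hb (ns n))
    (hv.comp hns)
  refine ⟨j, tendsto_integral_of_le_add (A := fun n x => v (ns (j n)) x ^ 2)
      (B := fun x => w x ^ 2) (K := K ^ 2) (integrable_sq_L2R w.toL2)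
      (fun n => integrable_sq_L2R _) (fun n x => sq_nonneg _)
      (fun n => (integral_sq_le hα₀.le _).trans (pow_le_pow_left₀ (norm_nonneg _) (hb _) 2))
      (fun n => (integrable_abs_mul w _).1)
      (fun n x => by positivity) ?_ fun ε hε => ?_⟩
  · filter_upwards [hae, coe_zero (N := N) (α := α)] with x hx h0
    rw [h0] at hx
    simpa using hx.abs.const_mul |w x|
  · refine ⟨ε⁻¹, Eventually.of_forall fun n => Eventually.of_forall fun x => ?_⟩
    set b := v (ns (j n)) x
    have h1 : 0 ≤ ε⁻¹ * (|w x| - ε * |b|) ^ 2 := by positivity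
    have h2 : ε⁻¹ * (|w x| - ε * |b|) ^ 2 = ε⁻¹ * w x ^ 2 - 2 * (|w x| * |b|) + ε * b ^ 2 := by
      rw [← sq_abs (w x), ← sq_abs b]
      field_simp
      ring
    have h3 : 0 ≤ |w x| * |b| := by positivity
    linarith

/-- Interaction of a remainder with a profile: after translation the profile is fixed and the
remainder is weakly null. -/
theorem tendsto_integral_abs_translate_mul (hN : 2 ≤ N) (hα₀ : 0 < α) (hα₁ : α < 1)
    {r : ℕ → HSpace N α} {K : ℝ} (hb : ∀ n, ‖r n‖ ≤ K) {y : ℕ → RN N}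
    (hr : WeakConv (fun n => translate (-y n) (r n)) 0) (w : HSpace N α) :
    Tendsto (fun n => ∫ x, |translate (y n) w x| * |r n x|) atTop (𝓝 0) := by
  refine (tendsto_integral_abs_mul hN hα₀ hα₁
    (fun n => (norm_translate _ _).trans_le (hb n)) hr w).congr fun n => ?_
  rw [← integral_add_right_eq_self (fun x => |translate (y n) w x| * |r n x|) (y n)]
  refine integral_congr_ae ?_
  have h := translate_neg_ae (y n) (translate (y n) w)
  rw [translate_neg_translate] at h
  filter_upwards [h, translate_neg_ae (y n) (r n)] with x h1 h2
  rw [h1, h2]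

end HSpace

/-! ### Strong convergence of vanishing remainders -/

namespace Subcritical
variable {N : ℕ} {p : ℝ} {f : RN N → ℝ → ℝ}

/-- Keeping 1 - η nonnegative allows (1 - η)∫u² to be replaced by (1 - η)‖u‖². -/
theorem exists_slope_le_one (hf : Subcritical p f) :
    ∃ η > 0, η ≤ 1 ∧ ∃ δ > 0, ∀ x s, |s| ≤ δ → f x s * s ≤ (1 - η) * s ^ 2 := by
  obtain ⟨η, hη, δ, hδ, h⟩ := hf.slope
  refine ⟨min η 1, by positivity, min_le_right _ _, δ, hδ, fun x s hs => (h x s hs).trans ?_⟩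
  have := min_le_left η 1
  gcongr

/-- The pointwise estimate behind strong convergence; r is the remainder and s the rest of u = r +
s. Where |u| ≤ δ the slope condition acts. Where |u| > δ, either |r| > δ/2 and the tail term pays,
or |r| ≤ |s| and the mixed term pays. -/
theorem exists_mul_remainder_le (hp : 2 < p) (hf : Subcritical p f) :
    ∃ η > 0, η ≤ 1 ∧ ∃ δ > 0, ∀ ε > 0, ∃ C ≥ 0, ∀ x s r, f x (r + s) * r ≤
      (1 - η) * r ^ 2 + C * (2 * (|s| * |r|) + HSpace.tailSq δ r) +
        ε * (pw p (r + s) + pw p r) := by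
  obtain ⟨η, hη, hη1, δ, hδ, hsl⟩ := hf.exists_slope_le_one
  refine ⟨η, hη, hη1, δ / 2, by positivity, fun ε hε => ?_⟩
  obtain ⟨C, hC, hgr⟩ := hf.growth ε hε
  refine ⟨C + ε * δ ^ (p - 2), by positivity, fun x s r => ?_⟩
  set u := r + s with hu
  have htail := HSpace.tailSq_nonneg (δ / 2) r
  have hpu := pw_nonneg p u
  have hpr := pw_nonneg p r
  have hsr : 0 ≤ |s| * |r| := by positivity
  have hη' : 0 ≤ (1 - η) * r ^ 2 := mul_nonneg (by linarith) (sq_nonneg _)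
  have hδp : 0 ≤ ε * δ ^ (p - 2) := by positivity
  have h1 := mul_nonneg hC htail
  have h2 := mul_nonneg hδp htail
  have h3 := mul_nonneg hε.le (add_nonneg hpu hpr)
  have h4 := mul_nonneg hC hsr
  have h5 := mul_nonneg hδp hsr
  rcases le_or_gt |u| δ with h | h
  · rcases eq_or_ne u 0 with h0 | h0
    · have hf0 : f x u = 0 := by
        have := hgr x u
        rw [h0, abs_zero, mul_zero, Real.zero_rpow (by linarith), mul_zero, add_zero] at this
        rw [h0]
        exact abs_nonpos_iff.1 this
      rw [hf0, zero_mul]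
      nlinarith
    · have hu0 : 0 < |u| := abs_pos.2 h0
      -- The one-sided bound on q multiplies r², so f(x,u)/u may be very negative; the cruder bound
      -- on |q| is spent on the mixed term.
      set q := f x u / u with hq
      have hfq : f x u = q * u := by rw [hq]; field_simp
      have hq1 : q ≤ 1 - η := by
        have h6 := hsl x u h
        rw [hfq] at h6
        have h7 : 0 < u ^ 2 := by positivity
        nlinarith
      have hq2 : |q| ≤ C + ε * δ ^ (p - 2) := by
        rw [hq, abs_div, div_le_iff₀ hu0]
        refine (hgr x u).trans ?_
        have e : |u| ^ (p - 1) = |u| ^ (p - 2) * |u| := by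
          rw [← Real.rpow_add_one hu0.ne']; congr 1; ring
        have h8 : |u| ^ (p - 2) ≤ δ ^ (p - 2) := Real.rpow_le_rpow hu0.le h (by linarith)
        rw [e, add_mul, mul_assoc]
        gcongr
      have h9 : q * r ^ 2 ≤ (1 - η) * r ^ 2 := by gcongr
      have h10 : q * (s * r) ≤ (C + ε * δ ^ (p - 2)) * (|s| * |r|) := by
        refine (le_abs_self _).trans ?_
        rw [abs_mul, abs_mul]
        gcongr
      have e : f x u * r = q * r ^ 2 + q * (s * r) := by rw [hfq, hu]; ring
      rw [e]
      nlinarith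
  · have hur : |u| ≤ |r| + |s| := abs_add_le _ _
    have h6 : |u| * |r| ≤ 2 * (|s| * |r|) + HSpace.tailSq (δ / 2) r := by
      unfold HSpace.tailSq
      have hr0 := abs_nonneg r
      split_ifs with h7
      · rw [← sq_abs r]
        nlinarith
      · have h8 : |r| ≤ |s| := by linarith
        nlinarith
    have h7 : |u| ^ (p - 1) * |r| ≤ pw p u + pw p r := by
      obtain ⟨m, hm1, hm2, hm3⟩ : ∃ m, |u| ≤ m ∧ |r| ≤ m ∧ m ^ p ≤ pw p u + pw p r := by
        rcases le_total |u| |r| with h | h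
        · exact ⟨|r|, h, le_rfl, by unfold pw at *; linarith [sq_nonneg r]⟩
        · exact ⟨|u|, le_rfl, h, by unfold pw at *; linarith [sq_nonneg u]⟩
      have hm0 : 0 < m := (hδ.trans h).trans_le hm1
      calc |u| ^ (p - 1) * |r| ≤ m ^ (p - 1) * m := by gcongr; linarith
        _ = m ^ p := by rw [← Real.rpow_add_one hm0.ne', sub_add_cancel]
        _ ≤ _ := hm3
    have h8 : f x u * r ≤ (C * |u| + ε * |u| ^ (p - 1)) * |r| := by
      refine (le_abs_self _).trans ?_
      rw [abs_mul]
      gcongr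
      exact hgr x u
    have h9 := mul_le_mul_of_nonneg_left h6 hC
    have h10 := mul_le_mul_of_nonneg_left h7 hε.le
    nlinarith

/-- For |s| > δ the quadratic term of the growth bound is at most δ^(2-p) |s|^p. -/
theorem exists_mul_self_le (hp : 2 < p) (hf : Subcritical p f) :
    ∃ η > 0, η ≤ 1 ∧ ∃ C > 0, ∀ x s, f x s * s ≤ (1 - η) * s ^ 2 + C * |s| ^ p := by
  obtain ⟨η, hη, hη1, δ, hδ, hsl⟩ := hf.exists_slope_le_one
  obtain ⟨C, hC, hgr⟩ := hf.exists_growth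
  refine ⟨η, hη, hη1, C * (δ ^ (2 - p) + 1) + 1, by positivity, fun x s => ?_⟩
  rcases le_or_gt |s| δ with h | h
  · have := hsl x s h
    have h2 : 0 ≤ (C * (δ ^ (2 - p) + 1) + 1) * |s| ^ p := by positivity
    linarith
  · have hs0 : 0 < |s| := hδ.trans h
    have h1 : |s| * |s| ≤ δ ^ (2 - p) * |s| ^ p := by
      have e : |s| * |s| = |s| ^ (2 - p) * |s| ^ p := by
        rw [← Real.rpow_add hs0, ← sq]; norm_num
      rw [e]
      gcongr ?_ * _
      exact Real.rpow_le_rpow_of_nonpos hδ h.le (by linarith)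
    have h2 : |s| ^ (p - 1) * |s| = |s| ^ p := by
      rw [← Real.rpow_add_one hs0.ne', sub_add_cancel]
    have h3 : 0 ≤ (1 - η) * s ^ 2 := mul_nonneg (by linarith) (sq_nonneg _)
    calc f x s * s ≤ |f x s| * |s| := by rw [← abs_mul]; exact le_abs_self _
      _ ≤ C * (|s| + |s| ^ (p - 1)) * |s| := by gcongr; exact hgr x s
      _ = C * (|s| * |s| + |s| ^ p) := by rw [← h2]; ring
      _ ≤ C * (δ ^ (2 - p) * |s| ^ p + |s| ^ p) := by gcongr
      _ ≤ (1 - η) * s ^ 2 + (C * (δ ^ (2 - p) + 1) + 1) * |s| ^ p := by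
        have : 0 ≤ |s| ^ p := by positivity
        nlinarith

end Subcritical

namespace HSpace
variable {N : ℕ} {α : ℝ} {f g : RN N → ℝ → ℝ}

/-- Nonzero critical points have norm bounded away from zero. -/
theorem exists_le_norm_of_critical (hN : 2 ≤ N) (hα₀ : 0 < α) (hα₁ : α < 1)
    (hf : Subcritical (critExp N α) f) :
    ∃ ρ > 0, ∀ w : HSpace N α, w ≠ 0 →
      (∀ φ : HSpace N α, inner ℝ w φ = ∫ x, f x (w x) * φ x) → ρ ≤ ‖w‖ := by
  have hp := two_lt_critExp hN hα₀ hα₁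
  obtain ⟨S, hS, hsob⟩ := exists_sobolev (N := N) hN hα₀ hα₁
  obtain ⟨η, hη, hη1, C, hC, h⟩ := hf.exists_mul_self_le hp
  -- Testing the equation with w and using Sobolev gives η‖w‖² ≤ CS‖w‖^p, and ρ solves η = CS
  -- ρ^(p-2).
  refine ⟨(η / (C * S)) ^ (1 / (critExp N α - 2)), by positivity, fun w hw hcr => ?_⟩
  have hn : 0 < ‖w‖ := norm_pos_iff.2 hw
  have hi1 := (integrable_sq_L2R w.toL2).const_mul (1 - η)
  have hi2 := (hsob w).1.const_mul C
  have h1 : ‖w‖ ^ 2 ≤ ∫ x, ((1 - η) * w x ^ 2 + C * |w x| ^ critExp N α) := by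
    rw [← real_inner_self_eq_norm_sq, hcr w]
    exact integral_mono (integrable_mul hN hα₀ hα₁ hf w w) (hi1.add hi2) fun x => h x (w x)
  rw [integral_add hi1 hi2, integral_const_mul, integral_const_mul] at h1
  have h2 := mul_le_mul_of_nonneg_left (integral_sq_le hα₀.le w) (by linarith : 0 ≤ 1 - η)
  have h3 := mul_le_mul_of_nonneg_left (hsob w).2 hC.le
  have e : ‖w‖ ^ critExp N α = ‖w‖ ^ (critExp N α - 2) * ‖w‖ ^ 2 := by
    rw [← Real.rpow_natCast, ← Real.rpow_add hn]; congr 1; push_cast; ring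
  rw [e] at h3
  have h4 : η * ‖w‖ ^ 2 ≤ C * S * ‖w‖ ^ (critExp N α - 2) * ‖w‖ ^ 2 := by nlinarith
  have h5 : η ≤ C * S * ‖w‖ ^ (critExp N α - 2) := le_of_mul_le_mul_right h4 (by positivity)
  have h6 : η / (C * S) ≤ ‖w‖ ^ (critExp N α - 2) := by
    rw [div_le_iff₀ (by positivity)]; linarith
  have hp2 : 0 < critExp N α - 2 := by linarith
  calc _ ≤ (‖w‖ ^ (critExp N α - 2)) ^ (1 / (critExp N α - 2)) := by gcongr
    _ = ‖w‖ := by rw [← Real.rpow_mul hn.le, mul_one_div_cancel hp2.ne', Real.rpow_one]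

/-- A remainder without low frequency concentration tends to zero strongly. -/
theorem tendsto_norm_of_vanishes (hN : 2 ≤ N) (hα₀ : 0 < α) (hα₁ : α < 1)
    (hf : Subcritical (critExp N α) f) {r s : ℕ → HSpace N α} {K : ℝ} (hrb : ∀ n, ‖r n‖ ≤ K)
    (hub : ∀ n, ‖r n + s n‖ ≤ K) (hr : Vanishes r)
    (hs : Tendsto (fun n => ∫ x, |s n x| * |r n x|) atTop (𝓝 0))
    (hsr : Tendsto (fun n => inner ℝ (s n) (r n)) atTop (𝓝 (0 : ℝ)))
    (hder : Tendsto (fun n => fderiv ℝ (energy f) (r n + s n)) atTop (𝓝 0)) :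
    Tendsto (fun n => ‖r n‖) atTop (𝓝 0) := by
  have hp := two_lt_critExp hN hα₀ hα₁
  obtain ⟨M, hM, hM2⟩ := exists_integral_pw_le (N := N) hN hα₀ hα₁ K
  obtain ⟨η, hη, hη1, δ, hδ, h⟩ := hf.exists_mul_remainder_le hp
  have hd : Tendsto (fun n => fderiv ℝ (energy f) (r n + s n) (r n)) atTop (𝓝 0) := by
    refine squeeze_zero_norm (a := fun n => ‖fderiv ℝ (energy f) (r n + s n)‖ * K) (fun n => ?_) ?_
    · exact (ContinuousLinearMap.le_opNorm _ _).trans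
        (mul_le_mul_of_nonneg_left (hrb n) (norm_nonneg _))
    · simpa using (tendsto_norm_clm hder).mul_const K
  have ht := hr.tendsto_tailSq hα₀ hrb hδ
  have hsq : Tendsto (fun n => ‖r n‖ ^ 2) atTop (𝓝 0) := by
    refine tendsto_order.2 ⟨fun a ha => Eventually.of_forall fun n => ha.trans_le (sq_nonneg _),
      fun a ha => ?_⟩
    -- Chosen so that the critical powers, of total integral at most 2M, cost less than ηa/2; the
    -- other half is left for the terms that tend to zero.
    set ε := η * a / (4 * (M + 1)) with hε
    have hε0 : 0 < ε := by positivity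
    obtain ⟨C, hC, hle⟩ := h ε hε0
    -- Everything besides η‖r‖² and the critical powers: mixed and tail terms, J'(r + s) applied to
    -- r, and the scalar product of s with r.
    have hsum := ((((hs.const_mul 2).add ht).const_mul C).add hd).sub hsr
    simp only [mul_zero, add_zero, sub_zero] at hsum
    filter_upwards [(tendsto_order.1 hsum).2 (η * a / 2) (by positivity)] with n hn
    obtain ⟨L, hL, hLd⟩ := exists_hasFDerivAt_energy hN hα₀ hα₁ hf (r n + s n)
    rw [hLd.fderiv, hL, inner_add_left, real_inner_self_eq_norm_sq] at hn
    have hi1 := (integrable_sq_L2R (r n).toL2).const_mul (1 - η)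
    have hi2 : Integrable (fun x => 2 * (|s n x| * |r n x|) + tailSq δ (r n x)) :=
      ((integrable_abs_mul (s n) (r n)).const_mul 2).add (integrable_tailSq δ (r n))
    have hi3 : Integrable (fun x => pw (critExp N α) ((r n + s n) x) + pw (critExp N α) (r n x)) :=
      (integrable_pw hN hα₀ hα₁ _).add (integrable_pw hN hα₀ hα₁ _)
    have h12 : Integrable (fun x => (1 - η) * r n x ^ 2 +
        C * (2 * (|s n x| * |r n x|) + tailSq δ (r n x))) := hi1.add (hi2.const_mul C)
    have h1 : ∫ x, f x ((r n + s n) x) * r n x ≤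
        ∫ x, ((1 - η) * r n x ^ 2 + C * (2 * (|s n x| * |r n x|) + tailSq δ (r n x)) +
          ε * (pw (critExp N α) ((r n + s n) x) + pw (critExp N α) (r n x))) := by
      refine integral_mono_ae (integrable_mul hN hα₀ hα₁ hf _ _) (h12.add (hi3.const_mul ε)) ?_
      filter_upwards [coe_add (r n) (s n)] with x hx
      have := hle x (s n x) (r n x)
      rwa [← hx] at this
    rw [integral_add h12 (hi3.const_mul ε), integral_add hi1 (hi2.const_mul C),
      integral_const_mul, integral_const_mul, integral_const_mul,
      integral_add ((integrable_abs_mul (s n) (r n)).const_mul 2) (integrable_tailSq δ (r n)),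
      integral_const_mul, integral_add (integrable_pw hN hα₀ hα₁ _)
        (integrable_pw hN hα₀ hα₁ _)] at h1
    have h2 := mul_le_mul_of_nonneg_left (integral_sq_le hα₀.le (r n)) (by linarith : 0 ≤ 1 - η)
    have h3 := mul_le_mul_of_nonneg_left (add_le_add (hM2 _ (hub n)) (hM2 _ (hrb n))) hε0.le
    have h4 : ε * (M + M) < η * a / 2 := by
      have : ε * (4 * (M + 1)) = η * a := by rw [hε]; field_simp
      nlinarith
    have h5 : η * ‖r n‖ ^ 2 < η * a := by linarith
    exact lt_of_mul_lt_mul_left h5 hη.le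
  have h3 := hsq.sqrt
  simpa only [Real.sqrt_sq (norm_nonneg _), Real.sqrt_zero] using h3

end HSpace

/-! ### Extraction of profiles -/

theorem WeakConv.unique {E : Type*} [NormedAddCommGroup E] [InnerProductSpace ℝ E] {v : ℕ → E}
    {a b : E} (ha : WeakConv v a) (hb : WeakConv v b) : a = b :=
  ext_inner_right ℝ fun φ => tendsto_nhds_unique (ha φ) (hb φ)

namespace HSpace
variable {N : ℕ} {α : ℝ}

theorem low_zero (A : ℝ) (x : RN N) : low A (0 : HSpace N α) x = 0 := by
  simpa using low_smul A 0 (0 : HSpace N α) x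

theorem translate_map_zero (y : RN N) : translate y (0 : HSpace N α) = 0 := by
  simpa using translate_sub y (0 : HSpace N α) 0

/-- Translations producing different weak limits drift apart. -/
theorem tendsto_norm_sub_of_weakConv {R : ℕ → HSpace N α} {K : ℝ} (hb : ∀ n, ‖R n‖ ≤ K)
    {y z : ℕ → RN N} {w : HSpace N α} (hw : w ≠ 0)
    (hy : WeakConv (fun n => translate (-y n) (R n)) 0)
    (hz : WeakConv (fun n => translate (-z n) (R n)) w) :
    Tendsto (fun n => ‖z n - y n‖) atTop atTop := by
  by_contra h
  rw [tendsto_atTop] at h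
  push Not at h
  obtain ⟨B, hB⟩ := h
  have hfr : ∃ᶠ n in atTop, z n - y n ∈ Metric.closedBall (0 : RN N) B := by
    refine hB.mono fun n hn => ?_
    rw [mem_closedBall_zero_iff]
    exact hn.le
  -- If z - y stays bounded infinitely often, it converges to some d along a subsequence. The
  -- translates by -z then differ from those by -y by a convergent translation, so their weak limit
  -- would be zero.
  obtain ⟨d, -, j, hj, hd⟩ := tendsto_subseq_of_frequently_bounded Metric.isBounded_closedBall hfr
  have h1 := (hy.comp hj.tendsto_atTop).translate
    (fun n => (norm_translate _ _).trans_le (hb (j n))) hd.neg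
  rw [translate_map_zero] at h1
  refine hw ((hz.comp hj.tendsto_atTop).unique ?_)
  refine fun φ => (h1 φ).congr fun n => ?_
  simp only [translate_translate, Function.comp_apply]
  congr 2
  abel

/-- A sequence that does not vanish has, after translation, a nonzero weak limit along a
subsequence. -/
theorem exists_profile_of_not_vanishes (hN : 2 ≤ N) (hα₀ : 0 < α) (hα₁ : α < 1)
    {r : ℕ → HSpace N α} {K : ℝ} (hb : ∀ n, ‖r n‖ ≤ K) (hr : ¬ Vanishes r) :
    ∃ (j : ℕ → ℕ) (z : ℕ → RN N) (w : HSpace N α), StrictMono j ∧ w ≠ 0 ∧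
      WeakConv (fun n => translate (-z n) (r (j n))) w := by
  have := completeSpace (N := N) hα₀.le
  unfold Vanishes at hr
  push Not at hr
  obtain ⟨A, hA, ε, hε, hfr⟩ := hr
  obtain ⟨j₁, hj₁, h1⟩ := extraction_of_frequently_atTop hfr
  choose z hz using h1
  obtain ⟨w, j₂, hj₂, hw⟩ := WeakConv.exists_subseq
    (v := fun n => translate (-z n) (r (j₁ n))) fun n => (norm_translate _ _).trans_le (hb (j₁ n))
  refine ⟨j₁ ∘ j₂, z ∘ j₂, w, hj₁.comp hj₂, fun h0 => ?_, hw⟩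
  -- After translation the large values of the low part all sit at the origin, and evaluation there
  -- is weakly continuous.
  have h2 := (tendsto_low hN hα₀ hα₁ hA hw 0).norm
  rw [h0, low_zero, norm_zero] at h2
  refine hε.not_ge (ge_of_tendsto' h2 fun n => ?_)
  rw [low_translate, sub_neg_eq_add, zero_add]
  exact (hz (j₂ n)).le

/-- The remainder after removal of `u₀` and of the translated profiles `ω i`. -/
def remainder {ℓ : ℕ} (u : ℕ → HSpace N α) (u₀ : HSpace N α) (k : ℕ → ℕ) (ω : Fin ℓ → HSpace N α)
    (y : Fin ℓ → ℕ → RN N) (n : ℕ) : HSpace N α :=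
  u (k n) - u₀ - ∑ i, translate (y i n) (ω i)

/-- A decomposition of a subsequence of `u` into `u₀`, finitely many escaping profiles that are
critical points of the limit functional, and a remainder that converges weakly to zero around each
profile. -/
structure ProfileDecomp (f : RN N → ℝ → ℝ) (finf : ℝ → ℝ) (u : ℕ → HSpace N α) (u₀ : HSpace N α)
    {ℓ : ℕ} (k : ℕ → ℕ) (ω : Fin ℓ → HSpace N α) (y : Fin ℓ → ℕ → RN N) : Prop where
  strictMono : StrictMono k
  escape : ∀ i, Tendsto (fun n => ‖y i n‖) atTop atTop
  separate : ∀ i j, i ≠ j → Tendsto (fun n => ‖y i n - y j n‖) atTop atTop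
  ne_zero : ∀ i, ω i ≠ 0
  critical : ∀ i, ∀ φ : HSpace N α, inner ℝ (ω i) φ = ∫ x, finf (ω i x) * φ x
  weak_zero : WeakConv (remainder u u₀ k ω y) 0
  weak : ∀ i, WeakConv (fun n => translate (-y i n) (remainder u u₀ k ω y n)) 0
  norm_sq : Tendsto (fun n => ‖u (k n)‖ ^ 2 - ‖remainder u u₀ k ω y n‖ ^ 2) atTop
    (𝓝 (‖u₀‖ ^ 2 + ∑ i, ‖ω i‖ ^ 2))
  nl_split : Tendsto (fun n => nl f (u (k n)) - nl f (remainder u u₀ k ω y n)) atTop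
    (𝓝 (nl f u₀ + ∑ i, nl (fun _ => finf) (ω i)))

namespace ProfileDecomp
variable {f : RN N → ℝ → ℝ} {finf : ℝ → ℝ} {u : ℕ → HSpace N α} {u₀ : HSpace N α} {ℓ : ℕ}
  {k : ℕ → ℕ} {ω : Fin ℓ → HSpace N α} {y : Fin ℓ → ℕ → RN N}

theorem comp (h : ProfileDecomp f finf u u₀ k ω y) {j : ℕ → ℕ} (hj : StrictMono j) :
    ProfileDecomp f finf u u₀ (k ∘ j) ω (fun i n => y i (j n)) where
  strictMono := h.strictMono.comp hj
  escape i := (h.escape i).comp hj.tendsto_atTop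
  separate i l hil := (h.separate i l hil).comp hj.tendsto_atTop
  ne_zero := h.ne_zero
  critical := h.critical
  weak_zero := h.weak_zero.comp hj.tendsto_atTop
  weak i := (h.weak i).comp hj.tendsto_atTop
  norm_sq := h.norm_sq.comp hj.tendsto_atTop
  nl_split := h.nl_split.comp hj.tendsto_atTop

theorem norm_remainder_le {K : ℝ} (hb : ∀ n, ‖u n‖ ≤ K) (n : ℕ) :
    ‖remainder u u₀ k ω y n‖ ≤ K + ‖u₀‖ + ∑ i, ‖ω i‖ := by
  unfold remainder
  refine (norm_sub_le _ _).trans (add_le_add ((norm_sub_le _ _).trans ?_) ?_)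
  · gcongr
    exact hb _
  · exact norm_sum_le_of_le _ fun i _ => (norm_translate _ _).le

theorem remainder_snoc (w : HSpace N α) (z : ℕ → RN N) (n : ℕ) :
    remainder u u₀ k (Fin.snoc ω w : Fin (ℓ + 1) → HSpace N α)
      (Fin.snoc y z : Fin (ℓ + 1) → ℕ → RN N) n =
      remainder u u₀ k ω y n - translate (z n) w := by
  unfold remainder
  rw [Fin.sum_univ_castSucc]
  simp only [Fin.snoc_castSucc, Fin.snoc_last]
  abel

/-- Seen from z, the remainder and the sequence u differ by u₀ and profiles that escape to infinity.
So the translates of u have the same weak limit w, and the Palais–Smale property is inherited from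
u. -/
theorem critical_of_weakConv (hN : 2 ≤ N) (hα₀ : 0 < α) (hα₁ : α < 1)
    (hf : Nonlinearity N α f finf) {K : ℝ} (hb : ∀ n, ‖u n‖ ≤ K)
    (hder : Tendsto (fun n => fderiv ℝ (energy f) (u n)) atTop (𝓝 0))
    (h : ProfileDecomp f finf u u₀ k ω y) {z : ℕ → RN N} {w : HSpace N α}
    (hz : Tendsto (fun n => ‖z n‖) atTop atTop)
    (hzy : ∀ i, Tendsto (fun n => ‖z n - y i n‖) atTop atTop)
    (hw : WeakConv (fun n => translate (-z n) (remainder u u₀ k ω y n)) w) (φ : HSpace N α) :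
    inner ℝ w φ = ∫ x, finf (w x) * φ x := by
  refine inner_eq_of_weakConv hN hα₀ hα₁ hf.subcritical_left (hf.subcritical_lim hN)
    (hf.limAt_of_norm_tendsto hz) (u := fun n => u (k n)) (fun n => hb (k n)) ?_
    (hder.comp h.strictMono.tendsto_atTop) φ
  have h1 : WeakConv (fun n => translate (-z n) u₀) 0 :=
    weakConv_translate_of_norm_tendsto (by simpa using hz) u₀
  have h2 : WeakConv (fun n => ∑ i, translate (-z n + y i n) (ω i)) 0 :=
    WeakConv.sum_zero Finset.univ fun i _ => weakConv_translate_of_norm_tendsto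
      ((hzy i).congr fun n => by rw [← norm_neg, neg_sub, sub_eq_neg_add]) (ω i)
  have h3 := (hw.add h1).add h2
  rw [add_zero, add_zero] at h3
  refine fun ψ => (h3 ψ).congr fun n => ?_
  congr 1
  simp_rw [← translate_translate]
  rw [← translate_sum, ← translate_add, ← translate_add, remainder]
  congr 1
  abel

/-- Adding one more profile. -/
theorem snoc (hN : 2 ≤ N) (hα₀ : 0 < α) (hα₁ : α < 1)
    (hf : Nonlinearity N α f finf) {K : ℝ} (hb : ∀ n, ‖u n‖ ≤ K)
    (hder : Tendsto (fun n => fderiv ℝ (energy f) (u n)) atTop (𝓝 0))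
    (h : ProfileDecomp f finf u u₀ k ω y) {z : ℕ → RN N} {w : HSpace N α} (hw0 : w ≠ 0)
    (hw : WeakConv (fun n => translate (-z n) (remainder u u₀ k ω y n)) w) :
    ProfileDecomp f finf u u₀ k (Fin.snoc ω w : Fin (ℓ + 1) → HSpace N α)
      (Fin.snoc y z : Fin (ℓ + 1) → ℕ → RN N) := by
  have hrb := norm_remainder_le (u₀ := u₀) (k := k) (ω := ω) (y := y) hb
  have hzy : ∀ i, Tendsto (fun n => ‖z n - y i n‖) atTop atTop := fun i =>
    tendsto_norm_sub_of_weakConv hrb hw0 (h.weak i) hw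
  have hz : Tendsto (fun n => ‖z n‖) atTop atTop := by
    -- The origin counts as one more centre, so z itself escapes.
    have h1 := tendsto_norm_sub_of_weakConv (y := fun _ => 0) hrb hw0
      (by simpa only [neg_zero, translate_zero] using h.weak_zero) hw
    simpa only [sub_zero] using h1
  have hzw := weakConv_translate_of_norm_tendsto hz w
  refine ⟨h.strictMono, fun i => ?_, fun i j hij => ?_, fun i => ?_, fun i => ?_, ?_, fun i => ?_,
    ?_, ?_⟩
  · refine Fin.lastCases ?_ (fun i => ?_) i
    · simpa only [Fin.snoc_last] using hz
    · simpa only [Fin.snoc_castSucc] using h.escape i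
  · revert hij
    refine Fin.lastCases ?_ (fun i => ?_) i <;> refine Fin.lastCases ?_ (fun j => ?_) j
    · exact fun hij => absurd rfl hij
    · intro _
      simpa only [Fin.snoc_castSucc, Fin.snoc_last] using hzy j
    · intro _
      simpa only [Fin.snoc_castSucc, Fin.snoc_last, norm_sub_rev] using hzy i
    · intro hij
      simpa only [Fin.snoc_castSucc] using h.separate i j fun e => hij (by rw [e])
  · refine Fin.lastCases ?_ (fun i => ?_) i
    · simpa only [Fin.snoc_last] using hw0
    · simpa only [Fin.snoc_castSucc] using h.ne_zero i
  · refine Fin.lastCases ?_ (fun i => ?_) i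
    · simpa only [Fin.snoc_last] using h.critical_of_weakConv hN hα₀ hα₁ hf hb hder hz hzy hw
    · simpa only [Fin.snoc_castSucc] using h.critical i
  · have h1 := h.weak_zero.sub hzw
    rw [sub_zero] at h1
    exact fun φ => (h1 φ).congr fun n => by rw [remainder_snoc]
  · simp_rw [remainder_snoc, translate_sub]
    refine Fin.lastCases ?_ (fun i => ?_) i
    · have h1 := hw.sub (WeakConv.const w)
      rw [sub_self] at h1
      exact fun φ => (h1 φ).congr fun n => by simp only [Fin.snoc_last, translate_neg_translate]
    · have h1 := (h.weak i).sub (weakConv_translate_of_norm_tendsto (hzy i) w)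
      rw [sub_zero] at h1
      exact fun φ => (h1 φ).congr fun n => by
        simp only [Fin.snoc_castSucc, translate_translate, neg_add_eq_sub]
  · rw [Fin.sum_univ_castSucc]
    simp only [Fin.snoc_castSucc, Fin.snoc_last, remainder_snoc]
    -- Expanding ‖r - w(· - z)‖² leaves 2⟨r(· + z), w⟩ - ‖w‖², which tends to ‖w‖².
    have h1 := h.norm_sq.add (((hw w).const_mul 2).sub_const (‖w‖ ^ 2))
    have e : ‖u₀‖ ^ 2 + ∑ i, ‖ω i‖ ^ 2 + (2 * inner ℝ w w - ‖w‖ ^ 2) =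
        ‖u₀‖ ^ 2 + (∑ i, ‖ω i‖ ^ 2 + ‖w‖ ^ 2) := by
      rw [real_inner_self_eq_norm_sq]; ring
    rw [e] at h1
    refine h1.congr fun n => ?_
    rw [norm_sub_sq_real, norm_translate, inner_translate_left, neg_neg]
    ring
  · rw [Fin.sum_univ_castSucc]
    simp only [Fin.snoc_castSucc, Fin.snoc_last, remainder_snoc]
    have h1 := h.nl_split.add (tendsto_nl_sub hN hα₀ hα₁ hf.subcritical_left
      (hf.subcritical_lim hN) (hf.limAt_of_norm_tendsto hz) hrb hw)
    rw [add_assoc] at h1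
    exact h1.congr fun n => by ring

theorem sum_le {K : ℝ} (hb : ∀ n, ‖u n‖ ≤ K) (h : ProfileDecomp f finf u u₀ k ω y) :
    ∑ i, ‖ω i‖ ^ 2 ≤ K ^ 2 := by
  have h1 := le_of_tendsto' h.norm_sq (b := K ^ 2) fun n => by
    have := pow_le_pow_left₀ (norm_nonneg _) (hb (k n)) 2
    linarith [sq_nonneg ‖remainder u u₀ k ω y n‖]
  linarith [sq_nonneg ‖u₀‖]

/-- The start of the extraction: the weak limit is treated as a profile centred at the origin, with
f as its own limit nonlinearity. -/
theorem exists_nil (hN : 2 ≤ N) (hα₀ : 0 < α) (hα₁ : α < 1)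
    (hf : Nonlinearity N α f finf) {K : ℝ} (hb : ∀ n, ‖u n‖ ≤ K)
    (hder : Tendsto (fun n => fderiv ℝ (energy f) (u n)) atTop (𝓝 0)) :
    ∃ (u₀ : HSpace N α) (k : ℕ → ℕ), IsCritical (energy f) u₀ ∧
      ProfileDecomp f finf u u₀ k (Fin.elim0 : Fin 0 → HSpace N α) Fin.elim0 := by
  have := completeSpace (N := N) hα₀.le
  have hs := hf.subcritical_left
  obtain ⟨u₀, k, hk, hw⟩ := WeakConv.exists_subseq hb
  have hw' : WeakConv (fun n => translate (-(fun _ => 0 : ℕ → RN N) n) (u (k n))) u₀ := by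
    simpa only [neg_zero, translate_zero] using hw
  have e : ∀ n, remainder u u₀ k (Fin.elim0 : Fin 0 → HSpace N α) Fin.elim0 n = u (k n) - u₀ :=
    fun n => by simp [remainder]
  have hr := hw.sub (WeakConv.const u₀)
  rw [sub_self] at hr
  refine ⟨u₀, k, (isCritical_iff hN hα₀ hα₁ hs u₀).2 fun φ => ?_, hk, fun i => i.elim0,
    fun i => i.elim0, fun i => i.elim0, fun i => i.elim0, ?_, fun i => i.elim0, ?_, ?_⟩
  · exact inner_eq_of_weakConv hN hα₀ hα₁ hs hs hs.limAt_zero (fun n => hb (k n)) hw'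
      (hder.comp hk.tendsto_atTop) φ
  · exact fun φ => (hr φ).congr fun n => by rw [e]
  · simp only [e, Finset.univ_eq_empty, Finset.sum_empty, add_zero]
    have h1 := ((hw u₀).const_mul 2).sub_const (‖u₀‖ ^ 2)
    have e2 : 2 * inner ℝ u₀ u₀ - ‖u₀‖ ^ 2 = ‖u₀‖ ^ 2 := by
      rw [real_inner_self_eq_norm_sq]; ring
    rw [e2] at h1
    refine h1.congr fun n => ?_
    rw [norm_sub_sq_real]
    ring
  · simp only [e, Finset.univ_eq_empty, Finset.sum_empty, add_zero]
    have h1 := tendsto_nl_sub hN hα₀ hα₁ hs hs hs.limAt_zero (fun n => hb (k n)) hw'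
    simpa only [translate_zero] using h1

/-- The number of profiles is bounded, so the extraction stops with a vanishing remainder. -/
theorem exists_vanishes (hN : 2 ≤ N) (hα₀ : 0 < α) (hα₁ : α < 1)
    (hf : Nonlinearity N α f finf) {K : ℝ} (hb : ∀ n, ‖u n‖ ≤ K)
    (hder : Tendsto (fun n => fderiv ℝ (energy f) (u n)) atTop (𝓝 0)) {k₀ : ℕ → ℕ}
    (h₀ : ProfileDecomp f finf u u₀ k₀ (Fin.elim0 : Fin 0 → HSpace N α) Fin.elim0) :
    ∃ (ℓ : ℕ) (k : ℕ → ℕ) (ω : Fin ℓ → HSpace N α) (y : Fin ℓ → ℕ → RN N),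
      ProfileDecomp f finf u u₀ k ω y ∧ Vanishes (remainder u u₀ k ω y) := by
  by_contra! hcon
  have hall : ∀ ℓ : ℕ, ∃ (k : ℕ → ℕ) (ω : Fin ℓ → HSpace N α) (y : Fin ℓ → ℕ → RN N),
      ProfileDecomp f finf u u₀ k ω y := by
    intro ℓ
    induction ℓ with
    | zero => exact ⟨k₀, _, _, h₀⟩
    | succ ℓ ih =>
      obtain ⟨k, ω, y, h⟩ := ih
      obtain ⟨j, z, w, hj, hw0, hw⟩ := exists_profile_of_not_vanishes hN hα₀ hα₁
        (norm_remainder_le hb) (hcon ℓ k ω y h)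
      exact ⟨_, _, _, (h.comp hj).snoc hN hα₀ hα₁ hf hb hder hw0 hw⟩
  obtain ⟨ρ, hρ, hle⟩ := exists_le_norm_of_critical (N := N) hN hα₀ hα₁ (hf.subcritical_lim hN)
  -- With m profiles of norm at least ρ the sum of squares would exceed K².
  obtain ⟨m, hm⟩ := exists_nat_gt (K ^ 2 / ρ ^ 2)
  obtain ⟨k, ω, y, h⟩ := hall m
  have h1 : ∑ _i : Fin m, ρ ^ 2 ≤ ∑ i, ‖ω i‖ ^ 2 := Finset.sum_le_sum fun i _ =>
    pow_le_pow_left₀ hρ.le (hle (ω i) (h.ne_zero i) (h.critical i)) 2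
  rw [Finset.sum_const, Finset.card_univ, Fintype.card_fin, nsmul_eq_mul] at h1
  rw [div_lt_iff₀ (by positivity)] at hm
  linarith [h.sum_le hb]

theorem tendsto_norm_remainder (hN : 2 ≤ N) (hα₀ : 0 < α) (hα₁ : α < 1)
    (hf : Nonlinearity N α f finf) {K : ℝ} (hb : ∀ n, ‖u n‖ ≤ K)
    (hder : Tendsto (fun n => fderiv ℝ (energy f) (u n)) atTop (𝓝 0))
    (h : ProfileDecomp f finf u u₀ k ω y) (hv : Vanishes (remainder u u₀ k ω y)) :
    Tendsto (fun n => ‖remainder u u₀ k ω y n‖) atTop (𝓝 0) := by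
  set r := remainder u u₀ k ω y with hr
  -- All interactions of r with s vanish in the limit, because r is weakly null around the origin
  -- and around each centre.
  set s : ℕ → HSpace N α := fun n => u₀ + ∑ i, translate (y i n) (ω i) with hs
  have hrs : ∀ n, r n + s n = u (k n) := fun n => by
    simp only [hr, hs, remainder]
    abel
  have hrb : ∀ n, ‖r n‖ ≤ K + ‖u₀‖ + ∑ i, ‖ω i‖ := norm_remainder_le hb
  refine tendsto_norm_of_vanishes hN hα₀ hα₁ hf.subcritical_left (s := s) hrb (fun n => ?_) hv
    ?_ ?_ ?_
  · rw [hrs]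
    have : 0 ≤ ∑ i, ‖ω i‖ := Finset.sum_nonneg fun i _ => norm_nonneg _
    linarith [hb (k n), norm_nonneg u₀]
  · have h1 := (tendsto_integral_abs_mul hN hα₀ hα₁ hrb h.weak_zero u₀).add
      (tendsto_finsetSum Finset.univ fun i _ =>
        tendsto_integral_abs_translate_mul hN hα₀ hα₁ hrb (h.weak i) (ω i))
    rw [Finset.sum_const_zero, add_zero] at h1
    refine squeeze_zero (fun n => integral_nonneg fun x => by positivity) (fun n => ?_) h1
    have hi : ∀ i ∈ Finset.univ, Integrable (fun x => |translate (y i n) (ω i) x| * |r n x|) :=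
      fun i _ => integrable_abs_mul _ _
    rw [← integral_finsetSum _ hi, ← integral_add (integrable_abs_mul _ _)
      (integrable_finsetSum _ hi)]
    refine integral_mono_ae (integrable_abs_mul _ _) ((integrable_abs_mul _ _).add
      (integrable_finsetSum _ hi)) ?_
    filter_upwards [coe_add u₀ (∑ i, translate (y i n) (ω i)),
      coe_sum Finset.univ fun i => translate (y i n) (ω i)] with x h1 h2
    simp only [hs, h1, h2]
    rw [← Finset.sum_mul, ← add_mul]
    gcongr
    exact (abs_add_le _ _).trans (by gcongr; exact Finset.abs_sum_le_sum_abs _ _)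
  · have h1 := (h.weak_zero u₀).add (tendsto_finsetSum Finset.univ fun i _ => h.weak i (ω i))
    simp only [inner_zero_left, Finset.sum_const_zero, add_zero] at h1
    refine h1.congr fun n => ?_
    simp only [hs]
    rw [real_inner_comm (r n), inner_add_right, inner_sum]
    congr 1
    refine Finset.sum_congr rfl fun i _ => ?_
    rw [inner_translate_left, neg_neg]
  · simp_rw [hrs]
    exact hder.comp h.strictMono.tendsto_atTop

theorem nl_zero (f : RN N → ℝ → ℝ) : nl f (0 : HSpace N α) = 0 := by
  rw [nl]
  refine (integral_congr_ae ?_).trans (integral_zero _ _)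
  filter_upwards [coe_zero (N := N) (α := α)] with x hx
  rw [hx, Subcritical.prim_zero]

/-- Both parts of the energy split up to the remainder, whose contribution tends to zero by strong
convergence and continuity of `nl` at 0. -/
theorem level_eq (hN : 2 ≤ N) (hα₀ : 0 < α) (hα₁ : α < 1)
    (hf : Nonlinearity N α f finf) {c : ℝ}
    (hc : Tendsto (fun n => energy f (u n)) atTop (𝓝 c)) (h : ProfileDecomp f finf u u₀ k ω y)
    (hr : Tendsto (fun n => ‖remainder u u₀ k ω y n‖) atTop (𝓝 0)) :
    c = energy f u₀ + ∑ i, energyInf finf (ω i) := by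
  have h1 := (continuousAt_nl hN hα₀ hα₁ hf.subcritical_left (0 : HSpace N α)).tendsto.comp
    (tendsto_zero_iff_norm_tendsto_zero.2 hr)
  rw [nl_zero] at h1
  have h2 := ((h.norm_sq.add (hr.pow 2)).div_const 2).sub (h.nl_split.add h1)
  refine (tendsto_nhds_unique ((hc.comp h.strictMono.tendsto_atTop).congr fun n => ?_) h2).trans ?_
  · simp only [Function.comp_apply, energy_eq]
    ring
  · simp only [energyInf, energy_eq, Finset.sum_sub_distrib, ← Finset.sum_div]
    ring

end ProfileDecomp
end HSpace

end FracSchrodinger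

end

/-! ### The decomposition theorem -/

open FracSchrodinger
theorem proposition4p2 (N : ℕ) (hN : 2 ≤ N) (α : ℝ) (hα₀ : 0 < α) (hα₁ : α < 1)
    (f : RN N → ℝ → ℝ) (finf : ℝ → ℝ) (hf : Nonlinearity N α f finf)
    (hPoh : ∀ u : HSpace N α, IsWeakSolution finf u → pohozaev finf u = 0)
    (c : ℝ) (u : ℕ → HSpace N α) (hu : IsBoundedPS (energy f) c u) :
    ∃ (k : ℕ → ℕ) (ℓ : ℕ) (u₀ : HSpace N α) (ω : Fin ℓ → HSpace N α) (y : Fin ℓ → ℕ → RN N),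
      StrictMono k ∧
      (∀ i, Tendsto (fun n => ‖y i n‖) atTop atTop) ∧
      (∀ i j, i ≠ j → Tendsto (fun n => ‖y i n - y j n‖) atTop atTop) ∧
      IsCritical (energy f) u₀ ∧
      (∀ i, ω i ≠ 0 ∧ IsCritical (energyInf finf) (ω i)) ∧
      Tendsto (fun n => ‖u (k n) - u₀ - ∑ i, (ω i).translate (y i n)‖) atTop (𝓝 0) ∧
      c = energy f u₀ + ∑ i, energyInf finf (ω i) := by
  obtain ⟨K, hb⟩ := hu.bounded
  obtain ⟨u₀, k₀, hcr, h₀⟩ :=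
    HSpace.ProfileDecomp.exists_nil hN hα₀ hα₁ hf hb hu.tendsto_deriv
  obtain ⟨ℓ, k, ω, y, h, hv⟩ := h₀.exists_vanishes hN hα₀ hα₁ hf hb hu.tendsto_deriv
  have hr := h.tendsto_norm_remainder hN hα₀ hα₁ hf hb hu.tendsto_deriv hv
  exact ⟨k, ℓ, u₀, ω, y, h.strictMono, h.escape, h.separate, hcr, fun i => ⟨h.ne_zero i,
    (HSpace.isCritical_iff hN hα₀ hα₁ (hf.subcritical_lim hN) (ω i)).2 (h.critical i)⟩, hr,
    h.level_eq hN hα₀ hα₁ hf hu.tendsto_level hr⟩
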